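/- Let $\Sigma$ be a simply connected, oriented smooth four-manifold (Hausdorff, second countable) with a smooth action of $U(1)^2=U(1)\times U(1)$, and let $\xi_{(1)},\xi_{(2)}$ be the generators of the two factors. Let $(h,K,j)$ be maximal $U(1)^2$-invariant initial data on $\Sigma$: $h$ is a smooth Riemannian metric, $K$ a smooth symmetric covariant 2-tensor and $j$ a one-form, with $$\mathcal L_{\xi_{(k)}}h=\mathcal L_{\xi_{(k)}}K=0\quad(k=1,2),\qquad \mathrm{Tr}_hK=0,\qquad \mathrm{div}_hK=8\pi j .$$ (Every generalized Brill initial data set is of this kind; no decay condition, no global coordinate form of the metric and no condition on the energy density is needed.) For a compact smooth embedded hypersurface $S\subset\Sigma$ with unit normal field $n$ put $$J_{(i)}(S)=\frac1{8\pi}\int_S K_{\alpha\beta}\,n^\alpha\xi_{(i)}^\beta\,ds_h ,$$ where $ds_h$ is the Riemannian measure induced by $h$ on $S$. Let $i\in\{1,2\}$ and assume $\iota_{\xi_{(i)}}j=0$ on $\Sigma$. Then: 1. $J_{(i)}$ is conserved: if $N\subset\Sigma$ is a compact region with smooth boundary $\partial N=S_1\sqcup S_2$, where $S_1,S_2$ are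 $U(1)^2$-invariant compact hypersurfaces whose unit normals point into $N$ along $S_1$ and out of $N$ along $S_2$, then $J_{(i)}(S_1)=J_{(i)}(S_2)$. 2. Let $\Phi$ be a diffeomorphism of $\{x\in\mathbb R^4:|x|>R\}$, $R>0$, onto an open subset of $\Sigma$ (for example the coordinates in an asymptotically flat end), and for $r>R$ let $S_r=\Phi(\{|x|=r\})$, with the unit normal that points towards increasing $r$. Then the limit $J_{(i)}=\lim_{r\to\infty}J_{(i)}(S_r)$ exists, and $J_{(i)}(S)=J_{(i)}$ for every $U(1)^2$-invariant compact hypersurface $S$ that, together with some $S_r$, $r>R$, bounds a compact region as in 1 (with $S$ in the role of $S_1$ and $S_r$ in the role of $S_2$). 3. There is a global twist potential: a smooth function $Y^{(i)}:\Sigma\to\mathbb R$ with $$dY^{(i)}=2\star\bigl(S^{(i)}\wedge\xi_{(1)}\wedge\xi_{(2)}\bigr),\qquad S^{(i)}_\alpha=K_{\alpha\beta}\xi_{(i)}^\beta ,$$ where $\star$ is the Hodge star of $h$ and $\xi_{(1)},\xi_{(2)}$ also denote the one-forms $h(\xi_{(k)},\cdot)$. -/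

import Mathlib

open scoped Manifold ContDiff Topology
open Bundle MeasureTheory

noncomputable section

namespace TorusData

/-- The model space of a four-dimensional manifold. -/
abbrev E4 : Type := EuclideanSpace ℝ (Fin 4)

/-- The group `U(1) × U(1)`. -/
abbrev Torus : Type := Circle × Circle

/-- The model with corners of `U(1) × U(1)` as a Lie group. -/
abbrev torusModel := (𝓡 1).prod (𝓡 1)

/-! ### Tensor calculus in charts -/

section Charts

variable {M : Type*} [TopologicalSpace M] [ChartedSpace E4 M]

/-- The fields of bilinear forms (covariant 2-tensors) on a four-manifold. -/
abbrev Bilin (M : Type*) [TopologicalSpace M] [ChartedSpace E4 M] : Type _ :=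
  ∀ p : M, TangentSpace 𝓘(ℝ, E4) p →L[ℝ] TangentSpace 𝓘(ℝ, E4) p →L[ℝ] ℝ

/-- The differential `df_p`, as a covector, of a real function `f`. -/
def differential (f : M → ℝ) (p : M) : TangentSpace 𝓘(ℝ, E4) p →L[ℝ] ℝ :=
  mfderiv 𝓘(ℝ, E4) 𝓘(ℝ, ℝ) f p

/-- The coordinate vector `∂_a` of the chart `e` at the point with coordinates `x`. -/
def coordVec (e : OpenPartialHomeomorph M E4) (x : E4) (a : Fin 4) :
    TangentSpace 𝓘(ℝ, E4) (e.symm x) :=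
  mfderiv 𝓘(ℝ, E4) 𝓘(ℝ, E4) e.symm x (EuclideanSpace.single a (1 : ℝ) : E4)

/-- The components `T_{ab}` of a covariant 2-tensor in the chart `e`. -/
def comp₂ (T : Bilin M) (e : OpenPartialHomeomorph M E4) (a b : Fin 4) (x : E4) : ℝ :=
  T (e.symm x) (coordVec e x a) (coordVec e x b)

/-- The components `θ_a` of a one-form in the chart `e`. -/
def comp₁ (θ : ∀ p : M, TangentSpace 𝓘(ℝ, E4) p →L[ℝ] ℝ)
    (e : OpenPartialHomeomorph M E4) (a : Fin 4) (x : E4) : ℝ :=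
  θ (e.symm x) (coordVec e x a)

/-- The components `X^a` of a vector field in the chart `e`. -/
def vecComp (X : ∀ p : M, TangentSpace 𝓘(ℝ, E4) p)
    (e : OpenPartialHomeomorph M E4) (a : Fin 4) (x : E4) : ℝ :=
  let v : E4 := mfderiv 𝓘(ℝ, E4) 𝓘(ℝ, E4) e (e.symm x) (X (e.symm x))
  v a

/-- The partial derivative `∂_a f`. -/
def pd (a : Fin 4) (f : E4 → ℝ) (x : E4) : ℝ :=
  fderiv ℝ f x (EuclideanSpace.single a (1 : ℝ))

/-- The components of the Lie derivative:
`(L_X T)_{ab} = X^c ∂_c T_{ab} + T_{cb} ∂_a X^c + T_{ac} ∂_b X^c`. -/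
def lieComp (X : ∀ p : M, TangentSpace 𝓘(ℝ, E4) p) (T : Bilin M)
    (e : OpenPartialHomeomorph M E4) (a b : Fin 4) (x : E4) : ℝ :=
  ∑ c, (vecComp X e c x * pd c (comp₂ T e a b) x
    + comp₂ T e c b x * pd a (vecComp X e c) x
    + comp₂ T e a c x * pd b (vecComp X e c) x)

/-- The components `g^{ab}` of the inverse metric. -/
def invComp (g : Bilin M) (e : OpenPartialHomeomorph M E4) (a b : Fin 4) (x : E4) : ℝ :=
  ((Matrix.of fun c d => comp₂ g e c d x)⁻¹ : Matrix (Fin 4) (Fin 4) ℝ) a b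

/-- The Christoffel symbols
`Γ^c_{ab} = ½ g^{cd} (∂_a g_{bd} + ∂_b g_{ad} - ∂_d g_{ab})` of the Levi-Civita connection. -/
def christoffel (g : Bilin M) (e : OpenPartialHomeomorph M E4) (c a b : Fin 4) (x : E4) : ℝ :=
  (1 / 2) * ∑ d, invComp g e c d x *
    (pd a (comp₂ g e b d) x + pd b (comp₂ g e a d) x - pd d (comp₂ g e a b) x)

/-- The components of the covariant derivative:
`∇_c T_{ab} = ∂_c T_{ab} - Γ^d_{ca} T_{db} - Γ^d_{cb} T_{ad}`. -/
def nablaComp (g T : Bilin M) (e : OpenPartialHomeomorph M E4) (c a b : Fin 4) (x : E4) : ℝ :=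
  pd c (comp₂ T e a b) x
    - ∑ d, (christoffel g e d c a x * comp₂ T e d b x
      + christoffel g e d c b x * comp₂ T e a d x)

/-- The components of the divergence: `(div T)_b = g^{ca} ∇_c T_{ab}`. -/
def divComp (g T : Bilin M) (e : OpenPartialHomeomorph M E4) (b : Fin 4) (x : E4) : ℝ :=
  ∑ c, ∑ a, invComp g e c a x * nablaComp g T e c a b x

/-- The trace `g^{ab} T_{ab}`. -/
def traceComp (g T : Bilin M) (e : OpenPartialHomeomorph M E4) (x : E4) : ℝ :=
  ∑ a, ∑ b, invComp g e a b x * comp₂ T e a b x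

/-! ### The generators of the torus action -/

/-- The one-parameter subgroup `t ↦ e^{it}` in the `i`-th factor of `U(1) × U(1)`. -/
def torusExp (i : Fin 2) (t : ℝ) : Torus :=
  if i = 0 then (Circle.exp t, 1) else (1, Circle.exp t)

/-- The generator `ξ_(i)` of the action of the `i`-th factor: the velocity at `t = 0` of
`t ↦ torusExp i t • p`, a curve that passes through `p` at `t = 0`. -/
def generator [MulAction Torus M] (i : Fin 2) (p : M) : TangentSpace 𝓘(ℝ, E4) p :=
  mfderiv 𝓘(ℝ, ℝ) 𝓘(ℝ, E4) (fun t : ℝ => torusExp i t • p) 0 (1 : ℝ)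

end Charts

/-! ### Maximal torus-invariant initial data -/

/-- Oriented, maximal, `U(1)²`-invariant initial data on a four-manifold `M` with a smooth
`U(1)²`-action. All tensor identities are required in every chart of the smooth structure. -/
structure InitialData (M : Type*) [TopologicalSpace M] [ChartedSpace E4 M]
    [IsManifold 𝓘(ℝ, E4) ∞ M] [MulAction Torus M] where
  /-- The Riemannian metric. -/
  h : ContMDiffRiemannianMetric 𝓘(ℝ, E4) ∞ E4 (fun p : M => TangentSpace 𝓘(ℝ, E4) p)
  /-- The volume form of `h` for the chosen orientation: a continuous 4-form whose square on
  every 4-tuple of tangent vectors is the Gram determinant. The choice of such a form is the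
  same as the choice of an orientation of `M`. -/
  vol : ∀ p : M, TangentSpace 𝓘(ℝ, E4) p [⋀^Fin 4]→ₗ[ℝ] ℝ
  vol_sq : ∀ (p : M) (w : Fin 4 → TangentSpace 𝓘(ℝ, E4) p),
    vol p w ^ 2 = (Matrix.of fun a b => h.inner p (w a) (w b)).det
  vol_continuous : ∀ e ∈ IsManifold.maximalAtlas 𝓘(ℝ, E4) ∞ M,
    ContinuousOn (fun x => vol (e.symm x) (coordVec e x)) e.target
  /-- The second fundamental form. -/
  K : Bilin M
  K_smooth : ContMDiff 𝓘(ℝ, E4) (𝓘(ℝ, E4).prod 𝓘(ℝ, E4 →L[ℝ] E4 →L[ℝ] ℝ)) ∞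
    (fun p => TotalSpace.mk' (E4 →L[ℝ] E4 →L[ℝ] ℝ)
      (E := fun p : M => TangentSpace 𝓘(ℝ, E4) p →L[ℝ] TangentSpace 𝓘(ℝ, E4) p →L[ℝ] ℝ) p (K p))
  K_symm : ∀ (p : M) (u w : TangentSpace 𝓘(ℝ, E4) p), K p u w = K p w u
  /-- The energy-momentum current. -/
  j : ∀ p : M, TangentSpace 𝓘(ℝ, E4) p →L[ℝ] ℝ
  /-- The data are maximal: `Tr_h K = 0`. -/
  maximal : ∀ e ∈ IsManifold.maximalAtlas 𝓘(ℝ, E4) ∞ M, ∀ x ∈ e.target,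
    traceComp h.inner K e x = 0
  /-- The momentum constraint: `div K = 8π j`. -/
  momentum : ∀ e ∈ IsManifold.maximalAtlas 𝓘(ℝ, E4) ∞ M, ∀ x ∈ e.target, ∀ b,
    divComp h.inner K e b x = 8 * Real.pi * comp₁ j e b x
  /-- The generators are Killing fields: `L_{ξ_(i)} h = 0`. -/
  killing : ∀ i : Fin 2, ∀ e ∈ IsManifold.maximalAtlas 𝓘(ℝ, E4) ∞ M, ∀ x ∈ e.target, ∀ a b,
    lieComp (generator i) h.inner e a b x = 0
  /-- The second fundamental form is invariant: `L_{ξ_(i)} K = 0`. -/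
  invariant : ∀ i : Fin 2, ∀ e ∈ IsManifold.maximalAtlas 𝓘(ℝ, E4) ∞ M, ∀ x ∈ e.target, ∀ a b,
    lieComp (generator i) K e a b x = 0

/-! ### Wedge product and Hodge star -/

section Hodge

variable {V : Type*} [AddCommGroup V] [Module ℝ V]

/-- The wedge product of three covectors: `(α ∧ β ∧ γ)(v₀, v₁, v₂)` is the determinant of the
matrix with rows `(α (v_k), β (v_k), γ (v_k))`. -/
def wedge₃ (α β γ : V →ₗ[ℝ] ℝ) : V [⋀^Fin 3]→ₗ[ℝ] ℝ :=
  (Matrix.detRowAlternating (n := Fin 3) (R := ℝ)).compLinearMap (LinearMap.pi ![α, β, γ])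

/-- The Hodge star of a 3-form on a four-dimensional oriented inner product space with basis `B`,
inner product `g` and volume form `vol`:
`(⋆θ)_d = (1/3!) g^{aa'} g^{bb'} g^{cc'} θ_{abc} vol_{a'b'c'd}`. -/
def hodgeStar₃ (B : Fin 4 → V) (g : V → V → ℝ) (vol : V [⋀^Fin 4]→ₗ[ℝ] ℝ)
    (θ : V [⋀^Fin 3]→ₗ[ℝ] ℝ) (w : V) : ℝ :=
  let G : Matrix (Fin 4) (Fin 4) ℝ := (Matrix.of fun a b => g (B a) (B b))⁻¹
  (1 / 6) * ∑ a, ∑ b, ∑ c, ∑ a', ∑ b', ∑ c',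
    G a a' * G b b' * G c c' * θ ![B a, B b, B c] * vol ![B a', B b', B c', w]

end Hodge

section Data

variable {M : Type*} [TopologicalSpace M] [ChartedSpace E4 M]
  [IsManifold 𝓘(ℝ, E4) ∞ M] [MulAction Torus M]

/-- The one-form `S^(i)_α = K_{αβ} ξ_(i)^β`. -/
def InitialData.S (D : InitialData M) (i : Fin 2) (p : M) : TangentSpace 𝓘(ℝ, E4) p →ₗ[ℝ] ℝ :=
  (D.K p (generator i p)).toLinearMap

/-- The one-form metrically dual to `ξ_(i)`. -/
def InitialData.xiFlat (D : InitialData M) (i : Fin 2) (p : M) :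
    TangentSpace 𝓘(ℝ, E4) p →ₗ[ℝ] ℝ :=
  (D.h.inner p (generator i p)).toLinearMap

/-- The basis of `T_p M` given by the standard basis of the model space. -/
def stdBasis (p : M) (a : Fin 4) : TangentSpace 𝓘(ℝ, E4) p :=
  (EuclideanSpace.single a (1 : ℝ) : E4)

/-- The one-form `⋆(S^(i) ∧ ξ_(1) ∧ ξ_(2))`. -/
def InitialData.twistForm (D : InitialData M) (i : Fin 2) (p : M)
    (w : TangentSpace 𝓘(ℝ, E4) p) : ℝ :=
  hodgeStar₃ (stdBasis p) (fun u v => D.h.inner p u v) (D.vol p)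
    (wedge₃ (D.S i p) (D.xiFlat 0 p) (D.xiFlat 1 p)) w

/-! ### Hypersurfaces and the Riemannian measure on them -/

/-- A compact smooth embedded hypersurface with a unit normal field for the metric of `D`: near
each of its points it is the zero set of a smooth function `f` whose gradient is a positive
multiple of the normal. The values of `normal` off the hypersurface are irrelevant. -/
structure Hypersurface (D : InitialData M) where
  carrier : Set M
  isCompact : IsCompact carrier
  normal : ∀ p : M, TangentSpace 𝓘(ℝ, E4) p
  unit : ∀ p ∈ carrier, D.h.inner p (normal p) (normal p) = 1
  smooth : ∀ p ∈ carrier, ∃ (U : Set M) (f : M → ℝ), IsOpen U ∧ p ∈ U ∧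
    ContMDiffOn 𝓘(ℝ, E4) 𝓘(ℝ, ℝ) ∞ f U ∧
    (∀ q ∈ U, q ∈ carrier ↔ f q = 0) ∧
    (∀ q ∈ U, q ∈ carrier → ∃ c : ℝ, 0 < c ∧
      ∀ w, differential f q w = c * D.h.inner q (normal q) w)

/-- The hypersurface is a union of orbits of `U(1)²`. -/
def Hypersurface.IsInvariant {D : InitialData M} (S : Hypersurface D) : Prop :=
  ∀ (g : Torus), ∀ p ∈ S.carrier, g • p ∈ S.carrier

/-- The unit normal of `S` points out of `N`, which lies locally on one side of `S`. -/
def Hypersurface.IsOutward {D : InitialData M} (S : Hypersurface D) (N : Set M) : Prop :=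
  ∀ p ∈ S.carrier, ∃ (U : Set M) (f : M → ℝ), IsOpen U ∧ p ∈ U ∧
    ContMDiffOn 𝓘(ℝ, E4) 𝓘(ℝ, ℝ) ∞ f U ∧
    0 < differential f p (S.normal p) ∧
    (∀ q ∈ U, q ∈ S.carrier ↔ f q = 0) ∧ (∀ q ∈ U, q ∈ N ↔ f q ≤ 0)

/-- The unit normal of `S` points into `N`, which lies locally on one side of `S`. -/
def Hypersurface.IsInward {D : InitialData M} (S : Hypersurface D) (N : Set M) : Prop :=
  ∀ p ∈ S.carrier, ∃ (U : Set M) (f : M → ℝ), IsOpen U ∧ p ∈ U ∧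
    ContMDiffOn 𝓘(ℝ, E4) 𝓘(ℝ, ℝ) ∞ f U ∧
    0 < differential f p (S.normal p) ∧
    (∀ q ∈ U, q ∈ S.carrier ↔ f q = 0) ∧ (∀ q ∈ U, q ∈ N ↔ 0 ≤ f q)

/-- The compact region `N` is bounded by the disjoint hypersurfaces `S₁` and `S₂`; the unit normals
are chosen consistently, pointing from `S₁` into `N` and out of `N` at `S₂`. -/
def Bounds {D : InitialData M} (N : Set M) (S₁ S₂ : Hypersurface D) : Prop :=
  IsCompact N ∧ frontier N = S₁.carrier ∪ S₂.carrier ∧ Disjoint S₁.carrier S₂.carrier ∧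
    S₁.IsInward N ∧ S₂.IsOutward N

/-- The point of `ℝ⁴` with first coordinates `y` and last coordinate `0`. -/
def slice (y : Fin 3 → ℝ) : E4 := !₂[y 0, y 1, y 2, 0]

/-- A chart of `M` in which the set `S` is the zero set of the last coordinate. -/
def IsSliceChart (S : Set M) (e : OpenPartialHomeomorph M E4) : Prop :=
  e ∈ IsManifold.maximalAtlas 𝓘(ℝ, E4) ∞ M ∧ ∀ p ∈ e.source, p ∈ S ↔ e p 3 = 0

/-- The measure `√(det γ_{ab}) dy⁰ dy¹ dy²` on the part of a hypersurface in a slice chart `e`,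
where `γ_{ab}`, for `a, b < 3`, is the induced metric in the coordinates `y`. -/
def sliceMeasure [MeasurableSpace M] (D : InitialData M) (e : OpenPartialHomeomorph M E4) :
    Measure M :=
  Measure.map (fun y : Fin 3 → ℝ => e.symm (slice y))
    ((volume.restrict {y : Fin 3 → ℝ | slice y ∈ e.target}).withDensity fun y =>
      ENNReal.ofReal (Real.sqrt (Matrix.of fun a b : Fin 3 =>
        comp₂ D.h.inner e a.castSucc b.castSucc (slice y)).det))

/-- The Riemannian measure `ds_h` that `h` induces on the hypersurface `S`. In each slice chart it
is `√(det γ) dy`; these local measures agree on overlaps, and the measure that they form is their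
supremum. -/
def surfaceMeasure [MeasurableSpace M] (D : InitialData M) (S : Set M) : Measure M :=
  ⨆ (e : OpenPartialHomeomorph M E4) (_ : IsSliceChart S e), sliceMeasure D e

/-- The angular momentum `J_(i)(S) = (1/8π) ∫_S K_{αβ} n^α ξ_(i)^β ds_h`. -/
def angularMomentum [MeasurableSpace M] {D : InitialData M} (i : Fin 2) (S : Hypersurface D) : ℝ :=
  1 / (8 * Real.pi) *
    ∫ p, D.K p (S.normal p) (generator i p) ∂(surfaceMeasure D S.carrier)

/-! ### Ends -/

/-- A diffeomorphism of `{x ∈ ℝ⁴ | R < ‖x‖}` onto an open subset of `M`: the coordinates in an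
end of `M`. -/
structure EndChart (M : Type*) [TopologicalSpace M] [ChartedSpace E4 M] where
  R : ℝ
  R_pos : 0 < R
  toFun : E4 → M
  smooth : ContMDiffOn 𝓘(ℝ, E4) 𝓘(ℝ, E4) ∞ toFun {x | R < ‖x‖}
  injOn : Set.InjOn toFun {x | R < ‖x‖}
  immersion : ∀ x : E4, R < ‖x‖ →
    Function.Injective (mfderiv 𝓘(ℝ, E4) 𝓘(ℝ, E4) toFun x)

/-- `S` is the sphere of coordinate radius `r` in the end `F`, with the unit normal that points in
the direction of increasing radius. -/
def Hypersurface.IsCoordSphere {D : InitialData M} (S : Hypersurface D) (F : EndChart M) (r : ℝ) :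
    Prop :=
  S.carrier = F.toFun '' {x : E4 | ‖x‖ = r} ∧
    ∀ x : E4, ‖x‖ = r →
      0 < D.h.inner (F.toFun x) (S.normal (F.toFun x))
        (mfderiv 𝓘(ℝ, E4) 𝓘(ℝ, E4) F.toFun x x)

end Data

end TorusData

end

/-! Everything rests on the vector field `X^a = K^a_b ξ_(i)^b` (`InitialData.flux`). Its divergence
is `(div K)(ξ_(i)) + ⟨K, ∇ξ_(i)⟩`. The first term is `8π j(ξ_(i)) = 0`. The second vanishes because
`K` is symmetric and `∇ξ_(i)` is antisymmetric for a Killing field. So `X` is divergence free, and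
`8π J_(i)(S)` is its flux through `S`.

Conservation is then the divergence theorem on `N`. For a test function `φ` let the defect be
`∫_{S₁} φ⟨X,n⟩ - ∫_{S₂} φ⟨X,n⟩ + ∫_N dφ(X)`. It is additive in `φ`, and it vanishes if `φ` is
supported in a suitable chart, where the claim is the divergence theorem on a half space or on all
of `ℝ⁴` (`Bounds.exists_chart`). A partition of unity gives defect zero for `φ = 1`
(`Bounds.angularMomentum_eq`). The bridge between the intrinsic surface integral and the coordinate
integral is `√γ K(n, ξ) = √g X³` in a chart whose last coordinate cuts out the surface
(`Hypersurface.IsAdapted.flux_density`).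

In an end, two coordinate spheres bound an annulus, so `J_(i)(S_r)` does not depend on `r`. The
limit exists trivially and is shared by every surface that bounds a region together with some `S_r`.

For the twist potential, `⋆(S^(i) ∧ ξ_(1) ∧ ξ_(2))` is the contraction of the volume form with `X`,
`ξ_(1)`, `ξ_(2)` (`InitialData.twistForm_eq`). The density `√g X` is divergence free and invariant
under the two generators, and these commute, so Cartan's formula makes the contraction closed
(`curl_det_eq_zero`). Local primitives come from the Poincaré lemma on balls. They differ by locally
constant functions, hence define a covering of `M` with discrete fibre, and on a simply connected
`M` this covering has a global section (`exists_global_of_local`).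

Tensor identities are proved in charts by partial derivatives of the density `√g X`, where the
divergence is simply `∂_a(√g X^a)`. -/

set_option linter.unusedSectionVars false

noncomputable section

namespace TorusData

/-! ### Derivatives of determinants and inverses of matrix-valued functions -/

section MatrixCalculus

variable {n : Type*} [Fintype n] [DecidableEq n]
variable {V : Type*} [NormedAddCommGroup V] [NormedSpace ℝ V]

theorem contDiff_det_entries {k : ℕ∞ω} :
    ContDiff ℝ k (fun M : n → n → ℝ => (Matrix.of M).det) := by
  simp only [Matrix.det_apply, Matrix.of_apply]
  fun_prop

/-- Jacobi's formula. Along the line `M + tN = M(1 + t M⁻¹N)` the determinant is `det M` times a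
polynomial in `t` whose linear coefficient is the trace of `M⁻¹N`. -/
theorem fderiv_det_entries (M N : n → n → ℝ) (hM : IsUnit (Matrix.of M).det) :
    fderiv ℝ (fun M : n → n → ℝ => (Matrix.of M).det) M N
      = (Matrix.of M).det * ((Matrix.of M)⁻¹ * Matrix.of N).trace := by
  have h1 : HasFDerivAt (fun M : n → n → ℝ => (Matrix.of M).det)
      (fderiv ℝ (fun M : n → n → ℝ => (Matrix.of M).det) M) (M + (0 : ℝ) • N) := by
    rw [zero_smul, add_zero]
    exact ((contDiff_det_entries (k := 1)).differentiable (by simp) M).hasFDerivAt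
  have h2 : HasDerivAt (fun t : ℝ => M + t • N) N 0 := by
    simpa using ((hasDerivAt_id (0 : ℝ)).smul_const N).const_add M
  have h3 := h1.comp_hasDerivAt (0 : ℝ) h2
  have h4 : ((fun M : n → n → ℝ => (Matrix.of M).det) ∘ fun t : ℝ => M + t • N)
      = fun t : ℝ => (Matrix.of M).det * ((1 + (Polynomial.X : Polynomial ℝ) •
          ((Matrix.of M)⁻¹ * Matrix.of N).map Polynomial.C).det).eval t := by
    funext t
    have e1 : Matrix.of (M + t • N)
        = Matrix.of M * (1 + t • ((Matrix.of M)⁻¹ * Matrix.of N)) := by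
      rw [mul_add, mul_one, Matrix.mul_smul, Matrix.mul_nonsing_inv_cancel_left _ _ hM]
      rfl
    simp only [Function.comp]
    rw [e1, Matrix.det_mul]
    congr 1
    rw [← Polynomial.coe_evalRingHom, RingHom.map_det]
    congr 1
    ext a b
    simp [Matrix.add_apply, Matrix.one_apply, apply_ite, -Matrix.map_mul]
    exact mul_comm _ _
  rw [h4] at h3
  have h5 := (Polynomial.hasDerivAt (1 + (Polynomial.X : Polynomial ℝ) •
          ((Matrix.of M)⁻¹ * Matrix.of N).map Polynomial.C).det (0 : ℝ)).const_mul
            (Matrix.of M).det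
  rw [h3.unique h5, Matrix.derivative_det_one_add_X_smul]

variable {g : n → n → V → ℝ} {x : V}

theorem contDiffAt_det {k : ℕ∞ω} (hg : ∀ a b, ContDiffAt ℝ k (g a b) x) :
    ContDiffAt ℝ k (fun y => (Matrix.of fun a b => g a b y).det) x :=
  (contDiff_det_entries (n := n)).contDiffAt.comp x
    (contDiffAt_pi.2 fun a => contDiffAt_pi.2 fun b => hg a b)

theorem fderiv_det (hg : ∀ a b, DifferentiableAt ℝ (g a b) x)
    (hd : (Matrix.of fun a b => g a b x).det ≠ 0) (v : V) :
    fderiv ℝ (fun y => (Matrix.of fun a b => g a b y).det) x v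
      = (Matrix.of fun a b => g a b x).det * ((Matrix.of fun a b => g a b x)⁻¹ *
          Matrix.of fun a b => fderiv ℝ (g a b) x v).trace := by
  have h1 : HasFDerivAt (fun y => fun a b => g a b y)
      (ContinuousLinearMap.pi fun a => ContinuousLinearMap.pi fun b => fderiv ℝ (g a b) x) x :=
    hasFDerivAt_pi.2 fun a => hasFDerivAt_pi.2 fun b => (hg a b).hasFDerivAt
  have h2 := ((contDiff_det_entries (n := n) (k := 1)).differentiable (by simp)
    (fun a b => g a b x)).hasFDerivAt.comp x h1
  rw [show (fun y => (Matrix.of fun a b => g a b y).det)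
    = (fun M : n → n → ℝ => (Matrix.of M).det) ∘ (fun y => fun a b => g a b y) from rfl,
    h2.fderiv, ContinuousLinearMap.comp_apply, fderiv_det_entries _ _ (isUnit_iff_ne_zero.2 hd)]
  rfl

theorem fderiv_sqrt_det (hg : ∀ a b, DifferentiableAt ℝ (g a b) x)
    (hd : 0 < (Matrix.of fun a b => g a b x).det) (v : V) :
    fderiv ℝ (fun y => √(Matrix.of fun a b => g a b y).det) x v
      = √(Matrix.of fun a b => g a b x).det * (1 / 2 * ((Matrix.of fun a b => g a b x)⁻¹ *
          Matrix.of fun a b => fderiv ℝ (g a b) x v).trace) := by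
  have h1 : DifferentiableAt ℝ (fun y => (Matrix.of fun a b => g a b y).det) x := by
    have h0 : DifferentiableAt ℝ (fun y => fun a b => g a b y) x :=
      differentiableAt_pi.2 fun a => differentiableAt_pi.2 fun b => hg a b
    exact DifferentiableAt.comp (g := fun M : n → n → ℝ => (Matrix.of M).det) x
      ((contDiff_det_entries (n := n) (k := 1)).differentiable (by simp) (fun a b => g a b x)) h0
  rw [fderiv_sqrt h1 hd.ne', _root_.smul_apply, fderiv_det hg hd.ne', smul_eq_mul]
  have h2 := Real.mul_self_sqrt hd.le
  have h3 := (Real.sqrt_pos.2 hd).ne'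
  field_simp
  rw [sq, h2]

theorem contDiffAt_inv_entry {k : ℕ∞ω} (hg : ∀ a b, ContDiffAt ℝ k (g a b) x)
    (hd : (Matrix.of fun a b => g a b x).det ≠ 0) (a b : n) :
    ContDiffAt ℝ k (fun y => ((Matrix.of fun a b => g a b y)⁻¹ : Matrix n n ℝ) a b) x := by
  -- Cramer's rule: an entry of the inverse is `det⁻¹` times the determinant with one row replaced
  -- by a unit vector, so smoothness reduces to that of determinants.
  have h1 : (fun y => ((Matrix.of fun a b => g a b y)⁻¹ : Matrix n n ℝ) a b)
      = fun y => (Matrix.of fun a b => g a b y).det⁻¹ *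
        (Matrix.of fun c d => (if c = b then fun _ => (Pi.single a (1 : ℝ) : n → ℝ) d
          else g c d) y).det := by
    funext y
    rw [Matrix.inv_def, Matrix.smul_apply, Matrix.adjugate_apply, Ring.inverse_eq_inv', smul_eq_mul]
    congr 2
    ext c d
    by_cases h : c = b
    · subst h; simp
    · simp [h]
  rw [h1]
  refine ((contDiffAt_det hg).inv hd).mul (contDiffAt_det fun c d => ?_)
  split_ifs
  · exact contDiffAt_const
  · exact hg c d

/-- Obtained by differentiating `G⁻¹ G = 1`, which holds near `x` because `det G` stays nonzero
there. -/
theorem fderiv_inv_entry (hg : ∀ a b, ContDiffAt ℝ 1 (g a b) x)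
    (hd : (Matrix.of fun a b => g a b x).det ≠ 0) (v : V) :
    (Matrix.of fun a b => fderiv ℝ
        (fun y => ((Matrix.of fun a b => g a b y)⁻¹ : Matrix n n ℝ) a b) x v)
      = -((Matrix.of fun a b => g a b x)⁻¹ * (Matrix.of fun a b => fderiv ℝ (g a b) x v) *
          (Matrix.of fun a b => g a b x)⁻¹) := by
  set H : n → n → V → ℝ := fun a b y => ((Matrix.of fun a b => g a b y)⁻¹ : Matrix n n ℝ) a b
  set G := Matrix.of fun a b => g a b x
  have hG : IsUnit G.det := isUnit_iff_ne_zero.2 hd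
  have hH : ∀ a b, DifferentiableAt ℝ (H a b) x := fun a b =>
    (contDiffAt_inv_entry hg hd a b).differentiableAt (by simp)
  have hg' : ∀ a b, DifferentiableAt ℝ (g a b) x := fun a b => (hg a b).differentiableAt (by simp)
  have key : (Matrix.of fun a b => fderiv ℝ (H a b) x v) * G
      + G⁻¹ * (Matrix.of fun a b => fderiv ℝ (g a b) x v) = 0 := by
    ext a b
    have h1 : (fun y => ∑ c, H a c y * g c b y) =ᶠ[𝓝 x] fun _ => (1 : Matrix n n ℝ) a b := by
      have : ∀ᶠ y in 𝓝 x, (Matrix.of fun a b => g a b y).det ≠ 0 :=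
        (contDiffAt_det hg).continuousAt.eventually_ne hd
      filter_upwards [this] with y hy
      have := Matrix.nonsing_inv_mul _ (isUnit_iff_ne_zero.2 hy)
      rw [← this, Matrix.mul_apply]
      rfl
    have h2 := h1.fderiv_eq (𝕜 := ℝ)
    have h0 : HasFDerivAt (fun y => ∑ c, H a c y * g c b y) _ x :=
      HasFDerivAt.fun_sum fun c (_ : c ∈ Finset.univ) =>
        (hH a c).hasFDerivAt.fun_mul (hg' c b).hasFDerivAt
    rw [h0.fderiv] at h2
    have h3 := congrArg (fun L => L v) h2
    simp only [_root_.sum_apply, _root_.add_apply, _root_.smul_apply, smul_eq_mul,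
      Finset.sum_add_distrib] at h3
    rw [Matrix.add_apply, Matrix.mul_apply, Matrix.mul_apply, Matrix.zero_apply, add_comm]
    simp only [Matrix.of_apply]
    convert h3 using 2
    · exact Finset.sum_congr rfl fun c _ => by rw [mul_comm]; rfl
    · simp
  have h4 := congrArg (· * G⁻¹) key
  simp only [add_mul, Matrix.mul_nonsing_inv_cancel_right _ _ hG, zero_mul] at h4
  exact eq_neg_of_add_eq_zero_left h4

end MatrixCalculus

/-! ### Divergence and Lie derivative of the density `√g g^{ac} K_{cb} ξ^b` -/

section CoordinateAlgebra

/-- The pointwise form of `∇_a (K^a_b ξ^b) = (div K)_b ξ^b` for a Killing field `ξ`. Here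
`dG c a b = ∂_c g_{ab}`, `dK c a b = ∂_c K_{ab}` and `dξ c a = ∂_c ξ^a`. -/
theorem divergence_contraction {G H K : Matrix (Fin 4) (Fin 4) ℝ}
    {dG dK : Fin 4 → Fin 4 → Fin 4 → ℝ} {ξ : Fin 4 → ℝ} {dξ : Fin 4 → Fin 4 → ℝ}
    (hHG : H * G = 1) (hG : ∀ a b, G a b = G b a) (hH : ∀ a b, H a b = H b a)
    (hK : ∀ a b, K a b = K b a) (hdG : ∀ c a b, dG c a b = dG c b a)
    (hlie : ∀ a b, ∑ c, (ξ c * dG c a b + G c b * dξ a c + G a c * dξ b c) = 0) :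
    ∑ a, (∑ p, ∑ q, 1 / 2 * (H p q * dG a q p) * ∑ c, H a c * ∑ b, K c b * ξ b
      + ∑ c, (-(∑ q, (∑ p, H a p * dG a p q) * H q c) * ∑ b, K c b * ξ b
        + H a c * ∑ b, (dK a c b * ξ b + K c b * dξ a b)))
    = ∑ b, (∑ c, ∑ a, H c a * (dK c a b - ∑ d,
        ((1 / 2 * ∑ e, H d e * (dG c a e + dG a c e - dG e c a)) * K d b
        + (1 / 2 * ∑ e, H d e * (dG c b e + dG b c e - dG e c b)) * K a d))) * ξ b := by
  -- the vector `X` and the tensor `T^{ab}`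
  set σ : Fin 4 → ℝ := fun c => ∑ b, K c b * ξ b with hσ
  set X : Fin 4 → ℝ := fun a => ∑ c, H a c * σ c with hX
  set T : Fin 4 → Fin 4 → ℝ := fun c e => ∑ a, ∑ d, H c a * K a d * H d e with hT
  have hTs : ∀ c e, T c e = T e c := by
    intro c e
    simp only [hT]
    rw [Finset.sum_comm]
    refine Finset.sum_congr rfl fun a _ => Finset.sum_congr rfl fun d _ => ?_
    rw [hH c d, hK d a, hH a e]; ring
  have hTG : ∀ a c, ∑ b, T a b * G b c = ∑ p, H a p * K p c := by
    intro a c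
    have : (Matrix.of T) = H * K * H := by
      ext a b
      simp only [Matrix.mul_apply, hT, Matrix.of_apply, Finset.sum_mul]
      rw [Finset.sum_comm]
    have h2 : (Matrix.of T) * G = H * K := by rw [this, mul_assoc, hHG, mul_one]
    have := congrFun (congrFun h2 a) c
    simpa [Matrix.mul_apply] using this
  -- terms of the right-hand side
  have e1 : ∑ b, (∑ c, ∑ a, H c a * dK c a b) * ξ b = ∑ a, ∑ c, H a c * ∑ b, dK a c b * ξ b := by
    simp only [Finset.sum_mul, Finset.mul_sum]
    rw [Finset.sum_comm]
    refine Finset.sum_congr rfl fun a _ => ?_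
    rw [Finset.sum_comm]
    simp only [mul_assoc]
  -- This is the trace `g^{ca} Γ^d_{ca}`: contraction with the symmetric `H` merges the first two
  -- terms of the Christoffel symbol.
  have e2 : ∑ b, (∑ c, ∑ a, H c a * ∑ d,
      (1 / 2 * ∑ e, H d e * (dG c a e + dG a c e - dG e c a)) * K d b) * ξ b
      = ∑ e, X e * ∑ c, ∑ a, (H c a * dG c a e - 1 / 2 * (H c a * dG e c a)) := by
    have h1 : ∀ e, ∑ c, ∑ a, H c a * (1 / 2 * (dG c a e + dG a c e - dG e c a))
        = ∑ c, ∑ a, (H c a * dG c a e - 1 / 2 * (H c a * dG e c a)) := by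
      intro e
      have h2 : ∑ c, ∑ a, H c a * dG a c e = ∑ c, ∑ a, H c a * dG c a e := by
        rw [Finset.sum_comm]
        exact Finset.sum_congr rfl fun a _ => Finset.sum_congr rfl fun c _ => by rw [hH]
      have h3 : ∑ c, ∑ a, H c a * (1 / 2 * (dG c a e + dG a c e - dG e c a))
          = 1 / 2 * ∑ c, ∑ a, H c a * dG c a e + 1 / 2 * ∑ c, ∑ a, H c a * dG a c e
            - ∑ c, ∑ a, 1 / 2 * (H c a * dG e c a) := by
        simp only [Finset.mul_sum, ← Finset.sum_add_distrib, ← Finset.sum_sub_distrib]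
        exact Finset.sum_congr rfl fun c _ => Finset.sum_congr rfl fun a _ => by ring
      rw [h3, h2]
      simp only [Finset.sum_sub_distrib]
      ring
    simp only [← h1]
    have s1 : ∀ γ : Fin 4 → Fin 4 → Fin 4 → ℝ,
        ∑ b, (∑ c, ∑ a, H c a * ∑ d, γ c a d * K d b) * ξ b
          = ∑ c, ∑ a, H c a * ∑ d, γ c a d * σ d := by
      intro γ
      simp only [hσ, Finset.mul_sum, Finset.sum_mul]
      rw [Finset.sum_comm]
      refine Finset.sum_congr rfl fun c _ => ?_
      rw [Finset.sum_comm]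
      refine Finset.sum_congr rfl fun a _ => ?_
      rw [Finset.sum_comm]
      exact Finset.sum_congr rfl fun d _ => Finset.sum_congr rfl fun b _ => by ring
    have s2 : ∀ D : Fin 4 → ℝ, ∑ d, (1 / 2 * ∑ e, H d e * D e) * σ d
        = ∑ e, X e * (1 / 2 * D e) := by
      intro D
      simp only [hX, Finset.mul_sum, Finset.sum_mul]
      rw [Finset.sum_comm]
      exact Finset.sum_congr rfl fun e _ => Finset.sum_congr rfl fun d _ => by rw [hH d e]; ring
    rw [s1]
    simp only [s2]
    simp only [Finset.mul_sum]
    have s3 : ∀ f : Fin 4 → Fin 4 → Fin 4 → ℝ,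
        ∑ c, ∑ a, ∑ e, f c a e = ∑ e, ∑ c, ∑ a, f c a e := by
      intro f
      rw [Finset.sum_comm (f := fun e c => ∑ a, f c a e)]
      exact Finset.sum_congr rfl fun c _ => Finset.sum_comm
    rw [s3]
    exact Finset.sum_congr rfl fun e _ => Finset.sum_congr rfl fun c _ =>
      Finset.sum_congr rfl fun a _ => by ring
  -- Contraction with the symmetric `T` cancels the first and third terms of the Christoffel symbol
  -- and leaves the middle one.
  have e3 : ∑ b, (∑ c, ∑ a, H c a * ∑ d,
      (1 / 2 * ∑ e, H d e * (dG c b e + dG b c e - dG e c b)) * K a d) * ξ b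
      = ∑ b, (1 / 2 * ∑ c, ∑ e, T c e * dG b c e) * ξ b := by
    refine Finset.sum_congr rfl fun b _ => ?_
    congr 1
    have s1 : ∀ D : Fin 4 → Fin 4 → ℝ, ∑ c, ∑ a, H c a * ∑ d, (1 / 2 * ∑ e, H d e * D c e) * K a d
        = 1 / 2 * ∑ c, ∑ e, T c e * D c e := by
      intro D
      simp only [hT, Finset.mul_sum, Finset.sum_mul]
      refine Finset.sum_congr rfl fun c _ => ?_
      rw [Finset.sum_comm (s := Finset.univ (α := Fin 4)) (t := Finset.univ (α := Fin 4))
        (f := fun e a => ∑ d, 1 / 2 * (H c a * K a d * H d e * D c e))]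
      refine Finset.sum_congr rfl fun a _ => ?_
      rw [Finset.sum_comm]
      exact Finset.sum_congr rfl fun e _ => Finset.sum_congr rfl fun d _ => by ring
    rw [s1]
    have s2 : ∑ c, ∑ e, T c e * dG c b e = ∑ c, ∑ e, T c e * dG e c b := by
      rw [Finset.sum_comm]
      exact Finset.sum_congr rfl fun c _ => Finset.sum_congr rfl fun e _ => by
        rw [hTs e c, hdG e b c]
    simp only [mul_add, mul_sub, Finset.sum_add_distrib, Finset.sum_sub_distrib]
    rw [s2]
    ring
  -- the Killing equation contracted with `T`
  have e4 : ∑ b, (1 / 2 * ∑ c, ∑ e, T c e * dG b c e) * ξ b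
      = -∑ a, ∑ c, H a c * ∑ b, K c b * dξ a b := by
    have h1 : ∑ a, ∑ b, T a b * ∑ c, (ξ c * dG c a b + G c b * dξ a c + G a c * dξ b c) = 0 := by
      simp only [hlie, mul_zero, Finset.sum_const_zero]
    have s1 : ∑ a, ∑ b, T a b * ∑ c, ξ c * dG c a b
        = ∑ b, (∑ c, ∑ e, T c e * dG b c e) * ξ b := by
      simp only [Finset.mul_sum, Finset.sum_mul]
      rw [Finset.sum_comm (s := Finset.univ (α := Fin 4)) (t := Finset.univ (α := Fin 4))
        (f := fun b c => ∑ e, T c e * dG b c e * ξ b)]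
      refine Finset.sum_congr rfl fun a _ => ?_
      rw [Finset.sum_comm]
      exact Finset.sum_congr rfl fun e _ => Finset.sum_congr rfl fun d _ => by ring
    have s2 : ∑ a, ∑ b, T a b * ∑ c, G c b * dξ a c
        = ∑ a, ∑ c, H a c * ∑ b, K c b * dξ a b := by
      refine Finset.sum_congr rfl fun a _ => ?_
      have : ∑ b, T a b * ∑ c, G c b * dξ a c = ∑ c, (∑ b, T a b * G b c) * dξ a c := by
        simp only [Finset.mul_sum, Finset.sum_mul]
        rw [Finset.sum_comm]
        exact Finset.sum_congr rfl fun c _ => Finset.sum_congr rfl fun b _ => by rw [hG c b]; ring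
      rw [this]
      simp only [hTG, Finset.mul_sum, Finset.sum_mul]
      rw [Finset.sum_comm]
      exact Finset.sum_congr rfl fun c _ => Finset.sum_congr rfl fun b _ => by ring
    have s3 : ∑ a, ∑ b, T a b * ∑ c, G a c * dξ b c
        = ∑ a, ∑ b, T a b * ∑ c, G c b * dξ a c := by
      rw [Finset.sum_comm]
      exact Finset.sum_congr rfl fun a _ => Finset.sum_congr rfl fun b _ => by
        rw [hTs b a]
        exact congrArg _ (Finset.sum_congr rfl fun c _ => by rw [hG])
    simp only [Finset.sum_add_distrib, mul_add] at h1
    rw [s3, s2, s1] at h1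
    have s4 : ∑ b, (1 / 2 * ∑ c, ∑ e, T c e * dG b c e) * ξ b
        = 1 / 2 * ∑ b, (∑ c, ∑ e, T c e * dG b c e) * ξ b := by
      rw [Finset.mul_sum]
      exact Finset.sum_congr rfl fun c _ => by ring
    rw [s4]
    linarith
  -- terms of the left-hand side
  have l1 : ∑ a, (∑ p, ∑ q, 1 / 2 * (H p q * dG a q p)) * X a
      = ∑ e, X e * ∑ c, ∑ a, 1 / 2 * (H c a * dG e c a) :=
    Finset.sum_congr rfl fun e _ => by
      rw [mul_comm]
      exact congrArg _ (Finset.sum_congr rfl fun p _ => Finset.sum_congr rfl fun q _ => by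
        rw [hdG e q p])
  have l2 : ∑ a, ∑ c, (∑ q, (∑ p, H a p * dG a p q) * H q c) * σ c
      = ∑ e, X e * ∑ c, ∑ a, H c a * dG c a e := by
    have s1 : ∀ a, ∑ c, (∑ q, (∑ p, H a p * dG a p q) * H q c) * σ c
        = ∑ q, X q * ∑ p, H a p * dG a p q := by
      intro a
      simp only [hX, Finset.sum_mul]
      rw [Finset.sum_comm]
      refine Finset.sum_congr rfl fun c _ => Finset.sum_congr rfl fun b _ => ?_
      rw [← Finset.sum_mul, ← Finset.sum_mul]
      ring
    simp only [s1]
    rw [Finset.sum_comm]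
    simp only [← Finset.mul_sum]
  have l0 : ∑ a, (∑ p, ∑ q, 1 / 2 * (H p q * dG a q p) * ∑ c, H a c * σ c
      + ∑ c, (-(∑ q, (∑ p, H a p * dG a p q) * H q c) * σ c
        + H a c * ∑ b, (dK a c b * ξ b + K c b * dξ a b)))
      = ∑ a, (∑ p, ∑ q, 1 / 2 * (H p q * dG a q p)) * X a
        - ∑ a, ∑ c, (∑ q, (∑ p, H a p * dG a p q) * H q c) * σ c
        + ∑ a, ∑ c, H a c * ∑ b, dK a c b * ξ b + ∑ a, ∑ c, H a c * ∑ b, K c b * dξ a b := by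
    simp only [← Finset.sum_add_distrib, ← Finset.sum_sub_distrib]
    refine Finset.sum_congr rfl fun a _ => ?_
    simp only [Finset.sum_add_distrib, mul_add, Finset.sum_mul, neg_mul, Finset.sum_neg_distrib]
    ring
  have r0 : ∑ b, (∑ c, ∑ a, H c a * (dK c a b - ∑ d,
        ((1 / 2 * ∑ e, H d e * (dG c a e + dG a c e - dG e c a)) * K d b
        + (1 / 2 * ∑ e, H d e * (dG c b e + dG b c e - dG e c b)) * K a d))) * ξ b
      = ∑ b, (∑ c, ∑ a, H c a * dK c a b) * ξ b
        - ∑ b, (∑ c, ∑ a, H c a * ∑ d,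
          (1 / 2 * ∑ e, H d e * (dG c a e + dG a c e - dG e c a)) * K d b) * ξ b
        - ∑ b, (∑ c, ∑ a, H c a * ∑ d,
          (1 / 2 * ∑ e, H d e * (dG c b e + dG b c e - dG e c b)) * K a d) * ξ b := by
    simp only [← Finset.sum_sub_distrib, ← sub_mul, ← mul_sub, Finset.sum_add_distrib, sub_sub]
  -- The derivative of `√g` (`l1`) and that of the inverse metric (`l2`) together match the trace
  -- term `e2`. By the Killing equation `e4`, the remaining Christoffel term `e3` accounts for the
  -- terms with `∂ξ`.
  rw [l0, r0, e1, e2, e3, e4, l1, l2]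
  simp only [Finset.sum_sub_distrib, mul_sub]
  ring

end CoordinateAlgebra
-- Calculus of the density in coordinates, and closedness of its contraction with two symmetries
section CoordinateCalculus

/-- The determinant of the matrix with the given rows. -/
def det₄ (r₀ r₁ r₂ r₃ : Fin 4 → ℝ) : ℝ := (Matrix.of ![r₀, r₁, r₂, r₃]).det

/-- Laplace expansion along the first two rows. The explicit polynomial lets `ring` decide
identities between determinants. -/
theorem det₄_apply (r₀ r₁ r₂ r₃ : Fin 4 → ℝ) : det₄ r₀ r₁ r₂ r₃ =
    (r₀ 0 * r₁ 1 - r₀ 1 * r₁ 0) * (r₂ 2 * r₃ 3 - r₂ 3 * r₃ 2)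
    - (r₀ 0 * r₁ 2 - r₀ 2 * r₁ 0) * (r₂ 1 * r₃ 3 - r₂ 3 * r₃ 1)
    + (r₀ 0 * r₁ 3 - r₀ 3 * r₁ 0) * (r₂ 1 * r₃ 2 - r₂ 2 * r₃ 1)
    + (r₀ 1 * r₁ 2 - r₀ 2 * r₁ 1) * (r₂ 0 * r₃ 3 - r₂ 3 * r₃ 0)
    - (r₀ 1 * r₁ 3 - r₀ 3 * r₁ 1) * (r₂ 0 * r₃ 2 - r₂ 2 * r₃ 0)
    + (r₀ 2 * r₁ 3 - r₀ 3 * r₁ 2) * (r₂ 0 * r₃ 1 - r₂ 1 * r₃ 0) := by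
  rw [det₄, Matrix.det_succ_row_zero]
  simp [Matrix.det_fin_three, Fin.sum_univ_four, Matrix.submatrix, Fin.succAbove, Fin.succ]
  ring

theorem det₄_eq_zero {r₀ : Fin 4 → ℝ} (h : ∀ a, r₀ a = 0) (r₁ r₂ r₃ : Fin 4 → ℝ) :
    det₄ r₀ r₁ r₂ r₃ = 0 := Matrix.det_eq_zero_of_row_eq_zero 0 h

/-- The exterior derivative of `ι_{x₁} ι_{x₀} ι_w (dx⁰ ∧ dx¹ ∧ dx² ∧ dx³)` vanishes when the density
`w` is divergence free and invariant under the commuting fields `x₀`, `x₁`. -/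
theorem curl_det_eq_zero {w x₀ x₁ : Fin 4 → ℝ} {dw d₀ d₁ : Fin 4 → Fin 4 → ℝ}
    (hdiv : ∑ a, dw a a = 0)
    (h₀ : ∀ a, ∑ c, (x₀ c * dw c a - w c * d₀ c a) + w a * ∑ c, d₀ c c = 0)
    (h₁ : ∀ a, ∑ c, (x₁ c * dw c a - w c * d₁ c a) + w a * ∑ c, d₁ c c = 0)
    (hc : ∀ a, ∑ c, (x₀ c * d₁ c a - x₁ c * d₀ c a) = 0) (d e : Fin 4) :
    det₄ (dw e) x₀ x₁ (Pi.single d 1) + det₄ w (d₀ e) x₁ (Pi.single d 1)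
      + det₄ w x₀ (d₁ e) (Pi.single d 1)
    = det₄ (dw d) x₀ x₁ (Pi.single e 1) + det₄ w (d₀ d) x₁ (Pi.single e 1)
      + det₄ w x₀ (d₁ d) (Pi.single e 1) := by
  -- Four quantities that vanish by hypothesis: three determinants with a zero row, coming from the
  -- invariance of `w` and the commutation of `x₀`, `x₁`, and one multiple of the divergence of `w`.
  have k₀ : det₄ (fun a => ∑ c, (x₀ c * dw c a - w c * d₀ c a) + w a * ∑ c, d₀ c c) x₁ (Pi.single d 1) (Pi.single e 1) = 0 := det₄_eq_zero h₀ _ _ _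
  have k₁ : det₄ (fun a => ∑ c, (x₁ c * dw c a - w c * d₁ c a) + w a * ∑ c, d₁ c c) x₀ (Pi.single d 1) (Pi.single e 1) = 0 := det₄_eq_zero h₁ _ _ _
  have k₂ : det₄ (fun a => ∑ c, (x₀ c * d₁ c a - x₁ c * d₀ c a)) w (Pi.single d 1) (Pi.single e 1) = 0 := det₄_eq_zero hc _ _ _
  have k₃ : det₄ x₀ x₁ (Pi.single d 1) (Pi.single e 1) * ∑ a, dw a a = 0 := by
    rw [hdiv, mul_zero]
  rw [← sub_eq_zero]
  -- Cartan's formula in components: the antisymmetrised derivative is a combination of the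
  -- divergence of `w`, the Lie derivatives of `w` along `x₀` and `x₁`, and the bracket of `x₀` and
  -- `x₁`. It is a polynomial identity, to be checked for each pair of indices.
  have : ∀ A C : ℝ, A - C = -(det₄ x₀ x₁ (Pi.single d 1) (Pi.single e 1) * ∑ a, dw a a)
      + det₄ (fun a => ∑ c, (x₀ c * dw c a - w c * d₀ c a) + w a * ∑ c, d₀ c c) x₁ (Pi.single d 1) (Pi.single e 1)
      - det₄ (fun a => ∑ c, (x₁ c * dw c a - w c * d₁ c a) + w a * ∑ c, d₁ c c) x₀ (Pi.single d 1) (Pi.single e 1)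
      - det₄ (fun a => ∑ c, (x₀ c * d₁ c a - x₁ c * d₀ c a)) w (Pi.single d 1) (Pi.single e 1) → A - C = 0 := by
    intro A C h
    rw [h, k₀, k₁, k₂, k₃]
    simp
  apply this
  clear k₀ k₁ k₂ k₃ this
  simp only [det₄_apply, Fin.sum_univ_four]
  fin_cases d <;> fin_cases e <;> simp <;> ring

/-- The function `√(det g_{ab})`. -/
def sqrtDet (g : Fin 4 → Fin 4 → E4 → ℝ) (y : E4) : ℝ := √(Matrix.of fun a b => g a b y).det

/-- The components of the inverse of the matrix `g_{ab}`. -/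
def invMat (g : Fin 4 → Fin 4 → E4 → ℝ) (a b : Fin 4) (y : E4) : ℝ :=
  ((Matrix.of fun c d => g c d y)⁻¹ : Matrix (Fin 4) (Fin 4) ℝ) a b

/-- The vector `g^{ac} K_{cb} ξ^b`. -/
def sharpVec (g K : Fin 4 → Fin 4 → E4 → ℝ) (ξ : Fin 4 → E4 → ℝ) (a : Fin 4) (y : E4) : ℝ :=
  ∑ c, invMat g a c y * ∑ b, K c b y * ξ b y

variable {g K : Fin 4 → Fin 4 → E4 → ℝ} {ξ η : Fin 4 → E4 → ℝ} {x : E4}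

theorem contDiffAt_sharpVec {k : ℕ∞ω} (hg : ∀ a b, ContDiffAt ℝ k (g a b) x)
    (hK : ∀ a b, ContDiffAt ℝ k (K a b) x) (hξ : ∀ a, ContDiffAt ℝ k (ξ a) x)
    (hd : 0 < (Matrix.of fun a b => g a b x).det) (a : Fin 4) :
    ContDiffAt ℝ k (sharpVec g K ξ a) x :=
  ContDiffAt.sum fun c _ => (contDiffAt_inv_entry hg hd.ne' a c).mul
    (ContDiffAt.sum fun b _ => (hK c b).mul (hξ b))

theorem contDiffAt_sqrtDet {k : ℕ∞ω} (hg : ∀ a b, ContDiffAt ℝ k (g a b) x)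
    (hd : 0 < (Matrix.of fun a b => g a b x).det) : ContDiffAt ℝ k (sqrtDet g) x :=
  (contDiffAt_det hg).sqrt hd.ne'

theorem fderiv_mul_apply {f₁ f₂ : E4 → ℝ} (h₁ : DifferentiableAt ℝ f₁ x)
    (h₂ : DifferentiableAt ℝ f₂ x) (v : E4) :
    fderiv ℝ (fun y => f₁ y * f₂ y) x v = fderiv ℝ f₁ x v * f₂ x + f₁ x * fderiv ℝ f₂ x v := by
  simp only [fderiv_fun_mul h₁ h₂, _root_.add_apply, _root_.smul_apply, smul_eq_mul]
  ring

theorem fderiv_sum_apply {ι : Type*} {s : Finset ι} {f : ι → E4 → ℝ}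
    (h : ∀ i ∈ s, DifferentiableAt ℝ (f i) x) (v : E4) :
    fderiv ℝ (fun y => ∑ i ∈ s, f i y) x v = ∑ i ∈ s, fderiv ℝ (f i) x v := by
  rw [fderiv_fun_sum h, _root_.sum_apply]

theorem fderiv_sqrtDet (hg : ∀ a b, DifferentiableAt ℝ (g a b) x)
    (hd : 0 < (Matrix.of fun a b => g a b x).det) (v : E4) :
    fderiv ℝ (sqrtDet g) x v
      = sqrtDet g x * ∑ p, ∑ q, 1 / 2 * (invMat g p q x * fderiv ℝ (g q p) x v) := by
  rw [sqrtDet, show sqrtDet g = fun y => √(Matrix.of fun a b => g a b y).det from rfl,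
    fderiv_sqrt_det hg hd]
  simp only [Matrix.trace, Matrix.diag, Matrix.mul_apply, Finset.mul_sum]
  rfl

theorem fderiv_invMat (hg : ∀ a b, ContDiffAt ℝ 1 (g a b) x)
    (hd : 0 < (Matrix.of fun a b => g a b x).det) (v : E4) (a b : Fin 4) :
    fderiv ℝ (invMat g a b) x v
      = -∑ q, (∑ p, invMat g a p x * fderiv ℝ (g p q) x v) * invMat g q b x := by
  have := congrFun (congrFun (fderiv_inv_entry hg hd.ne' v) a) b
  rw [Matrix.neg_apply, Matrix.mul_apply] at this
  simp only [Matrix.mul_apply] at this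
  exact this

theorem fderiv_density (hg : ∀ a b, ContDiffAt ℝ 1 (g a b) x)
    (hK : ∀ a b, ContDiffAt ℝ 1 (K a b) x)
    (hξ : ∀ a, ContDiffAt ℝ 1 (ξ a) x) (hd : 0 < (Matrix.of fun a b => g a b x).det)
    (v : E4) (a : Fin 4) :
    fderiv ℝ (fun y => sqrtDet g y * sharpVec g K ξ a y) x v = sqrtDet g x *
      (∑ p, ∑ q, 1 / 2 * (invMat g p q x * fderiv ℝ (g q p) x v) * sharpVec g K ξ a x
      + ∑ e, (-(∑ q, (∑ p, invMat g a p x * fderiv ℝ (g p q) x v) * invMat g q e x)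
          * ∑ b, K e b x * ξ b x
        + invMat g a e x * ∑ b, (fderiv ℝ (K e b) x v * ξ b x
          + K e b x * fderiv ℝ (ξ b) x v))) := by
  have hg' : ∀ a b, DifferentiableAt ℝ (g a b) x := fun a b => (hg a b).differentiableAt (by simp)
  have hK' : ∀ a b, DifferentiableAt ℝ (K a b) x := fun a b => (hK a b).differentiableAt (by simp)
  have hξ' : ∀ a, DifferentiableAt ℝ (ξ a) x := fun a => (hξ a).differentiableAt (by simp)
  have hH : ∀ a b, DifferentiableAt ℝ (invMat g a b) x := fun a b =>
    (contDiffAt_inv_entry hg hd.ne' a b).differentiableAt (by simp)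
  have hm : ∀ c b, DifferentiableAt ℝ (fun y => K c b y * ξ b y) x := fun c b =>
    (hK' c b).mul (hξ' b)
  have hσ : ∀ c, DifferentiableAt ℝ (fun y => ∑ b, K c b y * ξ b y) x := fun c =>
    DifferentiableAt.fun_sum fun b _ => hm c b
  have hp : ∀ e, DifferentiableAt ℝ (fun y => invMat g a e y * ∑ b, K e b y * ξ b y) x :=
    fun e => (hH a e).mul (hσ e)
  have hX : fderiv ℝ (sharpVec g K ξ a) x v
      = ∑ e, (-(∑ q, (∑ p, invMat g a p x * fderiv ℝ (g p q) x v) * invMat g q e x)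
          * ∑ b, K e b x * ξ b x
        + invMat g a e x * ∑ b, (fderiv ℝ (K e b) x v * ξ b x
          + K e b x * fderiv ℝ (ξ b) x v)) := by
    rw [show sharpVec g K ξ a = fun y => ∑ c, invMat g a c y * ∑ b, K c b y * ξ b y from rfl,
      fderiv_sum_apply (fun e _ => hp e)]
    refine Finset.sum_congr rfl fun e _ => ?_
    rw [fderiv_mul_apply (hH a e) (hσ e), fderiv_invMat hg hd, fderiv_sum_apply (fun b _ => hm e b)]
    congr 2
    exact Finset.sum_congr rfl fun b _ => fderiv_mul_apply (hK' e b) (hξ' b) v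
  rw [fderiv_mul_apply ((contDiffAt_sqrtDet hg hd).differentiableAt (by simp))
    ((contDiffAt_sharpVec hg hK hξ hd a).differentiableAt (by simp)), fderiv_sqrtDet hg' hd, hX]
  simp only [← Finset.sum_mul]
  ring

theorem invMat_symm (hgs : ∀ a b, g a b = g b a) (a b : Fin 4) :
    invMat g a b x = invMat g b a x := by
  have h : (Matrix.of fun c d => g c d x).transpose = Matrix.of fun c d => g c d x := by
    ext c d; simp [hgs c d]
  have h2 := Matrix.transpose_nonsing_inv (Matrix.of fun c d => g c d x)
  rw [h] at h2
  exact congrFun (congrFun h2 b) a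

/-- The density `√g g^{ac} K_{cb} ξ^b` is divergence free. -/
theorem sum_pd_density_eq_zero (hg : ∀ a b, ContDiffAt ℝ 1 (g a b) x)
    (hK : ∀ a b, ContDiffAt ℝ 1 (K a b) x)
    (hξ : ∀ a, ContDiffAt ℝ 1 (ξ a) x) (hd : 0 < (Matrix.of fun a b => g a b x).det)
    (hgs : ∀ a b, g a b = g b a) (hKs : ∀ a b, K a b = K b a)
    (hlie : ∀ a b, ∑ c, (ξ c x * pd c (g a b) x + g c b x * pd a (ξ c) x
      + g a c x * pd b (ξ c) x) = 0)
    (hdiv : ∑ b, (∑ c, ∑ a, invMat g c a x * (pd c (K a b) x - ∑ d,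
        ((1 / 2 * ∑ e, invMat g d e x *
            (pd c (g a e) x + pd a (g c e) x - pd e (g c a) x)) * K d b x
        + (1 / 2 * ∑ e, invMat g d e x *
            (pd c (g b e) x + pd b (g c e) x - pd e (g c b) x)) * K a d x))) * ξ b x = 0) :
    ∑ a, pd a (fun y => sqrtDet g y * sharpVec g K ξ a y) x = 0 := by
  have := divergence_contraction (G := Matrix.of fun a b => g a b x)
    (H := Matrix.of fun a b => invMat g a b x) (K := Matrix.of fun a b => K a b x)
    (dG := fun c a b => pd c (g a b) x) (dK := fun c a b => pd c (K a b) x)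
    (ξ := fun a => ξ a x) (dξ := fun c a => pd c (ξ a) x)
    (Matrix.nonsing_inv_mul _ (isUnit_iff_ne_zero.2 hd.ne'))
    (fun a b => by simp [hgs a b]) (fun a b => invMat_symm hgs a b) (fun a b => by simp [hKs a b])
    (fun c a b => by simp only [hgs a b]) hlie
  simp only [Matrix.of_apply] at this
  rw [hdiv] at this
  simp only [pd, fderiv_density hg hK hξ hd, ← Finset.mul_sum]
  exact mul_eq_zero_of_right _ this

/-- The density `√g g^{ac} K_{cb} ξ^b` is invariant under a Killing field `η` that preserves `K`
and commutes with `ξ`. -/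
theorem lie_density_eq_zero (hg : ∀ a b, ContDiffAt ℝ 1 (g a b) x)
    (hK : ∀ a b, ContDiffAt ℝ 1 (K a b) x)
    (hξ : ∀ a, ContDiffAt ℝ 1 (ξ a) x) (hd : 0 < (Matrix.of fun a b => g a b x).det)
    (hlg : ∀ a b, ∑ c, (η c x * pd c (g a b) x + g c b x * pd a (η c) x
      + g a c x * pd b (η c) x) = 0)
    (hlK : ∀ a b, ∑ c, (η c x * pd c (K a b) x + K c b x * pd a (η c) x
      + K a c x * pd b (η c) x) = 0)
    (hc : ∀ a, ∑ c, (η c x * pd c (ξ a) x - ξ c x * pd c (η a) x) = 0) (a : Fin 4) :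
    ∑ c, (η c x * pd c (fun y => sqrtDet g y * sharpVec g K ξ a y) x
        - sqrtDet g x * sharpVec g K ξ c x * pd c (η a) x)
      + sqrtDet g x * sharpVec g K ξ a x * ∑ c, pd c (η c) x = 0 := by
  -- The vector `η` at `x`, so that `η^c ∂_c f` is a single directional derivative and the
  -- hypotheses become matrix equations.
  set v : E4 := ∑ c, η c x • EuclideanSpace.single c (1 : ℝ)
  have hv : ∀ f : E4 → ℝ, fderiv ℝ f x v = ∑ c, η c x * pd c f x := fun f => by
    simp only [v, map_sum, map_smul, smul_eq_mul, pd]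
  set G : Matrix (Fin 4) (Fin 4) ℝ := Matrix.of fun a b => g a b x
  set H : Matrix (Fin 4) (Fin 4) ℝ := Matrix.of fun a b => invMat g a b x
  set k : Matrix (Fin 4) (Fin 4) ℝ := Matrix.of fun a b => K a b x
  set dG : Matrix (Fin 4) (Fin 4) ℝ := Matrix.of fun a b => fderiv ℝ (g a b) x v
  set dK : Matrix (Fin 4) (Fin 4) ℝ := Matrix.of fun a b => fderiv ℝ (K a b) x v
  set B : Matrix (Fin 4) (Fin 4) ℝ := Matrix.of fun a c => pd a (η c) x
  set u : Fin 4 → ℝ := fun a => ξ a x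
  set du : Fin 4 → ℝ := fun a => fderiv ℝ (ξ a) x v
  have hHG : H * G = 1 := Matrix.nonsing_inv_mul _ (isUnit_iff_ne_zero.2 hd.ne')
  have hGH : G * H = 1 := Matrix.mul_nonsing_inv _ (isUnit_iff_ne_zero.2 hd.ne')
  -- With `B = (∂_a η^c)`, invariance of `g` and `K` reads `dG = -(BG + GBᵀ)` and `dK = -(BK +
  -- KBᵀ)`, and commutation reads `dξ = Bᵀξ`.
  have h1 : dG = -(B * G + G * B.transpose) := by
    refine eq_neg_of_add_eq_zero_left ?_
    ext a b
    have := hlg a b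
    simp only [Finset.sum_add_distrib, ← hv] at this
    simp only [Matrix.add_apply, Matrix.mul_apply, Matrix.transpose_apply, Matrix.zero_apply,
      Matrix.of_apply, dG, B, G]
    rw [← this, add_assoc]
    simp only [mul_comm]
  have h2 : dK = -(B * k + k * B.transpose) := by
    refine eq_neg_of_add_eq_zero_left ?_
    ext a b
    have := hlK a b
    simp only [Finset.sum_add_distrib, ← hv] at this
    simp only [Matrix.add_apply, Matrix.mul_apply, Matrix.transpose_apply, Matrix.zero_apply,
      Matrix.of_apply, dK, B, k]
    rw [← this, add_assoc]
    simp only [mul_comm]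
  have h3 : du = B.transpose.mulVec u := by
    ext a
    have := hc a
    simp only [Finset.sum_sub_distrib, ← hv] at this
    simp only [Matrix.mulVec, dotProduct, Matrix.transpose_apply, Matrix.of_apply, B, du, u]
    rw [sub_eq_zero.1 this]
    simp only [mul_comm]
  have hX : (fun a => sharpVec g K ξ a x) = H.mulVec (k.mulVec u) := rfl
  -- After substitution the derivative of `√g` contributes `-tr B`, the weight of a density, and the
  -- terms with `B` next to `K` cancel in pairs. What is left is the vector part `Bᵀ X`.
  have h4 : (1 / 2 * (H * dG).trace) • H.mulVec (k.mulVec u)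
      + (-(H * dG * H).mulVec (k.mulVec u) + H.mulVec (dK.mulVec u + k.mulVec du))
      = B.transpose.mulVec (H.mulVec (k.mulVec u)) - B.trace • H.mulVec (k.mulVec u) := by
    have e1 : (H * dG).trace = -2 * B.trace := by
      rw [h1, mul_neg, Matrix.trace_neg, mul_add, Matrix.trace_add, ← mul_assoc, ← mul_assoc, hHG,
        one_mul, Matrix.trace_transpose, mul_assoc, Matrix.trace_mul_comm, mul_assoc, hGH, mul_one]
      ring
    have e2 : H * dG * H = -(H * B + B.transpose * H) := by
      rw [h1, mul_neg, neg_mul, mul_add, add_mul, ← mul_assoc, ← mul_assoc, hHG, one_mul,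
        mul_assoc (H * B), hGH, mul_one]
    rw [e1, e2, h2, h3]
    simp only [Matrix.neg_mulVec, Matrix.add_mulVec, Matrix.mulVec_add, Matrix.mulVec_neg,
      ← Matrix.mulVec_mulVec]
    module
  have h5 := congrFun h4 a
  have h6 : ∑ p, ∑ q, 1 / 2 * (invMat g p q x * fderiv ℝ (g q p) x v)
      = 1 / 2 * (H * dG).trace := by
    simp only [Matrix.trace, Matrix.diag, Matrix.mul_apply, Finset.mul_sum]
    rfl
  have h7 : ∑ e, (-(∑ q, (∑ p, invMat g a p x * fderiv ℝ (g p q) x v) * invMat g q e x)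
          * ∑ b, K e b x * ξ b x
        + invMat g a e x * ∑ b, (fderiv ℝ (K e b) x v * ξ b x
          + K e b x * fderiv ℝ (ξ b) x v))
      = (-(H * dG * H).mulVec (k.mulVec u) + H.mulVec (dK.mulVec u + k.mulVec du)) a := by
    simp only [Pi.add_apply, Pi.neg_apply, Finset.sum_add_distrib, neg_mul, Finset.sum_neg_distrib,
      Matrix.mulVec, dotProduct, Matrix.mul_apply]
    rfl
  rw [Finset.sum_sub_distrib, ← hv, fderiv_density hg hK hξ hd, h7]
  simp only [← Finset.sum_mul]
  rw [h6]
  have h8 : ∑ c, sqrtDet g x * sharpVec g K ξ c x * pd c (η a) x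
      = sqrtDet g x * B.transpose.mulVec (H.mulVec (k.mulVec u)) a := by
    rw [← hX]
    simp only [Matrix.mulVec, dotProduct, Matrix.transpose_apply, Finset.mul_sum]
    exact Finset.sum_congr rfl fun c _ => by simp only [B, Matrix.of_apply]; ring
  have h9 : sharpVec g K ξ a x = (H.mulVec (k.mulVec u)) a := rfl
  have h10 : ∑ c, pd c (η c) x = B.trace := rfl
  rw [h8, h9, h10]
  simp only [Pi.add_apply, Pi.sub_apply, Pi.smul_apply, smul_eq_mul] at h5 ⊢
  linear_combination sqrtDet g x * h5

end CoordinateCalculus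
/-! ### Components in charts -/

section ChartComponents

variable {M : Type*} [TopologicalSpace M] [ChartedSpace E4 M] [IsManifold 𝓘(ℝ, E4) ∞ M]
  {e e' : OpenPartialHomeomorph M E4} {x : E4}

theorem mdifferentiable_of_mem_maximalAtlas (he : e ∈ IsManifold.maximalAtlas 𝓘(ℝ, E4) ∞ M) :
    e.MDifferentiable 𝓘(ℝ, E4) 𝓘(ℝ, E4) :=
  ⟨(contMDiffOn_of_mem_maximalAtlas he).mdifferentiableOn (by simp),
    (contMDiffOn_symm_of_mem_maximalAtlas he).mdifferentiableOn (by simp)⟩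

/-- The coordinate field is the image of a constant section under the tangent map of `e.symm`. -/
theorem contMDiffOn_coordVec (he : e ∈ IsManifold.maximalAtlas 𝓘(ℝ, E4) ∞ M) (a : Fin 4) :
    ContMDiffOn 𝓘(ℝ, E4) 𝓘(ℝ, E4).tangent ∞
      (fun x => (TotalSpace.mk' E4 (e.symm x) (coordVec e x a) : TangentBundle 𝓘(ℝ, E4) M))
      e.target := by
  have h1 := (contMDiffOn_symm_of_mem_maximalAtlas he).contMDiffOn_tangentMapWithin (m := ∞)
    (by simp) e.open_target.uniqueMDiffOn
  have h2 : ContMDiff 𝓘(ℝ, E4) 𝓘(ℝ, E4).tangent ∞ (fun x : E4 =>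
      (TotalSpace.mk' E4 x (EuclideanSpace.single a (1 : ℝ) : E4) : TangentBundle 𝓘(ℝ, E4) E4)) := by
    exact contMDiff_vectorSpace_iff_contDiff.2 contDiff_const
  refine (h1.comp h2.contMDiffOn (fun x hx => hx)).congr fun x hx => ?_
  simp only [Function.comp, tangentMapWithin, coordVec]
  rw [mfderivWithin_of_isOpen e.open_target hx]

theorem contDiffOn_comp₂ {T : Bilin M} (he : e ∈ IsManifold.maximalAtlas 𝓘(ℝ, E4) ∞ M)
    (hT : ContMDiff 𝓘(ℝ, E4) (𝓘(ℝ, E4).prod 𝓘(ℝ, E4 →L[ℝ] E4 →L[ℝ] ℝ)) ∞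
      (fun p => TotalSpace.mk' (E4 →L[ℝ] E4 →L[ℝ] ℝ)
        (E := fun p : M => TangentSpace 𝓘(ℝ, E4) p →L[ℝ] TangentSpace 𝓘(ℝ, E4) p →L[ℝ] ℝ) p (T p)))
    (a b : Fin 4) : ContDiffOn ℝ ∞ (comp₂ T e a b) e.target := by
  rw [← contMDiffOn_iff_contDiffOn]
  intro x hx
  have : ContMDiffWithinAt 𝓘(ℝ, E4) (𝓘(ℝ, E4).prod 𝓘(ℝ)) ∞
      (fun x => TotalSpace.mk' ℝ (E := Bundle.Trivial M ℝ) (e.symm x)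
        (T (e.symm x) (coordVec e x a) (coordVec e x b))) e.target x := by
    apply ContMDiffWithinAt.clm_bundle_apply₂ (F₁ := E4) (F₂ := E4)
    · exact ContMDiffAt.comp_contMDiffWithinAt x hT.contMDiffAt
        (contMDiffOn_symm_of_mem_maximalAtlas he x hx)
    · exact contMDiffOn_coordVec he a x hx
    · exact contMDiffOn_coordVec he b x hx
  simp only [contMDiffWithinAt_totalSpace] at this
  exact this.2

theorem E4_sum (v : E4) : v = ∑ a, v a • (EuclideanSpace.single a (1 : ℝ) : E4) := by
  ext b
  simp [Pi.single_apply]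

theorem mfderiv_symm_apply (v : E4) :
    mfderiv 𝓘(ℝ, E4) 𝓘(ℝ, E4) e.symm x v = ∑ a, v a • coordVec e x a := by
  conv_lhs => rw [E4_sum v]
  exact (map_sum _ _ _).trans (Finset.sum_congr rfl fun a _ => map_smul _ _ _)

theorem mfderiv_coordVec (he : e ∈ IsManifold.maximalAtlas 𝓘(ℝ, E4) ∞ M) (hx : x ∈ e.target)
    (v : E4) : (mfderiv 𝓘(ℝ, E4) 𝓘(ℝ, E4) e (e.symm x)
      (mfderiv 𝓘(ℝ, E4) 𝓘(ℝ, E4) e.symm x v) : E4) = v :=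
  congrArg (fun L => L v) ((mdifferentiable_of_mem_maximalAtlas he).comp_symm_deriv hx)

theorem mfderiv_symm_mfderiv (he : e ∈ IsManifold.maximalAtlas 𝓘(ℝ, E4) ∞ M) (hx : x ∈ e.target)
    (v : TangentSpace 𝓘(ℝ, E4) (e.symm x)) : mfderiv 𝓘(ℝ, E4) 𝓘(ℝ, E4) e.symm x
      (mfderiv 𝓘(ℝ, E4) 𝓘(ℝ, E4) e (e.symm x) v) = v := by
  have h := (mdifferentiable_of_mem_maximalAtlas he).symm_comp_deriv (e.map_target hx)
  rw [e.right_inv hx] at h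
  exact congrArg (fun L => L v) h

/-- A vector field is `X^a ∂_a`. -/
theorem sum_vecComp (he : e ∈ IsManifold.maximalAtlas 𝓘(ℝ, E4) ∞ M) (hx : x ∈ e.target)
    (X : ∀ p : M, TangentSpace 𝓘(ℝ, E4) p) :
    X (e.symm x) = ∑ a, vecComp X e a x • coordVec e x a := by
  rw [← mfderiv_symm_mfderiv he hx (X (e.symm x))]
  exact mfderiv_symm_apply _

/-- Coordinate vectors form a basis of the tangent space. -/
theorem exists_sum_coordVec (he : e ∈ IsManifold.maximalAtlas 𝓘(ℝ, E4) ∞ M) (hx : x ∈ e.target)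
    (v : TangentSpace 𝓘(ℝ, E4) (e.symm x)) :
    ∃ c : E4, v = mfderiv 𝓘(ℝ, E4) 𝓘(ℝ, E4) e.symm x c :=
  ⟨_, (mfderiv_symm_mfderiv he hx v).symm⟩

/-- The transition function of two charts. -/
def transition (e e' : OpenPartialHomeomorph M E4) (x : E4) : E4 := e' (e.symm x)

theorem contDiffAt_transition (he : e ∈ IsManifold.maximalAtlas 𝓘(ℝ, E4) ∞ M)
    (he' : e' ∈ IsManifold.maximalAtlas 𝓘(ℝ, E4) ∞ M) (hx : x ∈ e.target)
    (hx' : e.symm x ∈ e'.source) : ContDiffAt ℝ ∞ (transition e e') x := by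
  rw [← contMDiffAt_iff_contDiffAt]
  exact (contMDiffAt_of_mem_maximalAtlas he' hx').comp x
    (contMDiffAt_symm_of_mem_maximalAtlas he hx)

/-- The chain rule for `e.symm = e'.symm ∘ (e' ∘ e.symm)` near `x`. The base points of the two
tangent spaces are equal but not definitionally so, hence the vectors are compared in the model
space `E4`. -/
theorem mfderiv_symm_transition (he : e ∈ IsManifold.maximalAtlas 𝓘(ℝ, E4) ∞ M)
    (he' : e' ∈ IsManifold.maximalAtlas 𝓘(ℝ, E4) ∞ M) (hx : x ∈ e.target)
    (hx' : e.symm x ∈ e'.source) (v : E4) :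
    (mfderiv 𝓘(ℝ, E4) 𝓘(ℝ, E4) e.symm x v : E4)
      = mfderiv 𝓘(ℝ, E4) 𝓘(ℝ, E4) e'.symm (transition e e' x)
          (fderiv ℝ (transition e e') x v) := by
  have h1 : (fun y => e'.symm (transition e e' y)) =ᶠ[𝓝 x] e.symm := by
    have : ∀ᶠ y in 𝓝 x, e.symm y ∈ e'.source :=
      (e.continuousAt_symm hx).eventually (e'.open_source.mem_nhds hx')
    filter_upwards [this] with y hy
    exact e'.left_inv hy
  have h2 : MDifferentiableAt 𝓘(ℝ, E4) 𝓘(ℝ, E4) (transition e e') x :=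
    ((contDiffAt_transition he he' hx hx').differentiableAt (by simp)).mdifferentiableAt
  have h3 : MDifferentiableAt 𝓘(ℝ, E4) 𝓘(ℝ, E4) e'.symm (transition e e' x) :=
    (mdifferentiable_of_mem_maximalAtlas he').mdifferentiableAt_symm (e'.map_source hx')
  have h4 := mfderiv_comp x h3 h2
  have h5 := h1.mfderiv_eq (I := 𝓘(ℝ, E4)) (I' := 𝓘(ℝ, E4))
  rw [mfderiv_eq_fderiv] at h4
  have h6 := congrArg (fun L : E4 →L[ℝ] E4 => L v) (h5.symm.trans h4)
  exact h6

end ChartComponents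
/-! ### The generators in charts -/

section Generators

variable {M : Type*} [TopologicalSpace M] [ChartedSpace E4 M] [IsManifold 𝓘(ℝ, E4) ∞ M]
  [MulAction Torus M] [ContMDiffSMul torusModel 𝓘(ℝ, E4) ∞ Torus M]
  {e : OpenPartialHomeomorph M E4} {x : E4}

theorem torusExp_zero (i : Fin 2) : torusExp i 0 = 1 := by
  unfold torusExp
  split_ifs <;> simp

theorem contMDiff_torusExp (i : Fin 2) : ContMDiff 𝓘(ℝ, ℝ) torusModel ∞ (torusExp i) := by
  unfold torusExp
  split_ifs
  · exact contMDiff_circleExp.prodMk contMDiff_const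
  · exact contMDiff_const.prodMk contMDiff_circleExp

/-- The one-parameter group of the `i`-th generator in the chart `e`. -/
def chartFlow (e : OpenPartialHomeomorph M E4) (i : Fin 2) (z : ℝ × E4) : E4 :=
  e (torusExp i z.1 • e.symm z.2)

theorem contDiffAt_chartFlow (he : e ∈ IsManifold.maximalAtlas 𝓘(ℝ, E4) ∞ M) (i : Fin 2)
    (hx : x ∈ e.target) : ContDiffAt ℝ ∞ (chartFlow e i) (0, x) := by
  have h1 : ContMDiffAt 𝓘(ℝ, ℝ × E4) torusModel ∞ (fun z : ℝ × E4 => torusExp i z.1) (0, x) :=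
    (contMDiff_torusExp i).contMDiffAt.comp (0, x) (contDiffAt_fst.contMDiffAt)
  have h2 : ContMDiffAt 𝓘(ℝ, ℝ × E4) 𝓘(ℝ, E4) ∞ (fun z : ℝ × E4 => e.symm z.2) (0, x) :=
    (contMDiffAt_symm_of_mem_maximalAtlas he hx).comp (0, x)
      (contDiffAt_snd.contMDiffAt (x := ((0 : ℝ), x)))
  have h3 : ContMDiffAt 𝓘(ℝ, ℝ × E4) 𝓘(ℝ, E4) ∞
      (fun z : ℝ × E4 => torusExp i z.1 • e.symm z.2) (0, x) :=
    (ContMDiffSMul.contMDiff_smul (I := torusModel) (I' := 𝓘(ℝ, E4)) (n := ∞) (G := Torus)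
      (M := M)).contMDiffAt.comp (0, x) (h1.prodMk h2)
  rw [← contMDiffAt_iff_contDiffAt]
  refine ContMDiffAt.comp (0, x) (g := e) (I' := 𝓘(ℝ, E4)) ?_ h3
  refine contMDiffAt_of_mem_maximalAtlas he ?_
  simp only [torusExp_zero, one_smul]
  exact e.map_target hx

theorem chartFlow_zero (i : Fin 2) (hx : x ∈ e.target) : chartFlow e i (0, x) = x := by
  simp [chartFlow, torusExp_zero, e.right_inv hx]

/-- The components of the generator are the time derivative of its flow. -/
theorem vecComp_generator (he : e ∈ IsManifold.maximalAtlas 𝓘(ℝ, E4) ∞ M) (i : Fin 2)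
    (hx : x ∈ e.target) (a : Fin 4) :
    vecComp (generator i) e a x = (fderiv ℝ (chartFlow e i) (0, x) (1, 0)) a := by
  have h1 : HasFDerivAt (fun t : ℝ => (t, x)) (ContinuousLinearMap.inl ℝ ℝ E4) 0 :=
    hasFDerivAt_prodMk_left (0 : ℝ) x
  have h2 := ((contDiffAt_chartFlow he i hx).differentiableAt (by simp)).hasFDerivAt.comp
    (0 : ℝ) h1
  have h3 : (chartFlow e i ∘ fun t : ℝ => (t, x)) = e ∘ fun t : ℝ => torusExp i t • e.symm x := rfl
  have hp : torusExp i 0 • e.symm x = e.symm x := by rw [torusExp_zero, one_smul]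
  have h4 : MDifferentiableAt 𝓘(ℝ, ℝ) 𝓘(ℝ, E4) (fun t : ℝ => torusExp i t • e.symm x) 0 := by
    have : ContMDiff 𝓘(ℝ, ℝ) 𝓘(ℝ, E4) ∞ (fun t : ℝ => torusExp i t • e.symm x) :=
      (ContMDiffSMul.contMDiff_smul (I := torusModel) (I' := 𝓘(ℝ, E4)) (n := ∞) (G := Torus)
        (M := M)).comp ((contMDiff_torusExp i).prodMk contMDiff_const)
    exact (this.mdifferentiable (by simp)) 0
  have h5 : MDifferentiableAt 𝓘(ℝ, E4) 𝓘(ℝ, E4) e (torusExp i 0 • e.symm x) := by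
    rw [hp]
    exact (mdifferentiable_of_mem_maximalAtlas he).mdifferentiableAt (e.map_target hx)
  have h6 := mfderiv_comp (0 : ℝ) h5 h4
  rw [mfderiv_eq_fderiv, ← h3, h2.fderiv] at h6
  have h7 : (mfderiv 𝓘(ℝ, E4) 𝓘(ℝ, E4) e (e.symm x) (generator i (e.symm x)) : E4)
      = fderiv ℝ (chartFlow e i) (0, x) (1, 0) := by
    rw [hp] at h6
    exact (congrArg (fun L : ℝ →L[ℝ] E4 => L 1) h6).symm
  exact congrArg (fun v : E4 => v a) h7

theorem contDiffOn_chartGenerator (he : e ∈ IsManifold.maximalAtlas 𝓘(ℝ, E4) ∞ M) (i : Fin 2) :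
    ContDiffOn ℝ ∞ (fun x => fderiv ℝ (chartFlow e i) (0, x) (1, 0)) e.target := by
  intro x hx
  have h1 := (contDiffAt_chartFlow he i hx).fderiv_right (m := ∞) (by simp)
  have h2 : ContDiffAt ℝ ∞ (fun y : E4 => fderiv ℝ (chartFlow e i) (0, y)) x :=
    h1.comp x (contDiffAt_const.prodMk contDiffAt_id)
  exact (h2.clm_apply contDiffAt_const).contDiffWithinAt

theorem contDiffOn_vecComp_generator (he : e ∈ IsManifold.maximalAtlas 𝓘(ℝ, E4) ∞ M) (i : Fin 2)
    (a : Fin 4) : ContDiffOn ℝ ∞ (vecComp (generator (M := M) i) e a) e.target :=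
  ((EuclideanSpace.proj a : E4 →L[ℝ] ℝ).contDiff.comp_contDiffOn (contDiffOn_chartGenerator he i)).congr
    fun _ hx => vecComp_generator he i hx a

theorem hasDerivAt_time {V : Type*} [NormedAddCommGroup V] [NormedSpace ℝ V] {F : ℝ × E4 → V}
    {y : E4} (h : DifferentiableAt ℝ F (0, y)) :
    HasDerivAt (fun s => F (s, y)) (fderiv ℝ F (0, y) (1, 0)) 0 :=
  HasFDerivAt.comp_hasDerivAt (f := fun s : ℝ => (s, y)) (0 : ℝ) h.hasFDerivAt
    ((hasDerivAt_id (0 : ℝ)).prodMk (hasDerivAt_const (0 : ℝ) y))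

/-- For small times the orbit stays in the chart, so that `chartFlow` represents the action there.
-/
theorem eventually_torusExp_smul_mem (i : Fin 2) (hx : x ∈ e.target) :
    ∀ᶠ t in 𝓝 (0 : ℝ), torusExp i t • e.symm x ∈ e.source := by
  have h : ContMDiff 𝓘(ℝ, ℝ) 𝓘(ℝ, E4) ∞ (fun t : ℝ => torusExp i t • e.symm x) :=
    (ContMDiffSMul.contMDiff_smul (I := torusModel) (I' := 𝓘(ℝ, E4)) (n := ∞) (G := Torus)
      (M := M)).comp ((contMDiff_torusExp i).prodMk contMDiff_const)
  refine h.continuous.continuousAt.eventually (e.open_source.mem_nhds ?_)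
  simp only [torusExp_zero, one_smul]
  exact e.map_target hx

/-- The two generators commute. -/
theorem generators_commute (he : e ∈ IsManifold.maximalAtlas 𝓘(ℝ, E4) ∞ M) (i k : Fin 2)
    (hx : x ∈ e.target) (a : Fin 4) :
    ∑ c, (vecComp (generator k) e c x * pd c (vecComp (generator i) e a) x
      - vecComp (generator i) e c x * pd c (vecComp (generator k) e a) x) = 0 := by
  set F : ℝ × E4 → E4 := chartFlow e k
  set G : ℝ × E4 → E4 := chartFlow e i
  have hF := contDiffAt_chartFlow he k hx
  have hG := contDiffAt_chartFlow he i hx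
  set u : E4 → E4 := fun y => fderiv ℝ F (0, y) (1, 0)
  set v : E4 → E4 := fun y => fderiv ℝ G (0, y) (1, 0)
  have hu : DifferentiableAt ℝ u x := ((contDiffOn_chartGenerator he k).contDiffAt
    (e.open_target.mem_nhds hx)).differentiableAt (by simp)
  have hv : DifferentiableAt ℝ v x := ((contDiffOn_chartGenerator he i).contDiffAt
    (e.open_target.mem_nhds hx)).differentiableAt (by simp)
  -- `u` is invariant under the flow `G`
  have inv : ∀ᶠ s in 𝓝 (0 : ℝ), u (G (s, x)) = fderiv ℝ G (s, x) (0, u x) := by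
    have hcs : ContinuousAt (fun s : ℝ => ((s, x) : ℝ × E4)) 0 := by fun_prop
    have c1 := eventually_torusExp_smul_mem (e := e) i hx
    have c2 : ∀ᶠ s in 𝓝 (0 : ℝ), DifferentiableAt ℝ G (s, x) := by
      have := (hG.of_le (show (1 : ℕ∞ω) ≤ ∞ by simp)).eventually (by simp)
      filter_upwards [hcs.eventually this] with s hs using hs.differentiableAt (by simp)
    filter_upwards [c1, c2] with s hs1 hs2
    have hy : G (s, x) ∈ e.target := e.map_source hs1
    -- two expressions for `t ↦ F (t, G (s, x))`
    have d1 : HasDerivAt (fun t : ℝ => F (t, G (s, x))) (u (G (s, x))) 0 :=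
      hasDerivAt_time ((contDiffAt_chartFlow he k hy).differentiableAt (by simp))
    have d2 : HasDerivAt (fun t : ℝ => G (s, F (t, x))) (fderiv ℝ G (s, x) (0, u x)) 0 := by
      have h3 : HasDerivAt (fun t : ℝ => ((s, F (t, x)) : ℝ × E4)) (0, u x) 0 :=
        (hasDerivAt_const (0 : ℝ) s).prodMk (hasDerivAt_time (hF.differentiableAt (by simp)))
      have h4 : HasFDerivAt G (fderiv ℝ G (s, x)) (s, F (0, x)) := by
        rw [show F (0, x) = x from chartFlow_zero k hx]
        exact hs2.hasFDerivAt
      exact h4.comp_hasDerivAt (0 : ℝ) h3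
    -- The commutativity of the torus enters here: the two flows commute as long as both orbits stay
    -- in the chart.
    have hev : (fun t : ℝ => F (t, G (s, x))) =ᶠ[𝓝 0] fun t => G (s, F (t, x)) := by
      have c3 := eventually_torusExp_smul_mem (e := e) k hx
      filter_upwards [c3] with t ht
      simp only [F, G, chartFlow, e.left_inv hs1, e.left_inv ht, smul_smul, mul_comm]
    exact d1.unique (d2.congr_of_eventuallyEq hev)
  -- differentiate in `s`
  have hDG : DifferentiableAt ℝ (fderiv ℝ G) (0, x) :=
    (hG.fderiv_right (m := ∞) (by simp)).differentiableAt (by simp)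
  have e1 : HasDerivAt (fun s : ℝ => u (G (s, x))) (fderiv ℝ u x (v x)) 0 := by
    have h4 : HasFDerivAt u (fderiv ℝ u x) (G (0, x)) := by
      rw [show G (0, x) = x from chartFlow_zero i hx]
      exact hu.hasFDerivAt
    have h5 : HasDerivAt (fun s : ℝ => G (s, x)) (v x) 0 :=
      hasDerivAt_time (hG.differentiableAt (by simp))
    exact h4.comp_hasDerivAt (0 : ℝ) h5
  have e2 : HasDerivAt (fun s : ℝ => fderiv ℝ G (s, x) (0, u x))
      (fderiv ℝ (fderiv ℝ G) (0, x) (1, 0) (0, u x)) 0 := by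
    simpa using (hasDerivAt_time hDG).clm_apply (hasDerivAt_const (0 : ℝ) ((0 : ℝ), u x))
  have e3 : fderiv ℝ v x (u x) = fderiv ℝ (fderiv ℝ G) (0, x) (0, u x) (1, 0) := by
    have h0 : HasFDerivAt (fun y : E4 => ((0 : ℝ), y)) (ContinuousLinearMap.inr ℝ ℝ E4) x :=
      hasFDerivAt_prodMk_right (0 : ℝ) x
    have h2 := (hDG.hasFDerivAt.comp x h0).clm_apply (hasFDerivAt_const ((1 : ℝ), (0 : E4)) x)
    have h3 : HasFDerivAt v _ x := h2
    rw [h3.fderiv]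
    simp
  -- Both sides are the mixed second derivative of the flow `G` in time and in the direction `u x`,
  -- taken in the two orders.
  have key : fderiv ℝ u x (v x) = fderiv ℝ v x (u x) := by
    rw [e3, e1.unique (e2.congr_of_eventuallyEq inv)]
    have hs : IsSymmSndFDerivAt ℝ G (0, x) := hG.isSymmSndFDerivAt (by
      simpa using WithTop.coe_le_coe.2 (le_top : (2 : ℕ∞) ≤ ⊤))
    exact hs _ _
  -- Passes from the vector-valued derivative to the components; `vecComp` agrees with the velocity
  -- of the flow only on the target of the chart, which is a neighbourhood of `x`.
  have comp : ∀ (w : E4 → E4) (l : Fin 2), (∀ y ∈ e.target, ∀ b,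
      vecComp (generator (M := M) l) e b y = w y b) → DifferentiableAt ℝ w x → ∀ z : E4,
      ∑ c, z c * pd c (vecComp (generator (M := M) l) e a) x = fderiv ℝ w x z a := by
    intro w l hw hwd z
    have h1 : vecComp (generator (M := M) l) e a =ᶠ[𝓝 x] fun y => w y a := by
      filter_upwards [e.open_target.mem_nhds hx] with y hy using hw y hy a
    have h2 : HasFDerivAt (fun y => w y a)
        ((EuclideanSpace.proj a : E4 →L[ℝ] ℝ).comp (fderiv ℝ w x)) x :=
      (EuclideanSpace.proj a : E4 →L[ℝ] ℝ).hasFDerivAt.comp x hwd.hasFDerivAt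
    simp only [pd, h1.fderiv_eq, h2.fderiv]
    conv_rhs => rw [E4_sum z]
    simp
  rw [Finset.sum_sub_distrib]
  simp only [vecComp_generator he _ hx]
  have k1 := comp v i (fun y hy b => vecComp_generator he i hy b) hv (u x)
  have k2 := comp u k (fun y hy b => vecComp_generator he k hy b) hu (v x)
  refine sub_eq_zero.2 (k1.trans (Eq.trans ?_ k2.symm))
  rw [key]

end Generators
/-! ### The metric in charts and the flux field -/

section Flux

/-- The quadratic form of the Gram matrix at `x` is the value of `B` on `∑ x_a w_a`, so the matrix
is positive definite when the `w_a` are independent. -/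
theorem gram_det_pos {n V : Type*} [Fintype n] [DecidableEq n] [AddCommGroup V] [Module ℝ V]
    (B : V →ₗ[ℝ] V →ₗ[ℝ] ℝ) (hs : ∀ v w, B v w = B w v) (hp : ∀ v, v ≠ 0 → 0 < B v v)
    (w : n → V) (hw : LinearIndependent ℝ w) :
    0 < (Matrix.of fun a b => B (w a) (w b)).det := by
  refine Matrix.PosDef.det_pos (Matrix.PosDef.of_dotProduct_mulVec_pos ?_ fun x hx => ?_)
  · ext a b
    simp [hs (w a)]
  · have h1 : dotProduct (star x) ((Matrix.of fun a b => B (w a) (w b)).mulVec x)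
        = B (∑ a, x a • w a) (∑ a, x a • w a) := by
      simp only [map_sum, LinearMap.sum_apply, map_smul, LinearMap.smul_apply, smul_eq_mul,
        Matrix.mulVec, dotProduct, Matrix.of_apply, star_trivial, Finset.mul_sum]
      rw [Finset.sum_comm]
      exact Finset.sum_congr rfl fun a _ => Finset.sum_congr rfl fun b _ => by ring
    rw [h1]
    refine hp _ fun h0 => hx ?_
    ext a
    exact Fintype.linearIndependent_iff.1 hw x h0 a

variable {M : Type*} [TopologicalSpace M] [ChartedSpace E4 M] [IsManifold 𝓘(ℝ, E4) ∞ M]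
  {e e' : OpenPartialHomeomorph M E4} {x : E4}

theorem linearIndependent_coordVec (he : e ∈ IsManifold.maximalAtlas 𝓘(ℝ, E4) ∞ M)
    (hx : x ∈ e.target) : LinearIndependent ℝ (coordVec e x) := by
  rw [Fintype.linearIndependent_iff]
  intro c hc a
  have h1 : (mfderiv 𝓘(ℝ, E4) 𝓘(ℝ, E4) e.symm x (WithLp.toLp 2 c : E4)) = 0 := by
    rw [mfderiv_symm_apply]
    exact hc
  have h2 := mfderiv_coordVec he hx (WithLp.toLp 2 c : E4)
  rw [h1, map_zero] at h2
  exact (congrArg (fun v : E4 => v a) h2).symm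

variable [MulAction Torus M] (D : InitialData M)

/-- The components of the metric. -/
abbrev InitialData.metricComp (e : OpenPartialHomeomorph M E4) : Fin 4 → Fin 4 → E4 → ℝ :=
  comp₂ D.h.inner e

/-- The metric as a bilinear map without continuity. -/
def InitialData.innerLin (p : M) :
    TangentSpace 𝓘(ℝ, E4) p →ₗ[ℝ] TangentSpace 𝓘(ℝ, E4) p →ₗ[ℝ] ℝ :=
  LinearMap.mk₂ ℝ (fun u v => D.h.inner p u v) (by simp) (by simp) (by simp) (by simp)

theorem InitialData.metricComp_det_pos (he : e ∈ IsManifold.maximalAtlas 𝓘(ℝ, E4) ∞ M)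
    (hx : x ∈ e.target) : 0 < (Matrix.of fun a b => D.metricComp e a b x).det :=
  gram_det_pos (D.innerLin (e.symm x)) (D.h.symm _) (D.h.pos _) (coordVec e x)
    (linearIndependent_coordVec he hx)

theorem InitialData.metricComp_symm (a b : Fin 4) : D.metricComp e a b = D.metricComp e b a :=
  funext fun _ => D.h.symm _ _ _

theorem InitialData.contDiffAt_metricComp (he : e ∈ IsManifold.maximalAtlas 𝓘(ℝ, E4) ∞ M)
    (hx : x ∈ e.target) (a b : Fin 4) : ContDiffAt ℝ ∞ (D.metricComp e a b) x :=
  (contDiffOn_comp₂ he D.h.contMDiff a b).contDiffAt (e.open_target.mem_nhds hx)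

theorem InitialData.contDiffAt_K (he : e ∈ IsManifold.maximalAtlas 𝓘(ℝ, E4) ∞ M)
    (hx : x ∈ e.target) (a b : Fin 4) : ContDiffAt ℝ ∞ (comp₂ D.K e a b) x :=
  (contDiffOn_comp₂ he D.K_smooth a b).contDiffAt (e.open_target.mem_nhds hx)

/-- The components of the vector field `K^a_b ξ_(i)^b`. -/
def InitialData.fluxComp (i : Fin 2) (e : OpenPartialHomeomorph M E4) (a : Fin 4) : E4 → ℝ :=
  sharpVec (D.metricComp e) (comp₂ D.K e) (vecComp (generator i) e) a

/-- The volume density `√(det g)`. -/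
def InitialData.volDensity (e : OpenPartialHomeomorph M E4) : E4 → ℝ := sqrtDet (D.metricComp e)

theorem InitialData.volDensity_pos (he : e ∈ IsManifold.maximalAtlas 𝓘(ℝ, E4) ∞ M)
    (hx : x ∈ e.target) : 0 < D.volDensity e x :=
  Real.sqrt_pos.2 (D.metricComp_det_pos he hx)

theorem InitialData.contDiffAt_volDensity (he : e ∈ IsManifold.maximalAtlas 𝓘(ℝ, E4) ∞ M)
    (hx : x ∈ e.target) : ContDiffAt ℝ ∞ (D.volDensity e) x :=
  contDiffAt_sqrtDet (D.contDiffAt_metricComp he hx) (D.metricComp_det_pos he hx)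

/-! ### Raising indices, and the flux field as an intrinsic vector field -/

section Sharp

theorem linearIndependent_stdBasis (p : M) : LinearIndependent ℝ (stdBasis p) := by
  rw [Fintype.linearIndependent_iff]
  intro c hc a
  have : (∑ a, c a • (EuclideanSpace.single a (1 : ℝ) : E4)) = 0 := hc
  have h2 := congrArg (fun v : E4 => v a) this
  simpa [Pi.single_apply] using h2

theorem sum_stdBasis (p : M) (v : TangentSpace 𝓘(ℝ, E4) p) :
    ∃ c : Fin 4 → ℝ, v = ∑ a, c a • stdBasis p a := ⟨fun a => (show E4 from v) a, E4_sum v⟩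

/-- The inverse Gram matrix of the standard basis of `T_p M`. -/
def InitialData.invGram (p : M) : Matrix (Fin 4) (Fin 4) ℝ :=
  (Matrix.of fun a b => D.h.inner p (stdBasis p a) (stdBasis p b))⁻¹

/-- The vector metrically dual to a covector. -/
def InitialData.sharp (p : M) (α : TangentSpace 𝓘(ℝ, E4) p →ₗ[ℝ] ℝ) : TangentSpace 𝓘(ℝ, E4) p :=
  ∑ a, (∑ c, D.invGram p a c * α (stdBasis p c)) • stdBasis p a

theorem InitialData.inner_sharp (p : M) (α : TangentSpace 𝓘(ℝ, E4) p →ₗ[ℝ] ℝ)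
    (w : TangentSpace 𝓘(ℝ, E4) p) : D.h.inner p (D.sharp p α) w = α w := by
  have hd : (Matrix.of fun a b => D.h.inner p (stdBasis p a) (stdBasis p b)).det ≠ 0 :=
    (gram_det_pos (D.innerLin p) (D.h.symm _) (D.h.pos _) (stdBasis p)
      (linearIndependent_stdBasis p)).ne'
  have h1 : ∀ d, D.h.inner p (D.sharp p α) (stdBasis p d) = α (stdBasis p d) := by
    intro d
    have h2 := Matrix.mul_nonsing_inv _ (isUnit_iff_ne_zero.2 hd)
    have h3 : ∀ c, ∑ a, D.h.inner p (stdBasis p d) (stdBasis p a) * D.invGram p a c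
        = (1 : Matrix (Fin 4) (Fin 4) ℝ) d c := fun c => by
      rw [← h2, Matrix.mul_apply]; rfl
    rw [D.h.symm]
    simp only [InitialData.sharp, map_sum, map_smul, smul_eq_mul, Finset.sum_mul]
    rw [Finset.sum_comm]
    have h4 : ∀ c, ∑ a, D.invGram p a c * α (stdBasis p c)
        * D.h.inner p (stdBasis p d) (stdBasis p a)
        = (1 : Matrix (Fin 4) (Fin 4) ℝ) d c * α (stdBasis p c) := fun c => by
      rw [← h3, Finset.sum_mul]
      exact Finset.sum_congr rfl fun a _ => by ring
    simp [h4, Matrix.one_apply]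
  obtain ⟨c, rfl⟩ := sum_stdBasis p w
  simp only [map_sum, map_smul, h1]

theorem InitialData.inner_left_injective (p : M) {u v : TangentSpace 𝓘(ℝ, E4) p}
    (h : ∀ w, D.h.inner p u w = D.h.inner p v w) : u = v := by
  by_contra hne
  have h1 := D.h.pos p (u - v) (sub_ne_zero.2 hne)
  have h2 := h (u - v)
  rw [map_sub, D.h.symm p _ u, D.h.symm p _ v, h2, sub_self] at h1
  exact lt_irrefl _ h1

theorem InitialData.sharp_xiFlat (i : Fin 2) (p : M) :
    D.sharp p (D.xiFlat i p) = generator i p :=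
  D.inner_left_injective p fun w => (D.inner_sharp p _ w).trans rfl

/-- The vector field `K^a_b ξ_(i)^b`. -/
def InitialData.flux (i : Fin 2) (p : M) : TangentSpace 𝓘(ℝ, E4) p := D.sharp p (D.S i p)

theorem InitialData.inner_flux (i : Fin 2) (p : M) (w : TangentSpace 𝓘(ℝ, E4) p) :
    D.h.inner p (D.flux i p) w = D.K p (generator i p) w := D.inner_sharp p _ w

/-- The flux is defined through `stdBasis`, the basis used by the Hodge star. In any chart it agrees
with `fluxComp`, because both solve `g_{cb} X^b = K_{cb} ξ^b` and the metric is invertible. -/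
theorem InitialData.vecComp_flux (he : e ∈ IsManifold.maximalAtlas 𝓘(ℝ, E4) ∞ M)
    (hx : x ∈ e.target) (i : Fin 2) (a : Fin 4) :
    vecComp (D.flux i) e a x = D.fluxComp i e a x := by
  have h1 : ∀ c, ∑ b, D.metricComp e c b x * vecComp (D.flux i) e b x
      = ∑ b, comp₂ D.K e c b x * vecComp (generator i) e b x := by
    intro c
    have h2 := D.inner_flux i (e.symm x) (coordVec e x c)
    rw [D.h.symm, D.K_symm, sum_vecComp he hx (D.flux i), sum_vecComp he hx (generator i)] at h2
    simp only [map_sum, map_smul, smul_eq_mul] at h2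
    convert h2 using 2 <;> exact mul_comm _ _
  have h3 := Matrix.nonsing_inv_mul _ (isUnit_iff_ne_zero.2 (D.metricComp_det_pos he hx).ne')
  have h4 : ((Matrix.of fun a b => D.metricComp e a b x)⁻¹).mulVec
      ((Matrix.of fun a b => D.metricComp e a b x).mulVec fun b => vecComp (D.flux i) e b x) a
      = vecComp (D.flux i) e a x := by
    rw [Matrix.mulVec_mulVec, h3, Matrix.one_mulVec]
  rw [← h4]
  simp only [Matrix.mulVec, dotProduct, Matrix.of_apply, h1]
  rfl

end Sharp

variable [ContMDiffSMul torusModel 𝓘(ℝ, E4) ∞ Torus M]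

theorem contDiffAt_vecComp_generator (he : e ∈ IsManifold.maximalAtlas 𝓘(ℝ, E4) ∞ M)
    (hx : x ∈ e.target) (i : Fin 2) (a : Fin 4) :
    ContDiffAt ℝ ∞ (vecComp (generator (M := M) i) e a) x :=
  (contDiffOn_vecComp_generator he i a).contDiffAt (e.open_target.mem_nhds hx)

theorem InitialData.contDiffAt_fluxComp (he : e ∈ IsManifold.maximalAtlas 𝓘(ℝ, E4) ∞ M)
    (hx : x ∈ e.target) (i : Fin 2) (a : Fin 4) : ContDiffAt ℝ ∞ (D.fluxComp i e a) x :=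
  contDiffAt_sharpVec (D.contDiffAt_metricComp he hx) (D.contDiffAt_K he hx)
    (contDiffAt_vecComp_generator he hx i) (D.metricComp_det_pos he hx) a

/-- The flux field is divergence free. -/
theorem InitialData.div_flux (he : e ∈ IsManifold.maximalAtlas 𝓘(ℝ, E4) ∞ M)
    (hx : x ∈ e.target) {i : Fin 2} (hj : ∀ p : M, D.j p (generator i p) = 0) :
    ∑ a, pd a (fun y => D.volDensity e y * D.fluxComp i e a y) x = 0 := by
  refine sum_pd_density_eq_zero (fun a b => (D.contDiffAt_metricComp he hx a b).of_le (by simp))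
    (fun a b => (D.contDiffAt_K he hx a b).of_le (by simp))
    (fun a => (contDiffAt_vecComp_generator he hx i a).of_le (by simp))
    (D.metricComp_det_pos he hx) D.metricComp_symm (fun a b => funext fun _ => D.K_symm _ _ _)
    (D.killing i e he x hx) ?_
  -- The momentum constraint contracted with the generator is `8π j(ξ_(i))`, which is zero.
  have h1 : ∑ b, divComp D.h.inner D.K e b x * vecComp (generator i) e b x = 0 := by
    have h2 := hj (e.symm x)
    rw [sum_vecComp he hx (generator i)] at h2
    simp only [map_sum, map_smul, smul_eq_mul] at h2
    simp only [D.momentum e he x hx, mul_assoc, ← Finset.mul_sum]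
    refine mul_eq_zero_of_right _ (mul_eq_zero_of_right _ ?_)
    rw [← h2]
    exact Finset.sum_congr rfl fun b _ => mul_comm _ _
  exact h1

/-- The flux density is invariant under the action. -/
theorem InitialData.lie_flux (he : e ∈ IsManifold.maximalAtlas 𝓘(ℝ, E4) ∞ M)
    (hx : x ∈ e.target) (i k : Fin 2) (a : Fin 4) :
    ∑ c, (vecComp (generator k) e c x * pd c (fun y => D.volDensity e y * D.fluxComp i e a y) x
        - D.volDensity e x * D.fluxComp i e c x * pd c (vecComp (generator k) e a) x)
      + D.volDensity e x * D.fluxComp i e a x * ∑ c, pd c (vecComp (generator k) e c) x = 0 :=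
  lie_density_eq_zero (fun a b => (D.contDiffAt_metricComp he hx a b).of_le (by simp))
    (fun a b => (D.contDiffAt_K he hx a b).of_le (by simp))
    (fun a => (contDiffAt_vecComp_generator he hx i a).of_le (by simp))
    (D.metricComp_det_pos he hx) (D.killing k e he x hx) (D.invariant k e he x hx)
    (generators_commute he i k hx) a

end Flux
/-! ### Gluing local primitives over a simply connected space -/

section Gluing

/-- The real line with the discrete topology. -/
def DiscreteReal : Type := ℝ

instance : TopologicalSpace DiscreteReal := ⊥

instance : DiscreteTopology DiscreteReal := ⟨rfl⟩

/-- The identity from the discrete real line. -/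
def DiscreteReal.toReal : DiscreteReal → ℝ := id

/-- The identity to the discrete real line. -/
def DiscreteReal.ofReal : ℝ → DiscreteReal := id

theorem DiscreteReal.eventually_eq (v : DiscreteReal) : ∀ᶠ w in 𝓝 v, w = v := by
  rw [nhds_discrete]
  exact rfl

variable {X : Type*} [TopologicalSpace X]

/-- The covering of `X` whose local sections are the functions that differ from the local
functions `f p`, defined on `U p`, by constants. -/
def primitiveBundle (U : X → Set X) (hU : ∀ p, IsOpen (U p)) (hmem : ∀ p, p ∈ U p)
    (f : X → X → ℝ)
    (hf : ∀ p q, ∀ x ∈ U p ∩ U q, ∀ᶠ y in 𝓝 x, f p y - f q y = f p x - f q x) :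
    FiberBundleCore X X DiscreteReal where
  baseSet := U
  isOpen_baseSet := hU
  indexAt := id
  mem_baseSet_at := hmem
  coordChange p q x v := .ofReal (v.toReal + (f p x - f q x))
  coordChange_self p x _ v := by
    show v.toReal + (f p x - f p x) = v.toReal
    ring
  continuousOn_coordChange p q := by
    rintro ⟨x, v⟩ ⟨hx, -⟩
    refine ContinuousAt.continuousWithinAt ?_
    -- The coordinate change is locally constant in both variables: the fibre is discrete and `f p -
    -- f q` is locally constant.
    have : (fun z : X × DiscreteReal => DiscreteReal.ofReal (z.2.toReal + (f p z.1 - f q z.1)))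
        =ᶠ[𝓝 (x, v)] fun _ => .ofReal (v.toReal + (f p x - f q x)) := by
      have h1 : ∀ᶠ z : X × DiscreteReal in 𝓝 (x, v), z.2 = v :=
        Filter.Tendsto.eventually (p := fun w => w = v)
          (continuous_snd.continuousAt (x := ((x, v) : X × DiscreteReal))) v.eventually_eq
      have h2 : ∀ᶠ z : X × DiscreteReal in 𝓝 (x, v), f p z.1 - f q z.1 = f p x - f q x :=
        Filter.Tendsto.eventually (p := fun y => f p y - f q y = f p x - f q x)
          (continuous_fst.continuousAt (x := ((x, v) : X × DiscreteReal))) (hf p q x hx)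
      filter_upwards [h1, h2] with z hz1 hz2
      rw [hz1, hz2]
    exact this.continuousAt
  coordChange_comp p q r x _ v := by
    show v.toReal + (f p x - f q x) + (f q x - f r x) = v.toReal + (f p x - f r x)
    ring

/-- On a simply connected space, local functions that differ by locally constant functions are the
restrictions of a global function, up to constants. -/
theorem exists_global_of_local [SimplyConnectedSpace X] [LocallyPathConnectedSpace X]
    (U : X → Set X) (hU : ∀ p, IsOpen (U p)) (hmem : ∀ p, p ∈ U p) (f : X → X → ℝ)
    (hf : ∀ p q, ∀ x ∈ U p ∩ U q, ∀ᶠ y in 𝓝 x, f p y - f q y = f p x - f q x) :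
    ∃ Y : X → ℝ, ∀ p, ∃ c : ℝ, ∀ᶠ x in 𝓝 p, Y x = f p x + c := by
  set Z := primitiveBundle U hU hmem f hf
  -- A fibre bundle with discrete fibre is a covering, so over a simply connected base the identity
  -- map lifts to a section `σ`.
  have hcov : IsCoveringMap (TotalSpace.proj : TotalSpace DiscreteReal Z.Fiber → X) :=
    FiberBundle.isCoveringMap
  obtain ⟨x₀⟩ : Nonempty X := inferInstance
  obtain ⟨σ, ⟨-, hσ⟩, -⟩ := hcov.existsUnique_continuousMap_lifts (ContinuousMap.id X) x₀
    (⟨x₀, DiscreteReal.ofReal 0⟩ : TotalSpace DiscreteReal Z.Fiber) rfl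
  have hp : ∀ x, (σ x).proj = x := fun x => congrFun hσ x
  -- The fibre over `x` is read in the trivialization with index `x`, so `(σ x).snd` is the constant
  -- to be added to `f x` at the point `x` itself.
  refine ⟨fun x => DiscreteReal.toReal (σ x).snd + f x x, fun p => ?_⟩
  have hc : ContinuousAt (fun x => ((Z.localTriv p) (σ x)).2) p := by
    have h1 : ContinuousAt (Z.localTriv p) (σ p) := by
      refine (Z.localTriv p).continuousAt ?_
      rw [Trivialization.mem_source]
      have h0 : (σ p).proj ∈ U p := by
        rw [hp]
        exact hmem p
      exact h0
    exact continuousAt_snd.comp (ContinuousAt.comp (f := σ) h1 σ.continuous.continuousAt)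
  -- Read in the fixed trivialization at `p`, the section is continuous with discrete values, hence
  -- locally constant. Its value at `p` is the constant `c`.
  have h2 : ∀ᶠ x in 𝓝 p, ((Z.localTriv p) (σ x)).2 = ((Z.localTriv p) (σ p)).2 :=
    hc.eventually (DiscreteReal.eventually_eq _)
  refine ⟨((Z.localTriv p) (σ p)).2.toReal, ?_⟩
  filter_upwards [h2] with x hx
  have h3 : ((Z.localTriv p) (σ x)).2.toReal
      = DiscreteReal.toReal (σ x).snd + (f (σ x).proj (σ x).proj - f p (σ x).proj) := rfl
  rw [hp x] at h3
  rw [← hx, h3]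
  ring

end Gluing
/-! ### The twist form -/

section Twist

theorem alternating_sum_slots {V : Type*} [AddCommGroup V] [Module ℝ V]
    (vol : V [⋀^Fin 4]→ₗ[ℝ] ℝ) (B : Fin 4 → V) (c₀ c₁ c₂ : Fin 4 → ℝ) (w : V) :
    vol ![∑ a, c₀ a • B a, ∑ b, c₁ b • B b, ∑ c, c₂ c • B c, w]
      = ∑ a, ∑ b, ∑ c, c₀ a * c₁ b * c₂ c * vol ![B a, B b, B c, w] := by
  have h0 : ∀ (c : Fin 4 → ℝ) (u v : V),
      vol ![∑ a, c a • B a, u, v, w] = ∑ a, c a * vol ![B a, u, v, w] := by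
    intro c u v
    have hu : ∀ y, Function.update ![0, u, v, w] 0 y = ![y, u, v, w] := by
      intro y
      funext k
      fin_cases k <;> rfl
    have h := vol.toMultilinearMap.map_update_sum Finset.univ 0 (fun a => c a • B a) ![0, u, v, w]
    have hs := fun r y => vol.toMultilinearMap.map_update_smul ![0, u, v, w] 0 r y
    simp only [hu, smul_eq_mul] at h hs
    exact h.trans (Finset.sum_congr rfl fun a _ => hs _ _)
  have h1 : ∀ (c : Fin 4 → ℝ) (u v : V),
      vol ![u, ∑ a, c a • B a, v, w] = ∑ a, c a * vol ![u, B a, v, w] := by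
    intro c u v
    have hu : ∀ y, Function.update ![u, 0, v, w] 1 y = ![u, y, v, w] := by
      intro y
      funext k
      fin_cases k <;> rfl
    have h := vol.toMultilinearMap.map_update_sum Finset.univ 1 (fun a => c a • B a) ![u, 0, v, w]
    have hs := fun r y => vol.toMultilinearMap.map_update_smul ![u, 0, v, w] 1 r y
    simp only [hu, smul_eq_mul] at h hs
    exact h.trans (Finset.sum_congr rfl fun a _ => hs _ _)
  have h2 : ∀ (c : Fin 4 → ℝ) (u v : V),
      vol ![u, v, ∑ a, c a • B a, w] = ∑ a, c a * vol ![u, v, B a, w] := by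
    intro c u v
    have hu : ∀ y, Function.update ![u, v, 0, w] 2 y = ![u, v, y, w] := by
      intro y
      funext k
      fin_cases k <;> rfl
    have h := vol.toMultilinearMap.map_update_sum Finset.univ 2 (fun a => c a • B a) ![u, v, 0, w]
    have hs := fun r y => vol.toMultilinearMap.map_update_smul ![u, v, 0, w] 2 r y
    simp only [hu, smul_eq_mul] at h hs
    exact h.trans (Finset.sum_congr rfl fun a _ => hs _ _)
  simp only [h0, h1, h2, Finset.mul_sum, mul_assoc]

/-- The signs of the five nontrivial permutations of the first three slots, needed to collect the
six terms of a wedge product. -/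
theorem alternating_perms {V : Type*} [AddCommGroup V] [Module ℝ V]
    (vol : V [⋀^Fin 4]→ₗ[ℝ] ℝ) (a b c w : V) :
    vol ![b, a, c, w] = -vol ![a, b, c, w] ∧ vol ![a, c, b, w] = -vol ![a, b, c, w] ∧
      vol ![b, c, a, w] = vol ![a, b, c, w] ∧ vol ![c, a, b, w] = vol ![a, b, c, w] ∧
      vol ![c, b, a, w] = -vol ![a, b, c, w] := by
  have s01 : ∀ a b c : V, vol ![b, a, c, w] = -vol ![a, b, c, w] := by
    intro a b c
    rw [← vol.map_swap ![a, b, c, w] (show (0 : Fin 4) ≠ 1 by decide)]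
    congr 1
    ext k
    fin_cases k <;> rfl
  have s12 : ∀ a b c : V, vol ![a, c, b, w] = -vol ![a, b, c, w] := by
    intro a b c
    rw [← vol.map_swap ![a, b, c, w] (show (1 : Fin 4) ≠ 2 by decide)]
    congr 1
    ext k
    fin_cases k <;> rfl
  refine ⟨s01 _ _ _, s12 _ _ _, ?_, ?_, ?_⟩
  · rw [s12, s01]; ring
  · rw [s01, s12]; ring
  · rw [s01, s12, s01]; ring

theorem wedge₃_apply {V : Type*} [AddCommGroup V] [Module ℝ V] (α β γ : V →ₗ[ℝ] ℝ) (u v w : V) :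
    wedge₃ α β γ ![u, v, w] = α u * β v * γ w - α u * γ v * β w - β u * α v * γ w
      + β u * γ v * α w + γ u * α v * β w - γ u * β v * α w := by
  have h : wedge₃ α β γ ![u, v, w] = Matrix.det (Matrix.of
      ![![α u, β u, γ u], ![α v, β v, γ v], ![α w, β w, γ w]] : Matrix (Fin 3) (Fin 3) ℝ) := by
    show Matrix.det (n := Fin 3) (R := ℝ) _ = _
    congr 1
    ext k l
    fin_cases k <;> fin_cases l <;> rfl
  rw [h, Matrix.det_fin_three]
  simp

variable {M : Type*} [TopologicalSpace M] [ChartedSpace E4 M] [IsManifold 𝓘(ℝ, E4) ∞ M]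
  [MulAction Torus M] (D : InitialData M) {e : OpenPartialHomeomorph M E4} {x : E4}

theorem InitialData.invGram_symm (p : M) (a b : Fin 4) : D.invGram p a b = D.invGram p b a := by
  have h : (Matrix.of fun a b => D.h.inner p (stdBasis p a) (stdBasis p b)).transpose
      = Matrix.of fun a b => D.h.inner p (stdBasis p a) (stdBasis p b) := by
    ext c d
    exact D.h.symm _ _ _
  have h2 := Matrix.transpose_nonsing_inv
    (Matrix.of fun a b => D.h.inner p (stdBasis p a) (stdBasis p b))
  rw [h] at h2
  exact congrFun (congrFun h2 b) a

/-- Raising the three indices of `α ⊗ β ⊗ γ` replaces each covector by its dual vector in the slots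
of the volume form. -/
theorem InitialData.sum_invGram_vol (p : M) (α β γ : TangentSpace 𝓘(ℝ, E4) p →ₗ[ℝ] ℝ)
    (w : TangentSpace 𝓘(ℝ, E4) p) :
    ∑ u : Fin 4 × Fin 4 × Fin 4, ∑ v : Fin 4 × Fin 4 × Fin 4,
      D.invGram p u.1 v.1 * D.invGram p u.2.1 v.2.1 * D.invGram p u.2.2 v.2.2
      * (α (stdBasis p u.1) * β (stdBasis p u.2.1) * γ (stdBasis p u.2.2))
      * D.vol p ![stdBasis p v.1, stdBasis p v.2.1, stdBasis p v.2.2, w]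
    = D.vol p ![D.sharp p α, D.sharp p β, D.sharp p γ, w] := by
  simp only [InitialData.sharp]
  rw [alternating_sum_slots, Finset.sum_comm]
  simp only [Fintype.sum_prod_type]
  refine Finset.sum_congr rfl fun a' _ => Finset.sum_congr rfl fun b' _ =>
    Finset.sum_congr rfl fun c' _ => ?_
  rw [Finset.sum_mul_sum, Finset.sum_mul, Finset.sum_mul]
  refine Finset.sum_congr rfl fun a _ => ?_
  rw [Finset.sum_mul_sum, Finset.sum_mul]
  refine Finset.sum_congr rfl fun b _ => ?_
  rw [Finset.sum_mul]
  refine Finset.sum_congr rfl fun c _ => ?_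
  rw [D.invGram_symm p a' a, D.invGram_symm p b' b, D.invGram_symm p c' c]
  ring

/-- The twist form is `ι_{ξ₂} ι_{ξ₁} ι_X vol`, where `X` is the flux field. -/
theorem InitialData.twistForm_eq (i : Fin 2) (p : M) (w : TangentSpace 𝓘(ℝ, E4) p) :
    D.twistForm i p w = D.vol p ![D.flux i p, generator 0 p, generator 1 p, w] := by
  have h : ∀ α β γ : TangentSpace 𝓘(ℝ, E4) p →ₗ[ℝ] ℝ,
      hodgeStar₃ (stdBasis p) (fun u v => D.h.inner p u v) (D.vol p) (wedge₃ α β γ) w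
        = D.vol p ![D.sharp p α, D.sharp p β, D.sharp p γ, w] := by
    intro α β γ
    -- The six terms of the wedge product give the same value up to the sign that the volume form
    -- absorbs, which compensates the factor `1/6`.
    have h1 : hodgeStar₃ (stdBasis p) (fun u v => D.h.inner p u v) (D.vol p) (wedge₃ α β γ) w
      = 1 / 6 * (D.vol p ![D.sharp p α, D.sharp p β, D.sharp p γ, w]
        - D.vol p ![D.sharp p α, D.sharp p γ, D.sharp p β, w]
        - D.vol p ![D.sharp p β, D.sharp p α, D.sharp p γ, w]
        + D.vol p ![D.sharp p β, D.sharp p γ, D.sharp p α, w]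
        + D.vol p ![D.sharp p γ, D.sharp p α, D.sharp p β, w]
        - D.vol p ![D.sharp p γ, D.sharp p β, D.sharp p α, w]) := by
      have h2 : hodgeStar₃ (stdBasis p) (fun u v => D.h.inner p u v) (D.vol p) (wedge₃ α β γ) w
          = 1 / 6 * ∑ u : Fin 4 × Fin 4 × Fin 4, ∑ v : Fin 4 × Fin 4 × Fin 4,
            D.invGram p u.1 v.1 * D.invGram p u.2.1 v.2.1 * D.invGram p u.2.2 v.2.2
            * wedge₃ α β γ ![stdBasis p u.1, stdBasis p u.2.1, stdBasis p u.2.2]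
            * D.vol p ![stdBasis p v.1, stdBasis p v.2.1, stdBasis p v.2.2, w] := by
        simp only [Fintype.sum_prod_type]
        rfl
      rw [h2]
      simp only [← D.sum_invGram_vol, ← Finset.sum_add_distrib, ← Finset.sum_sub_distrib,
        wedge₃_apply]
      congr 1
      refine Finset.sum_congr rfl fun u _ => Finset.sum_congr rfl fun v _ => ?_
      ring
    obtain ⟨e1, e2, e3, e4, e5⟩ :=
      alternating_perms (D.vol p) (D.sharp p α) (D.sharp p β) (D.sharp p γ) w
    rw [h1, e1, e2, e3, e4, e5]
    ring
  rw [InitialData.twistForm, h, D.sharp_xiFlat, D.sharp_xiFlat]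
  rfl

/-- The value of the volume form on the coordinate vectors. -/
def InitialData.volComp (e : OpenPartialHomeomorph M E4) (x : E4) : ℝ :=
  D.vol (e.symm x) (coordVec e x)

/-- A 4-form on a four-dimensional space is its value on a basis times the determinant. -/
theorem InitialData.vol_coord (v : Fin 4 → E4) :
    D.vol (e.symm x) (fun k => mfderiv 𝓘(ℝ, E4) 𝓘(ℝ, E4) e.symm x (v k))
      = D.volComp e x * (Matrix.of fun k a => v k a).det := by
  set b := (EuclideanSpace.basisFun (Fin 4) ℝ).toBasis
  set f : E4 [⋀^Fin 4]→ₗ[ℝ] ℝ := (D.vol (e.symm x)).compLinearMap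
    (mfderiv 𝓘(ℝ, E4) 𝓘(ℝ, E4) e.symm x : E4 →L[ℝ] TangentSpace 𝓘(ℝ, E4) (e.symm x)).toLinearMap
  have h1 := congrArg (fun F : E4 [⋀^Fin 4]→ₗ[ℝ] ℝ => F v) (AlternatingMap.eq_smul_basis_det b f)
  have h2 : f b = D.volComp e x := by
    show D.vol (e.symm x) (fun k => mfderiv 𝓘(ℝ, E4) 𝓘(ℝ, E4) e.symm x (b k)) = _
    congr 1
    ext1 k
    simp [b, coordVec]
  have h3 : b.det v = (Matrix.of fun k a => v k a).det := by
    rw [Module.Basis.det_apply, ← Matrix.det_transpose]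
    congr 1
  show f v = _
  rw [show f v = (f b • b.det) v from h1, h2, AlternatingMap.smul_apply, smul_eq_mul, h3]

theorem InitialData.volComp_sq : D.volComp e x ^ 2
    = (Matrix.of fun a b => D.metricComp e a b x).det := D.vol_sq _ _

end Twist
/-! ### The twist potential -/

section Potential

theorem fderiv_det₄ {w u v : Fin 4 → E4 → ℝ} {x : E4} (hw : ∀ a, DifferentiableAt ℝ (w a) x)
    (hu : ∀ a, DifferentiableAt ℝ (u a) x) (hv : ∀ a, DifferentiableAt ℝ (v a) x)
    (r : Fin 4 → ℝ) (z : E4) :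
    fderiv ℝ (fun y => det₄ (fun a => w a y) (fun a => u a y) (fun a => v a y) r) x z
      = det₄ (fun a => fderiv ℝ (w a) x z) (fun a => u a x) (fun a => v a x) r
        + det₄ (fun a => w a x) (fun a => fderiv ℝ (u a) x z) (fun a => v a x) r
        + det₄ (fun a => w a x) (fun a => u a x) (fun a => fderiv ℝ (v a) x z) r := by
  have A := fun k l : Fin 4 => ((hw k).hasFDerivAt.mul (hu l).hasFDerivAt).sub
    ((hw l).hasFDerivAt.mul (hu k).hasFDerivAt)
  have C := fun k l : Fin 4 => ((hv k).hasFDerivAt.mul_const (r l)).sub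
    ((hv l).hasFDerivAt.mul_const (r k))
  have h := ((((((A 0 1).mul (C 2 3)).sub ((A 0 2).mul (C 1 3))).add ((A 0 3).mul (C 1 2))).add
    ((A 1 2).mul (C 0 3))).sub ((A 1 3).mul (C 0 2))).add ((A 2 3).mul (C 0 1))
  have h' : HasFDerivAt (fun y => det₄ (fun a => w a y) (fun a => u a y) (fun a => v a y) r) _ x :=
    h.congr_of_eventuallyEq (Filter.Eventually.of_forall fun y => det₄_apply _ _ _ _)
  rw [h'.fderiv]
  simp only [det₄_apply, _root_.add_apply, _root_.sub_apply, _root_.smul_apply, smul_eq_mul,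
    Pi.sub_apply, Pi.mul_apply]
  ring

theorem contDiffAt_det₄ {k : ℕ∞ω} {w u v : Fin 4 → E4 → ℝ} {x : E4}
    (hw : ∀ a, ContDiffAt ℝ k (w a) x)
    (hu : ∀ a, ContDiffAt ℝ k (u a) x) (hv : ∀ a, ContDiffAt ℝ k (v a) x) (r : Fin 4 → ℝ) :
    ContDiffAt ℝ k (fun y => det₄ (fun a => w a y) (fun a => u a y) (fun a => v a y) r) x := by
  refine contDiffAt_det fun a b => ?_
  fin_cases a
  · exact hw b
  · exact hu b
  · exact hv b
  · exact contDiffAt_const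

variable {M : Type*} [TopologicalSpace M] [ChartedSpace E4 M] [IsManifold 𝓘(ℝ, E4) ∞ M]
  [MulAction Torus M] [ContMDiffSMul torusModel 𝓘(ℝ, E4) ∞ Torus M] (D : InitialData M)
  {e : OpenPartialHomeomorph M E4} {x : E4}

/-- The components of `ι_{ξ₂} ι_{ξ₁} (√g X)` in a positively oriented chart. -/
def InitialData.twistComp (i : Fin 2) (e : OpenPartialHomeomorph M E4) (d : Fin 4) (y : E4) : ℝ :=
  det₄ (fun a => D.volDensity e y * D.fluxComp i e a y) (fun a => vecComp (generator 0) e a y)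
    (fun a => vecComp (generator 1) e a y) (Pi.single d 1)

theorem InitialData.contDiffAt_twistComp (he : e ∈ IsManifold.maximalAtlas 𝓘(ℝ, E4) ∞ M)
    (hx : x ∈ e.target) (i : Fin 2) (d : Fin 4) : ContDiffAt ℝ ∞ (D.twistComp i e d) x :=
  contDiffAt_det₄ (fun a => (D.contDiffAt_volDensity he hx).mul (D.contDiffAt_fluxComp he hx i a))
    (contDiffAt_vecComp_generator he hx 0) (contDiffAt_vecComp_generator he hx 1) _

/-- Closedness of the contracted form: `curl_det_eq_zero` for the flux density, which is divergence
free and invariant under the two commuting generators. -/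
theorem InitialData.twistComp_closed (he : e ∈ IsManifold.maximalAtlas 𝓘(ℝ, E4) ∞ M)
    (hx : x ∈ e.target) {i : Fin 2} (hj : ∀ p : M, D.j p (generator i p) = 0) (c d : Fin 4) :
    pd c (D.twistComp i e d) x = pd d (D.twistComp i e c) x := by
  have h1 : ∀ a, DifferentiableAt ℝ (fun y => D.volDensity e y * D.fluxComp i e a y) x := fun a =>
    ((D.contDiffAt_volDensity he hx).mul (D.contDiffAt_fluxComp he hx i a)).differentiableAt
      (by simp)
  have h2 : ∀ (k : Fin 2) (a : Fin 4), DifferentiableAt ℝ (vecComp (generator (M := M) k) e a) x :=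
    fun k a => (contDiffAt_vecComp_generator he hx k a).differentiableAt (by simp)
  have key := curl_det_eq_zero
    (dw := fun c a => pd c (fun y => D.volDensity e y * D.fluxComp i e a y) x)
    (D.div_flux he hx hj) (D.lie_flux he hx i 0) (D.lie_flux he hx i 1)
    (generators_commute he 1 0 hx) d c
  have h (k : Fin 4) (z : E4) : fderiv ℝ (D.twistComp i e k) x z = _ :=
    fderiv_det₄ h1 (h2 0) (h2 1) (Pi.single k 1) z
  exact (h d _).trans (key.trans (h c _).symm)

/-- In use, `s` is the sign `±1` that compares the orientation of the chart with that of `M`. It is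
kept as a factor, so charts of either orientation serve. -/
theorem InitialData.twistForm_chart (he : e ∈ IsManifold.maximalAtlas 𝓘(ℝ, E4) ∞ M)
    (hx : x ∈ e.target) (i : Fin 2) {s : ℝ} (hs : D.volComp e x = s * D.volDensity e x) (c : E4) :
    D.twistForm i (e.symm x) (mfderiv 𝓘(ℝ, E4) 𝓘(ℝ, E4) e.symm x c)
      = s * ∑ d, D.twistComp i e d x * c d := by
  set v : Fin 4 → E4 := ![WithLp.toLp 2 fun a => vecComp (D.flux i) e a x,
    WithLp.toLp 2 fun a => vecComp (generator 0) e a x,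
    WithLp.toLp 2 fun a => vecComp (generator 1) e a x, c]
  have h1 : ![D.flux i (e.symm x), generator 0 (e.symm x), generator 1 (e.symm x),
      mfderiv 𝓘(ℝ, E4) 𝓘(ℝ, E4) e.symm x c]
      = fun k => mfderiv 𝓘(ℝ, E4) 𝓘(ℝ, E4) e.symm x (v k) := by
    funext k
    fin_cases k
    · exact (sum_vecComp he hx _).trans (mfderiv_symm_apply (e := e) (x := x) (v 0)).symm
    · exact (sum_vecComp he hx _).trans (mfderiv_symm_apply (e := e) (x := x) (v 1)).symm
    · exact (sum_vecComp he hx _).trans (mfderiv_symm_apply (e := e) (x := x) (v 2)).symm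
    · rfl
  have h2 : (Matrix.of fun k a => v k a).det = det₄ (fun a => D.fluxComp i e a x)
      (fun a => vecComp (generator 0) e a x) (fun a => vecComp (generator 1) e a x) c := by
    rw [det₄]
    congr 1
    ext k a
    fin_cases k
    · exact D.vecComp_flux he hx i a
    · rfl
    · rfl
    · rfl
  rw [D.twistForm_eq, h1, D.vol_coord, h2, hs]
  simp only [InitialData.twistComp, det₄_apply, Fin.sum_univ_four]
  simp
  ring

/-- Near each point the twist form has a primitive. -/
theorem InitialData.exists_local_potential {i : Fin 2} (hj : ∀ p : M, D.j p (generator i p) = 0)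
    (p : M) : ∃ (U : Set M) (F : M → ℝ), IsOpen U ∧ p ∈ U ∧ ContMDiffOn 𝓘(ℝ, E4) 𝓘(ℝ, ℝ) ∞ F U ∧
      ∀ q ∈ U, ∀ w, differential F q w = 2 * D.twistForm i q w := by
  set e := chartAt E4 p
  have he : e ∈ IsManifold.maximalAtlas 𝓘(ℝ, E4) ∞ M := IsManifold.chart_mem_maximalAtlas p
  have hp : p ∈ e.source := mem_chart_source E4 p
  obtain ⟨r, hr, hB⟩ := Metric.isOpen_iff.1 e.open_target (e p) (e.map_source hp)
  set B := Metric.ball (e p) r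
  -- the orientation of the chart
  obtain ⟨s, hs⟩ : ∃ s : ℝ, ∀ x ∈ B, D.volComp e x = s * D.volDensity e x := by
    have hc : ContinuousOn (D.volComp e) B := (D.vol_continuous e he).mono hB
    have hv : ContinuousOn (D.volDensity e) B := fun x hx =>
      (D.contDiffAt_volDensity he (hB hx)).continuousAt.continuousWithinAt
    -- `volComp` and `volDensity` are continuous with equal squares, and the latter is nowhere zero,
    -- so on the connected ball they agree up to one global sign.
    rcases (convex_ball (e p) r).isPreconnected.eq_or_eq_neg_of_sq_eq hc hv (fun x hx => by
        simp only [Pi.pow_apply]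
        rw [D.volComp_sq]
        exact (Real.sq_sqrt (D.metricComp_det_pos he (hB hx)).le).symm)
      (fun hx => (D.volDensity_pos he (hB hx)).ne') with h | h
    · exact ⟨1, fun x hx => by rw [h hx, one_mul]⟩
    · exact ⟨-1, fun x hx => by rw [h hx]; simp⟩
  set η : E4 → E4 →L[ℝ] ℝ := fun y =>
    ∑ d, (2 * s * D.twistComp i e d y) • (EuclideanSpace.proj d : E4 →L[ℝ] ℝ)
  have hη : ∀ x ∈ B, ContDiffAt ℝ ∞ η x := fun x hx => ContDiffAt.sum fun d _ =>
    (contDiffAt_const.mul (D.contDiffAt_twistComp he (hB hx) i d)).smul contDiffAt_const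
  have hdη : ∀ x ∈ B, ∀ u v, fderiv ℝ η x u v = fderiv ℝ η x v u := by
    intro x hx
    have ht : ∀ d, DifferentiableAt ℝ (D.twistComp i e d) x := fun d =>
      (D.contDiffAt_twistComp he (hB hx) i d).differentiableAt (by simp)
    have h1 : ∀ u v : E4, fderiv ℝ η x u v
        = 2 * s * ∑ d, ∑ c, u c * v d * pd c (D.twistComp i e d) x := by
      intro u v
      have h2 : HasFDerivAt η _ x := HasFDerivAt.fun_sum fun d (_ : d ∈ Finset.univ) =>
        (((ht d).hasFDerivAt.const_mul (2 * s)).smul_const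
          (EuclideanSpace.proj d : E4 →L[ℝ] ℝ))
      have h3 : ∀ d, fderiv ℝ (D.twistComp i e d) x u
          = ∑ c, u c * pd c (D.twistComp i e d) x := fun d => by
        conv_lhs => rw [E4_sum u]
        simp [pd]
      rw [h2.fderiv]
      simp only [_root_.sum_apply, ContinuousLinearMap.smulRight_apply, _root_.smul_apply,
        smul_eq_mul, h3, Finset.mul_sum, Finset.sum_mul]
      exact Finset.sum_congr rfl fun d _ => Finset.sum_congr rfl fun c _ => by
        change _ * v d = _
        ring
    intro u v
    rw [h1, h1, Finset.sum_comm]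
    congr 1
    refine Finset.sum_congr rfl fun c _ => Finset.sum_congr rfl fun d _ => ?_
    rw [D.twistComp_closed he (hB hx) hj]
    ring
  -- The Poincaré lemma on a convex ball: closedness of `η` is the symmetry of its derivative.
  obtain ⟨f, hf⟩ := (convex_ball (e p) r).exists_forall_hasFDerivAt_of_fderiv_symmetric
    Metric.isOpen_ball (fun x hx => ((hη x hx).differentiableAt (by simp)).differentiableWithinAt)
    hdη
  have hfs : ContDiffOn ℝ ∞ f B := by
    rw [contDiffOn_infty_iff_fderiv_of_isOpen Metric.isOpen_ball]
    refine ⟨fun x hx => (hf x hx).differentiableAt.differentiableWithinAt, ?_⟩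
    exact ContDiffOn.congr (fun x hx => (hη x hx).contDiffWithinAt) fun x hx => (hf x hx).fderiv
  refine ⟨e.source ∩ e ⁻¹' B, f ∘ e, e.isOpen_inter_preimage Metric.isOpen_ball,
    ⟨hp, Metric.mem_ball_self hr⟩, ?_, ?_⟩
  · exact (contMDiffOn_iff_contDiffOn.2 hfs).comp
      ((contMDiffOn_of_mem_maximalAtlas he).mono Set.inter_subset_left) fun q hq => hq.2
  · rintro q ⟨hq, hqB⟩ w
    have hx : e q ∈ e.target := hB hqB
    obtain ⟨x, hxB, rfl⟩ : ∃ x ∈ B, e.symm x = q := ⟨e q, hqB, e.left_inv hq⟩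
    have hxt := hB hxB
    obtain ⟨c, rfl⟩ := exists_sum_coordVec he hxt w
    have h1 := mfderiv_comp (I := 𝓘(ℝ, E4)) (I' := 𝓘(ℝ, E4)) (I'' := 𝓘(ℝ, ℝ)) (e.symm x)
      (g := f) (f := e) (by
        rw [e.right_inv hxt]
        exact (hf x hxB).differentiableAt.mdifferentiableAt)
      ((mdifferentiable_of_mem_maximalAtlas he).mdifferentiableAt hq)
    have h2 : differential (f ∘ e) (e.symm x) (mfderiv 𝓘(ℝ, E4) 𝓘(ℝ, E4) e.symm x c)
        = η x c := by
      rw [differential, h1, mfderiv_eq_fderiv]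
      have h3 := mfderiv_coordVec he hxt c
      have h4 : fderiv ℝ f (e (e.symm x)) = η x := by
        rw [e.right_inv hxt]
        exact (hf x hxB).fderiv
      rw [h4]
      exact congrArg (η x) h3
    rw [h2, D.twistForm_chart he hxt i (hs x hxB)]
    simp only [η, _root_.sum_apply, _root_.smul_apply, smul_eq_mul,
      Finset.mul_sum]
    exact Finset.sum_congr rfl fun d _ => by
      change _ * c d = _
      ring

/-- On a simply connected manifold the twist form has a global potential. -/
theorem InitialData.exists_twist_potential [SimplyConnectedSpace M] {i : Fin 2}
    (hj : ∀ p : M, D.j p (generator i p) = 0) :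
    ∃ Y : M → ℝ, ContMDiff 𝓘(ℝ, E4) 𝓘(ℝ, ℝ) ∞ Y ∧
      ∀ (p : M) (w : TangentSpace 𝓘(ℝ, E4) p), differential Y p w = 2 * D.twistForm i p w := by
  choose U F hU hmem hF hd using D.exists_local_potential hj
  have : LocallyPathConnectedSpace M := ChartedSpace.locallyPathConnectedSpace E4 M
  have hdiff : ∀ p, ∀ q ∈ U p, MDifferentiableAt 𝓘(ℝ, E4) 𝓘(ℝ, ℝ) (F p) q := fun p q hq =>
    ((hF p).contMDiffAt ((hU p).mem_nhds hq)).mdifferentiableAt (by simp)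
  obtain ⟨Y, hY⟩ := exists_global_of_local U hU hmem F (by
    rintro p q x ⟨hxp, hxq⟩
    set e := chartAt E4 x
    have he : e ∈ IsManifold.maximalAtlas 𝓘(ℝ, E4) ∞ M := IsManifold.chart_mem_maximalAtlas x
    have hx : x ∈ e.source := mem_chart_source E4 x
    have hO : IsOpen (e.target ∩ e.symm ⁻¹' (U p ∩ U q)) :=
      e.symm.isOpen_inter_preimage ((hU p).inter (hU q))
    obtain ⟨r, hr, hB⟩ := Metric.isOpen_iff.1 hO (e x)
      ⟨e.map_source hx, by simpa [e.left_inv hx] using ⟨hxp, hxq⟩⟩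
    -- Two local primitives have the same differential, so in a coordinate ball their difference has
    -- derivative zero and is constant.
    have h0 : ∀ y ∈ Metric.ball (e x) r, HasFDerivAt
        (fun y => F p (e.symm y) - F q (e.symm y)) (0 : E4 →L[ℝ] ℝ) y := by
      intro y hy
      obtain ⟨hyt, hyp, hyq⟩ := hB hy
      have hs : MDifferentiableAt 𝓘(ℝ, E4) 𝓘(ℝ, E4) e.symm y :=
        (mdifferentiable_of_mem_maximalAtlas he).mdifferentiableAt_symm hyt
      have k1 := ((hdiff p _ hyp).hasMFDerivAt.comp y hs.hasMFDerivAt).hasFDerivAt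
      have k2 := ((hdiff q _ hyq).hasMFDerivAt.comp y hs.hasMFDerivAt).hasFDerivAt
      have k3 := k1.sub k2
      refine k3.congr_fderiv ?_
      ext v
      have m1 := hd p _ hyp (mfderiv 𝓘(ℝ, E4) 𝓘(ℝ, E4) e.symm y v)
      have m2 := hd q _ hyq (mfderiv 𝓘(ℝ, E4) 𝓘(ℝ, E4) e.symm y v)
      exact sub_eq_zero.2 (m1.trans m2.symm)
    have h1 : ∀ᶠ z in 𝓝 x, z ∈ e.source ∧ e z ∈ Metric.ball (e x) r :=
      (e.open_source.mem_nhds hx |> Filter.eventually_mem_set.2).and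
        ((e.continuousAt hx).eventually (Metric.ball_mem_nhds _ hr))
    filter_upwards [h1] with z hz
    have h2 := (convex_ball (e x) r).is_const_of_fderivWithin_eq_zero (𝕜 := ℝ)
      (f := fun y => F p (e.symm y) - F q (e.symm y))
      (fun y hy => (h0 y hy).differentiableAt.differentiableWithinAt)
      (fun y hy => by
        rw [fderivWithin_of_isOpen Metric.isOpen_ball hy]
        exact (h0 y hy).fderiv) hz.2 (Metric.mem_ball_self hr)
    simpa [e.left_inv hz.1, e.left_inv hx] using h2)
  refine ⟨Y, fun p => ?_, fun p w => ?_⟩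
  · obtain ⟨c, hc⟩ := hY p
    have h1 : ContMDiffAt 𝓘(ℝ, E4) 𝓘(ℝ, ℝ) ∞ (fun x => F p x + c) p :=
      ((hF p).contMDiffAt ((hU p).mem_nhds (hmem p))).add contMDiffAt_const
    exact h1.congr_of_eventuallyEq hc
  · obtain ⟨c, hc⟩ := hY p
    rw [← hd p p (hmem p) w, differential, differential]
    have h1 : HasMFDerivAt 𝓘(ℝ, E4) 𝓘(ℝ, ℝ) (fun x => F p x + c) p _ :=
      (hdiff p p (hmem p)).hasMFDerivAt.add (hasMFDerivAt_const c p)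
    have h2 := h1.congr_of_eventuallyEq hc
    rw [h2.mfderiv]
    exact add_zero (differential (F p) p w)

end Potential
/-! ### Measures given by parametrizations -/

section ParamMeasure

/-- Measures that agree on overlaps are the restrictions of their supremum. -/
theorem iSup_restrict_of_agree {X ι : Type*} [MeasurableSpace X] (μ : ι → Measure X)
    (s : ι → Set X) (hs : ∀ i, MeasurableSet (s i)) (h0 : ∀ i, μ i (s i)ᶜ = 0)
    (h : ∀ i j, (μ i).restrict (s i ∩ s j) = (μ j).restrict (s i ∩ s j)) (k : ι) :
    (⨆ i, μ i).restrict (s k) = μ k := by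
  have hr : ∀ i, (μ i).restrict (s i) = μ i := fun i =>
    Measure.restrict_eq_self_of_ae_mem (by rw [ae_iff]; exact h0 i)
  apply le_antisymm
  · have hle : (⨆ i, μ i) ≤ μ k + (Measure.sum μ).restrict (s k)ᶜ := by
      refine iSup_le fun j => ?_
      rw [← Measure.restrict_add_restrict_compl (μ := μ j) (hs k)]
      refine add_le_add ?_ (Measure.restrict_mono le_rfl (Measure.le_sum μ j))
      calc (μ j).restrict (s k) = ((μ j).restrict (s j)).restrict (s k) := by rw [hr]
        _ = (μ j).restrict (s j ∩ s k) := by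
          rw [Measure.restrict_restrict (hs k), Set.inter_comm]
        _ = (μ k).restrict (s j ∩ s k) := h j k
        _ ≤ μ k := Measure.restrict_le_self
    calc (⨆ i, μ i).restrict (s k)
        ≤ (μ k + (Measure.sum μ).restrict (s k)ᶜ).restrict (s k) :=
          Measure.restrict_mono le_rfl hle
      _ = μ k := by
        rw [Measure.restrict_add, Measure.restrict_restrict (hs k), Set.inter_compl_self,
          Measure.restrict_empty, add_zero, hr]
  · conv_lhs => rw [← hr k]
    exact Measure.restrict_mono le_rfl (le_iSup μ k)

variable {V X : Type*} [NormedAddCommGroup V] [NormedSpace ℝ V] [FiniteDimensional ℝ V]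
  [MeasureSpace V] [BorelSpace V] [(volume : Measure V).IsAddHaarMeasure]
  [TopologicalSpace X] [MeasurableSpace X] [BorelSpace X]

/-- The measure with density `ρ` in the parametrization `σ : T → X`. -/
def paramMeasure (σ : V → X) (T : Set V) (ρ : V → ℝ) : Measure X :=
  Measure.map σ ((volume.restrict T).withDensity fun y => ENNReal.ofReal (ρ y))

variable {σ σ' : V → X} {T T' : Set V} {ρ ρ' : V → ℝ}

theorem aemeasurable_param (hT : IsOpen T) (hσ : ContinuousOn σ T) :
    AEMeasurable σ ((volume.restrict T).withDensity fun y => ENNReal.ofReal (ρ y)) :=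
  (hσ.aemeasurable hT.measurableSet).mono_ac (withDensity_absolutelyContinuous _ _)

theorem paramMeasure_apply (hT : IsOpen T) (hσ : ContinuousOn σ T) {B : Set X}
    (hB : MeasurableSet B) :
    paramMeasure σ T ρ B = ∫⁻ y in T ∩ σ ⁻¹' B, ENNReal.ofReal (ρ y) := by
  rw [paramMeasure, Measure.map_apply_of_aemeasurable (aemeasurable_param hT hσ) hB,
    withDensity_apply', Measure.restrict_restrict' hT.measurableSet, Set.inter_comm]

theorem paramMeasure_eq_zero (hT : IsOpen T) (hσ : ContinuousOn σ T) {B : Set X}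
    (hB : MeasurableSet B) (h : ∀ y ∈ T, σ y ∉ B) : paramMeasure σ T ρ B = 0 := by
  rw [paramMeasure_apply hT hσ hB,
    show T ∩ σ ⁻¹' B = ∅ from Set.eq_empty_of_forall_notMem fun y hy => h y hy.1 hy.2]
  simp

/-- `σ` is controlled only on `T`, so the preimage is taken in the subtype `T` and pushed forward.
-/
theorem measurableSet_inter_preimage (hT : IsOpen T) (hσ : ContinuousOn σ T) {B : Set X}
    (hB : MeasurableSet B) : MeasurableSet (T ∩ σ ⁻¹' B) := by
  have h : T ∩ σ ⁻¹' B = Subtype.val '' (T.domRestrict σ ⁻¹' B) := by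
    ext y
    simp [and_comm]
  rw [h]
  exact hT.measurableSet.subtype_image
    ((continuousOn_iff_continuous_domRestrict.1 hσ).measurable hB)

/-- Change of variables between parametrizations. -/
theorem paramMeasure_agree (hT : IsOpen T) (hσ : ContinuousOn σ T) (hT' : IsOpen T')
    (hσ' : ContinuousOn σ' T') (hi : Set.InjOn σ T) (hi' : Set.InjOn σ' T') {s s' : Set X}
    (hs : MeasurableSet s) (hs' : MeasurableSet s') (hr : ∀ z ∈ T', σ' z ∈ s → ∃ y ∈ T, σ y = σ' z)
    {τ : V → V} {τ' : V → V →L[ℝ] V}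
    (hτ : ∀ y ∈ T, σ y ∈ s' → HasFDerivAt τ (τ' y) y ∧ τ y ∈ T' ∧ σ' (τ y) = σ y ∧
      ρ y = |(τ' y).det| * ρ' (τ y)) :
    (paramMeasure σ T ρ).restrict (s ∩ s') = (paramMeasure σ' T' ρ').restrict (s ∩ s') := by
  ext B hB
  have hB' : MeasurableSet (B ∩ (s ∩ s')) := hB.inter (hs.inter hs')
  rw [Measure.restrict_apply hB, Measure.restrict_apply hB, paramMeasure_apply hT hσ hB',
    paramMeasure_apply hT' hσ' hB']
  -- The transition `τ` maps the part of `T` lying over `B ∩ s ∩ s'` bijectively onto the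
  -- corresponding part of `T'`; the change of variables formula then applies.
  have himg : τ '' (T ∩ σ ⁻¹' (B ∩ (s ∩ s'))) = T' ∩ σ' ⁻¹' (B ∩ (s ∩ s')) := by
    ext z
    constructor
    · rintro ⟨y, ⟨hy, hyB⟩, rfl⟩
      obtain ⟨-, h1, h2, -⟩ := hτ y hy hyB.2.2
      refine ⟨h1, ?_⟩
      rw [Set.mem_preimage, h2]
      exact hyB
    · rintro ⟨hz, hzB⟩
      obtain ⟨y, hy, hyz⟩ := hr z hz hzB.2.1
      have hyB : σ y ∈ B ∩ (s ∩ s') := by rw [hyz]; exact hzB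
      obtain ⟨-, h1, h2, -⟩ := hτ y hy hyB.2.2
      exact ⟨y, ⟨hy, hyB⟩, hi' h1 hz (h2.trans hyz)⟩
  have hinj : Set.InjOn τ (T ∩ σ ⁻¹' (B ∩ (s ∩ s'))) := by
    rintro y ⟨hy, hyB⟩ z ⟨hz, hzB⟩ hyz
    apply hi hy hz
    rw [← (hτ y hy hyB.2.2).2.2.1, ← (hτ z hz hzB.2.2).2.2.1, hyz]
  have hm := measurableSet_inter_preimage hT hσ hB'
  rw [← himg, lintegral_image_eq_lintegral_abs_det_fderiv_mul volume hm
    (fun y hy => (hτ y hy.1 hy.2.2.2).1.hasFDerivWithinAt) hinj]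
  refine setLIntegral_congr_fun hm fun y hy => ?_
  rw [(hτ y hy.1 hy.2.2.2).2.2.2, ENNReal.ofReal_mul (abs_nonneg _)]

theorem paramMeasure_lt_top (hT : IsOpen T) (hσ : ContinuousOn σ T) (hρ : ContinuousOn ρ T)
    {B : Set X} (hB : MeasurableSet B) {K : Set V} (hK : IsCompact K) (hKT : K ⊆ T)
    (hBK : ∀ y ∈ T, σ y ∈ B → y ∈ K) : paramMeasure σ T ρ B < ⊤ := by
  rw [paramMeasure_apply hT hσ hB]
  have h1 : IntegrableOn ρ K := (hρ.mono hKT).integrableOn_compact hK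
  calc ∫⁻ y in T ∩ σ ⁻¹' B, ENNReal.ofReal (ρ y)
      ≤ ∫⁻ y in K, ENNReal.ofReal (ρ y) := lintegral_mono_set fun y hy => hBK y hy.1 hy.2
    _ < ⊤ := h1.lintegral_lt_top

theorem integral_paramMeasure (hT : IsOpen T) (hσ : ContinuousOn σ T) (hρ : ContinuousOn ρ T)
    (h0 : ∀ y ∈ T, 0 ≤ ρ y) {f : X → ℝ} (hf : AEStronglyMeasurable f (paramMeasure σ T ρ)) :
    ∫ p, f p ∂(paramMeasure σ T ρ) = ∫ y in T, ρ y * f (σ y) := by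
  rw [paramMeasure, integral_map (aemeasurable_param hT hσ) hf,
    integral_withDensity_eq_integral_toReal_smul₀
      (hρ.aemeasurable hT.measurableSet).ennreal_ofReal
      (Filter.Eventually.of_forall fun _ => ENNReal.ofReal_lt_top)]
  refine setIntegral_congr_fun hT.measurableSet fun y hy => ?_
  simp [ENNReal.toReal_ofReal (h0 y hy)]

end ParamMeasure

/-- The Gram determinant of a bilinear form under a linear endomorphism. -/
theorem det_gram_comp {V ι : Type*} [AddCommGroup V] [Module ℝ V] [Fintype ι] [DecidableEq ι]
    (b : Module.Basis ι ℝ V) (B : V →ₗ[ℝ] V →ₗ[ℝ] ℝ) (L : V →ₗ[ℝ] V) :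
    (Matrix.of fun i j => B (L (b i)) (L (b j))).det
      = LinearMap.det L ^ 2 * (Matrix.of fun i j => B (b i) (b j)).det := by
  have h1 : (Matrix.of fun i j => B (b i) (b j)) = LinearMap.BilinForm.toMatrix b B := by
    ext i j
    simp [LinearMap.BilinForm.toMatrix_apply]
  have h2 : (Matrix.of fun i j => B (L (b i)) (L (b j)))
      = LinearMap.BilinForm.toMatrix b (LinearMap.BilinForm.comp B L L) := by
    ext i j
    simp [LinearMap.BilinForm.toMatrix_apply]
  rw [h1, h2, LinearMap.BilinForm.toMatrix_comp b b, Matrix.det_mul, Matrix.det_mul,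
    Matrix.det_transpose, LinearMap.det_toMatrix]
  ring

/-! ### Constructing charts -/

section ConstructCharts

theorem exists_equiv_of_injective {L : E4 →L[ℝ] E4} (h : Function.Injective L) :
    ∃ L' : E4 ≃L[ℝ] E4, (L' : E4 →L[ℝ] E4) = L :=
  ⟨(LinearEquiv.ofInjectiveEndo L.toLinearMap h).toContinuousLinearEquiv, by ext; rfl⟩

/-- The inverse function theorem: in finite dimension an injective derivative is invertible, which
makes the inverse map smooth. -/
theorem mem_contDiffGroupoid_of_injective {G : OpenPartialHomeomorph E4 E4}
    (hG : ContDiffOn ℝ ∞ G G.source)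
    (hi : ∀ x ∈ G.source, Function.Injective (fderiv ℝ G x)) :
    G ∈ contDiffGroupoid ∞ 𝓘(ℝ, E4) := by
  have hs : ContDiffOn ℝ ∞ G.symm G.target := by
    intro y hy
    have hx := G.map_target hy
    obtain ⟨L, hL⟩ := exists_equiv_of_injective (hi _ hx)
    have hc : ContDiffAt ℝ ∞ G (G.symm y) := hG.contDiffAt (G.open_source.mem_nhds hx)
    refine (G.contDiffAt_symm hy (f₀' := L) ?_ hc).contDiffWithinAt
    rw [hL]
    exact (hc.differentiableAt (by simp)).hasFDerivAt
  rw [contDiffGroupoid, mem_groupoid_of_pregroupoid]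
  constructor
  · simpa [contDiffPregroupoid] using hG
  · simpa [contDiffPregroupoid] using hs

variable {M : Type*} [TopologicalSpace M] [ChartedSpace E4 M] [IsManifold 𝓘(ℝ, E4) ∞ M]

theorem trans_mem_maximalAtlas {e : OpenPartialHomeomorph M E4} {G : OpenPartialHomeomorph E4 E4}
    (he : e ∈ IsManifold.maximalAtlas 𝓘(ℝ, E4) ∞ M) (hG : G ∈ contDiffGroupoid ∞ 𝓘(ℝ, E4)) :
    e ≫ₕ G ∈ IsManifold.maximalAtlas 𝓘(ℝ, E4) ∞ M := by
  rw [IsManifold.mem_maximalAtlas_iff, mem_maximalAtlas_iff]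
  intro e' he'
  have h1 := IsManifold.mem_maximalAtlas_iff.1 he
  rw [mem_maximalAtlas_iff] at h1
  obtain ⟨h2, h3⟩ := h1 e' he'
  constructor
  · rw [OpenPartialHomeomorph.trans_symm_eq_symm_trans_symm, OpenPartialHomeomorph.trans_assoc]
    exact StructureGroupoid.trans _ (StructureGroupoid.symm _ hG) h2
  · rw [← OpenPartialHomeomorph.trans_assoc]
    exact StructureGroupoid.trans _ h3 hG

/-- A smooth function with nonzero differential is the last coordinate of a chart. -/
theorem exists_chart_of_function {U : Set M} {f : M → ℝ} {p : M} (hU : IsOpen U) (hp : p ∈ U)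
    (hf : ContMDiffOn 𝓘(ℝ, E4) 𝓘(ℝ, ℝ) ∞ f U) (hd : differential f p ≠ 0) :
    ∃ e ∈ IsManifold.maximalAtlas 𝓘(ℝ, E4) ∞ M, p ∈ e.source ∧ e.source ⊆ U ∧
      ∀ q ∈ e.source, e q 3 = f q := by
  set e := chartAt E4 p
  have he : e ∈ IsManifold.maximalAtlas 𝓘(ℝ, E4) ∞ M := IsManifold.chart_mem_maximalAtlas p
  have hpe : p ∈ e.source := mem_chart_source E4 p
  set x := e p
  have hx : x ∈ e.target := e.map_source hpe
  have hex : e.symm x = p := e.left_inv hpe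
  set W := e.target ∩ e.symm ⁻¹' U
  have hW : IsOpen W := e.symm.isOpen_inter_preimage hU
  have hxW : x ∈ W := ⟨hx, by rw [Set.mem_preimage, hex]; exact hp⟩
  have hg : ContDiffOn ℝ ∞ (f ∘ e.symm) W := contMDiffOn_iff_contDiffOn.1
    (hf.comp ((contMDiffOn_symm_of_mem_maximalAtlas he).mono Set.inter_subset_left)
      fun y hy => hy.2)
  have hgx := hg.contDiffAt (hW.mem_nhds hxW)
  -- The differential is nonzero, so some partial derivative of `f` in the chart is; this is the
  -- coordinate that `f` will replace.
  obtain ⟨a, ha⟩ : ∃ a, fderiv ℝ (f ∘ e.symm) x (EuclideanSpace.single a 1) ≠ 0 := by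
    by_contra! h
    apply hd
    have h1 : fderiv ℝ (f ∘ e.symm) x
        = (differential f (e.symm x)).comp (mfderiv 𝓘(ℝ, E4) 𝓘(ℝ, E4) e.symm x) := by
      rw [← mfderiv_eq_fderiv]
      exact mfderiv_comp x (by
        rw [hex]
        exact (hf.contMDiffAt (hU.mem_nhds hp)).mdifferentiableAt (by simp))
        ((mdifferentiable_of_mem_maximalAtlas he).mdifferentiableAt_symm hx)
    rw [← hex]
    ext w
    obtain ⟨c, rfl⟩ := exists_sum_coordVec he hx w
    have h2 : fderiv ℝ (f ∘ e.symm) x c = 0 := by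
      rw [E4_sum c]
      simp [h]
    rw [h1] at h2
    exact h2
  -- exchange the coordinate `a` with the last one, and replace the latter by `f`
  set P : E4 →L[ℝ] E4 := ((EuclideanSpace.equiv (Fin 4) ℝ).symm : (Fin 4 → ℝ) →L[ℝ] E4).comp
    (ContinuousLinearMap.pi fun b => if b = 3 then 0 else EuclideanSpace.proj (Equiv.swap a 3 b))
  have hP : ∀ v : E4, ∀ b, P v b = if b = 3 then 0 else v (Equiv.swap a 3 b) := by
    intro v b
    change (if b = 3 then (0 : E4 →L[ℝ] ℝ) else EuclideanSpace.proj (Equiv.swap a 3 b)) v = _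
    split_ifs <;> rfl
  set g : E4 → E4 := fun y => P y + (f ∘ e.symm) y • EuclideanSpace.single 3 1
  have hgs : ContDiffOn ℝ ∞ g W := P.contDiff.contDiffOn.add (hg.smul contDiffOn_const)
  have hgx' := hgs.contDiffAt (hW.mem_nhds hxW)
  have hgd : HasFDerivAt g (P + (fderiv ℝ (f ∘ e.symm) x).smulRight (EuclideanSpace.single 3 1)) x :=
    P.hasFDerivAt.add ((hgx.differentiableAt (by simp)).hasFDerivAt.smul_const _)
  have hinj : Function.Injective (fderiv ℝ g x) := by
    rw [hgd.fderiv, injective_iff_map_eq_zero]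
    intro v hv
    have h1 : ∀ b, P v b + fderiv ℝ (f ∘ e.symm) x v * (if b = 3 then 1 else 0) = 0 := by
      intro b
      have := congrArg (fun u : E4 => u b) hv
      simpa [Pi.single_apply] using this
    have h2 : ∀ b, b ≠ a → v b = 0 := by
      intro b hb
      by_cases hb3 : b = 3
      · subst hb3
        have := h1 a
        rw [hP] at this
        simpa [Ne.symm hb] using this
      · have := h1 b
        rw [hP] at this
        simpa [hb3, Equiv.swap_apply_of_ne_of_ne hb hb3] using this
    have h3 : v = v a • EuclideanSpace.single a (1 : ℝ) := by
      ext b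
      by_cases hb : b = a
      · subst hb; simp
      · simp [hb, h2 b hb]
    have h4 := h1 3
    rw [hP] at h4
    simp only [if_true, zero_add, mul_one] at h4
    rw [h3, map_smul, smul_eq_mul] at h4
    rw [h3, (mul_eq_zero.1 h4).resolve_right ha, zero_smul]
  obtain ⟨L, hL⟩ := exists_equiv_of_injective hinj
  have hgL : HasFDerivAt g (L : E4 →L[ℝ] E4) x := by
    rw [hL]; exact (hgx'.differentiableAt (by simp)).hasFDerivAt
  set G₀ := hgx'.toOpenPartialHomeomorph g hgL (by simp)
  -- A chart of the atlas needs an invertible derivative on its whole source. Invertibility is an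
  -- open condition, so the source is shrunk accordingly.
  have hev : ∀ᶠ y in 𝓝 x, Function.Injective (fderiv ℝ g y) := by
    have hc : ContinuousAt (fderiv ℝ g) x := (hgx'.fderiv_right (m := 0) (by simp)).continuousAt
    have hn := L.nhds
    rw [hL] at hn
    filter_upwards [hc.eventually hn] with y hy
    obtain ⟨L', hL'⟩ := hy
    rw [← hL']
    exact L'.injective
  obtain ⟨O, hO, hOo, hxO⟩ := eventually_nhds_iff.1 hev
  set G := G₀.restr (O ∩ W)
  have hGs : G.source = G₀.source ∩ (O ∩ W) := G₀.restr_source' _ (hOo.inter hW)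
  have hGm : G ∈ contDiffGroupoid ∞ 𝓘(ℝ, E4) := by
    apply mem_contDiffGroupoid_of_injective
    · rw [hGs]
      exact hgs.mono fun y hy => hy.2.2
    · intro y hy
      rw [hGs] at hy
      exact hO y hy.2.1
  refine ⟨e ≫ₕ G, trans_mem_maximalAtlas he hGm, ?_, ?_, ?_⟩
  · rw [OpenPartialHomeomorph.trans_source, hGs]
    exact ⟨hpe, hgx'.mem_toOpenPartialHomeomorph_source hgL (by simp), hxO, hxW⟩
  · intro q hq
    rw [OpenPartialHomeomorph.trans_source, hGs] at hq
    have := hq.2.2.2.2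
    rwa [Set.mem_preimage, e.left_inv hq.1] at this
  · intro q hq
    rw [OpenPartialHomeomorph.trans_source, hGs] at hq
    change g (e q) 3 = f q
    simp [g, hP, e.left_inv hq.1]

end ConstructCharts

/-! ### The volume measure and the measure on hypersurfaces in charts -/

section Measures

/-- The inclusion `y ↦ slice y` as a linear map. -/
def sliceL : (Fin 3 → ℝ) →L[ℝ] E4 :=
  ((EuclideanSpace.equiv (Fin 4) ℝ).symm : (Fin 4 → ℝ) →L[ℝ] E4).comp
    (ContinuousLinearMap.pi ![ContinuousLinearMap.proj 0, ContinuousLinearMap.proj 1,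
      ContinuousLinearMap.proj 2, 0])

/-- The first three coordinates. -/
def frontL : E4 →L[ℝ] Fin 3 → ℝ :=
  ContinuousLinearMap.pi fun a => EuclideanSpace.proj a.castSucc

theorem sliceL_apply (y : Fin 3 → ℝ) : sliceL y = slice y := by
  ext a
  fin_cases a <;> rfl

theorem slice_castSucc (y : Fin 3 → ℝ) (a : Fin 3) : slice y a.castSucc = y a := by
  fin_cases a <;> rfl

theorem slice_last (y : Fin 3 → ℝ) : slice y 3 = 0 := rfl

theorem frontL_slice (y : Fin 3 → ℝ) : frontL (slice y) = y :=
  funext fun a => slice_castSucc y a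

theorem slice_frontL {x : E4} (hx : x 3 = 0) : slice (frontL x) = x := by
  ext a
  fin_cases a
  · rfl
  · rfl
  · rfl
  · exact hx.symm

theorem continuous_slice : Continuous slice := by
  rw [show slice = sliceL from funext fun y => (sliceL_apply y).symm]
  exact sliceL.continuous

theorem slice_injective : Function.Injective slice := fun y z h => by
  rw [← frontL_slice y, h, frontL_slice]

theorem sliceL_single (a : Fin 3) :
    sliceL (Pi.single a 1) = EuclideanSpace.single a.castSucc (1 : ℝ) := by
  rw [sliceL_apply]
  ext b
  fin_cases a <;> fin_cases b <;> simp [slice]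

variable {M : Type*} [TopologicalSpace M] [ChartedSpace E4 M] [IsManifold 𝓘(ℝ, E4) ∞ M]
  [MulAction Torus M] (D : InitialData M) {e e' : OpenPartialHomeomorph M E4} {x : E4}

/-- The metric in a chart. -/
def InitialData.chartForm (e : OpenPartialHomeomorph M E4) (x : E4) : E4 →ₗ[ℝ] E4 →ₗ[ℝ] ℝ :=
  (D.innerLin (e.symm x)).compl₁₂ (mfderiv 𝓘(ℝ, E4) 𝓘(ℝ, E4) e.symm x).toLinearMap
    (mfderiv 𝓘(ℝ, E4) 𝓘(ℝ, E4) e.symm x).toLinearMap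

theorem InitialData.chartForm_single (a b : Fin 4) :
    D.chartForm e x (EuclideanSpace.single a 1) (EuclideanSpace.single b 1)
      = D.metricComp e a b x := rfl

theorem InitialData.chartForm_transition (he : e ∈ IsManifold.maximalAtlas 𝓘(ℝ, E4) ∞ M)
    (he' : e' ∈ IsManifold.maximalAtlas 𝓘(ℝ, E4) ∞ M) (hx : x ∈ e.target)
    (hx' : e.symm x ∈ e'.source) (u v : E4) :
    D.chartForm e x u v = D.chartForm e' (transition e e' x) (fderiv ℝ (transition e e') x u)
      (fderiv ℝ (transition e e') x v) := by
  have h1 : e'.symm (transition e e' x) = e.symm x := e'.left_inv hx'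
  -- Moves the metric between equal base points while the vectors stay fixed in `E4`.
  have h2 : ∀ (q q' : M), q = q' → ∀ u v : E4, D.h.inner q u v = D.h.inner q' u v := by
    rintro q _ rfl u v
    rfl
  change D.h.inner (e.symm x) (mfderiv 𝓘(ℝ, E4) 𝓘(ℝ, E4) e.symm x u)
    (mfderiv 𝓘(ℝ, E4) 𝓘(ℝ, E4) e.symm x v) = _
  refine (h2 _ _ h1.symm _ _).trans ?_
  rw [mfderiv_symm_transition he he' hx hx' u, mfderiv_symm_transition he he' hx hx' v]
  rfl

/-- The Gram determinant scales by the square of the Jacobian determinant. Its root is the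
compatibility condition that `paramMeasure_agree` requires. -/
theorem InitialData.volDensity_transition (he : e ∈ IsManifold.maximalAtlas 𝓘(ℝ, E4) ∞ M)
    (he' : e' ∈ IsManifold.maximalAtlas 𝓘(ℝ, E4) ∞ M) (hx : x ∈ e.target)
    (hx' : e.symm x ∈ e'.source) :
    D.volDensity e x = |(fderiv ℝ (transition e e') x).det|
      * D.volDensity e' (transition e e' x) := by
  have h := det_gram_comp (EuclideanSpace.basisFun (Fin 4) ℝ).toBasis
    (D.chartForm e' (transition e e' x)) (fderiv ℝ (transition e e') x).toLinearMap
  simp only [OrthonormalBasis.coe_toBasis, EuclideanSpace.basisFun_apply,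
    ContinuousLinearMap.coe_coe, ← D.chartForm_transition he he' hx hx', D.chartForm_single] at h
  rw [InitialData.volDensity, sqrtDet, h, Real.sqrt_mul (sq_nonneg _), Real.sqrt_sq_eq_abs]
  rfl

variable [MeasurableSpace M] [BorelSpace M]

/-- The Riemannian volume measure. -/
def InitialData.volMeasure : Measure M :=
  ⨆ e : {e : OpenPartialHomeomorph M E4 // e ∈ IsManifold.maximalAtlas 𝓘(ℝ, E4) ∞ M},
    paramMeasure e.1.symm e.1.target (D.volDensity e.1)

theorem InitialData.volMeasure_restrict (he : e ∈ IsManifold.maximalAtlas 𝓘(ℝ, E4) ∞ M) :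
    D.volMeasure.restrict e.source = paramMeasure e.symm e.target (D.volDensity e) := by
  refine iSup_restrict_of_agree (fun e : {e : OpenPartialHomeomorph M E4 //
    e ∈ IsManifold.maximalAtlas 𝓘(ℝ, E4) ∞ M} => paramMeasure e.1.symm e.1.target
      (D.volDensity e.1)) (fun e => e.1.source) (fun e => e.1.open_source.measurableSet) ?_ ?_
      ⟨e, he⟩
  · intro e
    exact paramMeasure_eq_zero e.1.open_target e.1.continuousOn_symm
      e.1.open_source.measurableSet.compl fun y hy h => h (e.1.map_target hy)
  · rintro ⟨e, he⟩ ⟨e', he'⟩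
    exact paramMeasure_agree e.open_target e.continuousOn_symm e'.open_target e'.continuousOn_symm
      e.symm.injOn e'.symm.injOn e.open_source.measurableSet e'.open_source.measurableSet
      (fun z hz hz' => ⟨e (e'.symm z), e.map_source hz', e.left_inv hz'⟩)
      (τ := transition e e') (τ' := fderiv ℝ (transition e e')) fun y hy hy' =>
      ⟨((contDiffAt_transition he he' hy hy').differentiableAt (by simp)).hasFDerivAt,
        e'.map_source hy', e'.left_inv hy', D.volDensity_transition he he' hy hy'⟩

theorem InitialData.continuousOn_volDensity (he : e ∈ IsManifold.maximalAtlas 𝓘(ℝ, E4) ∞ M) :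
    ContinuousOn (D.volDensity e) e.target := fun _ hx =>
  (D.contDiffAt_volDensity he hx).continuousAt.continuousWithinAt

theorem InitialData.volMeasure_locallyFinite [T2Space M] [LocallyCompactSpace M] :
    IsLocallyFiniteMeasure D.volMeasure := by
  refine ⟨fun p => ?_⟩
  set e := chartAt E4 p
  have he : e ∈ IsManifold.maximalAtlas 𝓘(ℝ, E4) ∞ M := IsManifold.chart_mem_maximalAtlas p
  obtain ⟨C, hC, hCe, hCc⟩ := local_compact_nhds
    (e.open_source.mem_nhds (mem_chart_source E4 p))
  refine ⟨C, hC, ?_⟩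
  have h1 : D.volMeasure C = paramMeasure e.symm e.target (D.volDensity e) C := by
    rw [← D.volMeasure_restrict he, Measure.restrict_apply hCc.measurableSet,
      Set.inter_eq_left.2 hCe]
  rw [h1]
  exact paramMeasure_lt_top e.open_target e.continuousOn_symm (D.continuousOn_volDensity he)
    hCc.measurableSet (hCc.image_of_continuousOn (e.continuousOn.mono hCe))
    (Set.image_subset_iff.2 fun q hq => e.map_source (hCe hq))
    fun y hy hyC => ⟨e.symm y, hyC, e.right_inv hy⟩

/-! #### Slice charts -/

/-- The density of the induced measure in a slice chart. -/
def InitialData.sliceDensity (e : OpenPartialHomeomorph M E4) (y : Fin 3 → ℝ) : ℝ :=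
  Real.sqrt (Matrix.of fun a b : Fin 3 => D.metricComp e a.castSucc b.castSucc (slice y)).det

/-- The parameter domain of a slice chart. -/
def sliceDomain (e : OpenPartialHomeomorph M E4) : Set (Fin 3 → ℝ) := {y | slice y ∈ e.target}

/-- The parametrization of the hypersurface in a slice chart. -/
def sliceParam (e : OpenPartialHomeomorph M E4) (y : Fin 3 → ℝ) : M := e.symm (slice y)

theorem isOpen_sliceDomain (e : OpenPartialHomeomorph M E4) : IsOpen (sliceDomain e) :=
  e.open_target.preimage continuous_slice

theorem continuousOn_sliceParam (e : OpenPartialHomeomorph M E4) :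
    ContinuousOn (sliceParam e) (sliceDomain e) :=
  e.continuousOn_symm.comp continuous_slice.continuousOn fun _ hy => hy

theorem injOn_sliceParam (e : OpenPartialHomeomorph M E4) :
    Set.InjOn (sliceParam e) (sliceDomain e) := fun _ hy _ hz h =>
  slice_injective (e.symm.injOn hy hz h)

theorem InitialData.continuousOn_sliceDensity (he : e ∈ IsManifold.maximalAtlas 𝓘(ℝ, E4) ∞ M) :
    ContinuousOn (D.sliceDensity e) (sliceDomain e) := by
  intro y hy
  have h : ContinuousAt (fun y : Fin 3 → ℝ => (Matrix.of fun a b : Fin 3 =>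
      D.metricComp e a.castSucc b.castSucc (slice y)).det) y := by
    have h1 : ∀ a b : Fin 3, ContinuousAt
        (fun y : Fin 3 → ℝ => D.metricComp e a.castSucc b.castSucc (slice y)) y := fun a b =>
      (D.contDiffAt_metricComp he hy _ _).continuousAt.comp continuous_slice.continuousAt
    exact (Continuous.matrix_det continuous_id).continuousAt.comp
      (continuousAt_pi.2 fun a => continuousAt_pi.2 fun b => h1 a b)
  exact (Real.continuous_sqrt.continuousAt.comp h).continuousWithinAt

variable {S : Set M}

theorem sliceParam_mem (h : IsSliceChart S e) {y : Fin 3 → ℝ} (hy : y ∈ sliceDomain e) :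
    sliceParam e y ∈ S := by
  refine (h.2 _ (e.map_target hy)).2 ?_
  rw [e.right_inv hy]
  rfl

theorem exists_sliceParam (h : IsSliceChart S e) {p : M} (hp : p ∈ e.source) (hS : p ∈ S) :
    frontL (e p) ∈ sliceDomain e ∧ sliceParam e (frontL (e p)) = p := by
  have h1 := slice_frontL ((h.2 p hp).1 hS)
  refine ⟨?_, ?_⟩
  · change slice (frontL (e p)) ∈ e.target
    rw [h1]
    exact e.map_source hp
  · rw [sliceParam, h1, e.left_inv hp]

/-- The transition map between slice charts. -/
def sliceTransition (e e' : OpenPartialHomeomorph M E4) (y : Fin 3 → ℝ) : Fin 3 → ℝ :=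
  frontL (transition e e' (slice y))

theorem slice_sliceTransition (h : IsSliceChart S e) (h' : IsSliceChart S e') {y : Fin 3 → ℝ}
    (hy : y ∈ sliceDomain e) (hy' : sliceParam e y ∈ e'.source) :
    slice (sliceTransition e e' y) = transition e e' (slice y) :=
  slice_frontL ((h'.2 _ hy').1 (sliceParam_mem h hy))

/-- A transition between slice charts maps the slice into the slice, so its derivative preserves the
slice directions. That is the second part, and it lets the induced Gram matrix transform by the 3×3
derivative alone. -/
theorem hasFDerivAt_sliceTransition (h : IsSliceChart S e) (h' : IsSliceChart S e')
    {y : Fin 3 → ℝ} (hy : y ∈ sliceDomain e) (hy' : sliceParam e y ∈ e'.source) :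
    HasFDerivAt (sliceTransition e e')
      (frontL.comp ((fderiv ℝ (transition e e') (slice y)).comp sliceL)) y ∧
    ∀ u, fderiv ℝ (transition e e') (slice y) (sliceL u)
      = sliceL (frontL (fderiv ℝ (transition e e') (slice y) (sliceL u))) := by
  have h1 : HasFDerivAt (transition e e') (fderiv ℝ (transition e e') (slice y)) (slice y) :=
    ((contDiffAt_transition h.1 h'.1 hy hy').differentiableAt (by simp)).hasFDerivAt
  have h2 : HasFDerivAt slice sliceL y := by
    rw [show slice = sliceL from funext fun y => (sliceL_apply y).symm]
    exact sliceL.hasFDerivAt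
  have h3 : HasFDerivAt (sliceTransition e e')
      (frontL.comp ((fderiv ℝ (transition e e') (slice y)).comp sliceL)) y :=
    frontL.hasFDerivAt.comp y (h1.comp y h2)
  refine ⟨h3, fun u => ?_⟩
  have h4 : HasFDerivAt (fun z => sliceL (sliceTransition e e' z))
      ((fderiv ℝ (transition e e') (slice y)).comp sliceL) y := by
    refine (h1.comp y h2).congr_of_eventuallyEq ?_
    have hev : ∀ᶠ z in 𝓝 y, z ∈ sliceDomain e ∧ sliceParam e z ∈ e'.source :=
      ((isOpen_sliceDomain e).mem_nhds hy |> Filter.eventually_mem_set.2).and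
        (((continuousOn_sliceParam e).continuousAt
          ((isOpen_sliceDomain e).mem_nhds hy)).eventually (e'.open_source.mem_nhds hy'))
    filter_upwards [hev] with z hz
    rw [sliceL_apply]
    exact slice_sliceTransition h h' hz.1 hz.2
  have h5 := h4.unique (sliceL.hasFDerivAt.comp y h3)
  exact congrArg (fun L : (Fin 3 → ℝ) →L[ℝ] E4 => L u) h5

theorem InitialData.sliceDensity_transition (h : IsSliceChart S e) (h' : IsSliceChart S e')
    {y : Fin 3 → ℝ} (hy : y ∈ sliceDomain e) (hy' : sliceParam e y ∈ e'.source) :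
    D.sliceDensity e y
      = |(frontL.comp ((fderiv ℝ (transition e e') (slice y)).comp sliceL)).det|
      * D.sliceDensity e' (sliceTransition e e' y) := by
  set L := frontL.comp ((fderiv ℝ (transition e e') (slice y)).comp sliceL)
  have hL := (hasFDerivAt_sliceTransition h h' hy hy').2
  have key := det_gram_comp (Pi.basisFun ℝ (Fin 3)) ((D.chartForm e' (slice
    (sliceTransition e e' y))).compl₁₂ sliceL.toLinearMap sliceL.toLinearMap) L.toLinearMap
  have h1 : ∀ a b : Fin 3, ((D.chartForm e' (slice
      (sliceTransition e e' y))).compl₁₂ sliceL.toLinearMap sliceL.toLinearMap)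
      (L.toLinearMap (Pi.basisFun ℝ (Fin 3) a)) (L.toLinearMap (Pi.basisFun ℝ (Fin 3) b))
      = D.metricComp e a.castSucc b.castSucc (slice y) := by
    intro a b
    rw [← D.chartForm_single, D.chartForm_transition h.1 h'.1 hy hy', ← sliceL_single,
      ← sliceL_single, hL (Pi.single a 1), hL (Pi.single b 1),
      ← slice_sliceTransition h h' hy hy', Pi.basisFun_apply,
      Pi.basisFun_apply]
    rfl
  have h2 : ∀ a b : Fin 3, ((D.chartForm e' (slice
      (sliceTransition e e' y))).compl₁₂ sliceL.toLinearMap sliceL.toLinearMap)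
      (Pi.basisFun ℝ (Fin 3) a) (Pi.basisFun ℝ (Fin 3) b)
      = D.metricComp e' a.castSucc b.castSucc (slice (sliceTransition e e' y)) := by
    intro a b
    rw [← D.chartForm_single, ← sliceL_single, ← sliceL_single, Pi.basisFun_apply,
      Pi.basisFun_apply]
    rfl
  simp only [h1, h2] at key
  rw [InitialData.sliceDensity, key, Real.sqrt_mul (sq_nonneg _), Real.sqrt_sq_eq_abs]
  rfl

theorem surfaceMeasure_eq_iSup :
    surfaceMeasure D S = ⨆ e : {e : OpenPartialHomeomorph M E4 // IsSliceChart S e},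
      paramMeasure (sliceParam e.1) (sliceDomain e.1) (D.sliceDensity e.1) := by
  rw [surfaceMeasure, iSup_subtype']
  rfl

theorem surfaceMeasure_restrict (h : IsSliceChart S e) :
    (surfaceMeasure D S).restrict e.source
      = paramMeasure (sliceParam e) (sliceDomain e) (D.sliceDensity e) := by
  rw [surfaceMeasure_eq_iSup]
  refine iSup_restrict_of_agree (fun e : {e : OpenPartialHomeomorph M E4 // IsSliceChart S e} =>
    paramMeasure (sliceParam e.1) (sliceDomain e.1) (D.sliceDensity e.1))
    (fun e => e.1.source) (fun e => e.1.open_source.measurableSet) ?_ ?_ ⟨e, h⟩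
  · intro e
    exact paramMeasure_eq_zero (isOpen_sliceDomain _) (continuousOn_sliceParam _)
      e.1.open_source.measurableSet.compl fun y hy h => h (e.1.map_target hy)
  · rintro ⟨e, h⟩ ⟨e', h'⟩
    refine paramMeasure_agree (isOpen_sliceDomain _) (continuousOn_sliceParam _)
      (isOpen_sliceDomain _) (continuousOn_sliceParam _) (injOn_sliceParam _) (injOn_sliceParam _)
      e.open_source.measurableSet e'.open_source.measurableSet
      (fun z hz hz' => ⟨_, exists_sliceParam h hz' (sliceParam_mem h' hz)⟩)
      (τ := sliceTransition e e')
      (τ' := fun y => frontL.comp ((fderiv ℝ (transition e e') (slice y)).comp sliceL))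
      fun y hy hy' => ?_
    have h1 := exists_sliceParam h' hy' (sliceParam_mem h hy)
    exact ⟨(hasFDerivAt_sliceTransition h h' hy hy').1, h1.1, h1.2,
      D.sliceDensity_transition h h' hy hy'⟩

/-- A supremum of measures need not be evaluated set by set, so the measure is bounded by one that
lives on `S`: the sum of all slice measures, restricted to `S`. -/
theorem surfaceMeasure_compl (hS : IsClosed S) : surfaceMeasure D S Sᶜ = 0 := by
  have hm : MeasurableSet S := hS.measurableSet
  have h : surfaceMeasure D S ≤ (Measure.sum fun e : {e : OpenPartialHomeomorph M E4 //
      IsSliceChart S e} => paramMeasure (sliceParam e.1) (sliceDomain e.1)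
        (D.sliceDensity e.1)).restrict S := by
    rw [surfaceMeasure_eq_iSup]
    refine iSup_le fun e => ?_
    have h0 : paramMeasure (sliceParam e.1) (sliceDomain e.1) (D.sliceDensity e.1) Sᶜ = 0 :=
      paramMeasure_eq_zero (isOpen_sliceDomain _) (continuousOn_sliceParam _) hm.compl
        fun y hy hn => hn (sliceParam_mem e.2 hy)
    rw [← Measure.restrict_eq_self_of_ae_mem (s := S) (μ := paramMeasure (sliceParam e.1)
      (sliceDomain e.1) (D.sliceDensity e.1)) (by rw [ae_iff]; exact h0)]
    exact Measure.restrict_mono le_rfl (Measure.le_sum _ e)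
  refine le_antisymm ((h _).trans ?_) bot_le
  rw [Measure.restrict_apply hm.compl, Set.compl_inter_self, measure_empty]

theorem surfaceMeasure_locallyFinite [T2Space M] [LocallyCompactSpace M] (hS : IsClosed S)
    (h : ∀ p ∈ S, ∃ e, IsSliceChart S e ∧ p ∈ e.source) :
    IsLocallyFiniteMeasure (surfaceMeasure D S) := by
  refine ⟨fun p => ?_⟩
  by_cases hp : p ∈ S
  · obtain ⟨e, he, hpe⟩ := h p hp
    obtain ⟨C, hC, hCe, hCc⟩ := local_compact_nhds (e.open_source.mem_nhds hpe)
    refine ⟨C, hC, ?_⟩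
    have h1 : surfaceMeasure D S C = paramMeasure (sliceParam e) (sliceDomain e)
        (D.sliceDensity e) C := by
      rw [← surfaceMeasure_restrict D he, Measure.restrict_apply hCc.measurableSet,
        Set.inter_eq_left.2 hCe]
    rw [h1]
    refine paramMeasure_lt_top (K := frontL '' (e '' (C ∩ S))) (isOpen_sliceDomain _)
      (continuousOn_sliceParam _) (D.continuousOn_sliceDensity he.1) hCc.measurableSet ?_ ?_ ?_
    · exact ((hCc.inter_right hS).image_of_continuousOn
        (e.continuousOn.mono fun q hq => hCe hq.1)).image frontL.continuous
    · rintro _ ⟨_, ⟨q, hq, rfl⟩, rfl⟩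
      exact (exists_sliceParam he (hCe hq.1) hq.2).1
    · intro y hy hyC
      refine ⟨slice y, ⟨sliceParam e y, ⟨hyC, sliceParam_mem he hy⟩, e.right_inv hy⟩,
        frontL_slice y⟩
  · exact ⟨Sᶜ, hS.isOpen_compl.mem_nhds hp, by rw [surfaceMeasure_compl D hS]; simp⟩

end Measures

/-! ### The divergence theorem in a half space -/

section HalfSpace

/-- The divergence theorem in a slab, for fields that vanish far out in the other directions. -/
theorem integral_div_slab {F : Fin 4 → E4 → ℝ} (hF : ∀ a, ContDiff ℝ 1 (F a)) {L lo hi : ℝ}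
    (hL : 0 < L) (h0 : ∀ a x c, L ≤ |x c| → F a x = 0) (hlh : lo ≤ hi) :
    ∫ z in Set.Icc (fun c : Fin 4 => if c = 3 then lo else -L) (fun c => if c = 3 then hi else L),
        ∑ a, pd a (F a) (WithLp.toLp 2 z)
      = (∫ y in Set.Icc (fun _ : Fin 3 => -L) (fun _ => L),
          F 3 (slice y + hi • EuclideanSpace.single 3 1))
        - ∫ y in Set.Icc (fun _ : Fin 3 => -L) (fun _ => L),
          F 3 (slice y + lo • EuclideanSpace.single 3 1) := by
  set T : (Fin 4 → ℝ) →L[ℝ] E4 := ((EuclideanSpace.equiv (Fin 4) ℝ).symm : (Fin 4 → ℝ) →L[ℝ] E4)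
  have hT : ∀ z, T z = WithLp.toLp 2 z := fun z => rfl
  have hd : ∀ a z, HasFDerivAt (fun z => F a (T z)) ((fderiv ℝ (F a) (T z)).comp T) z := fun a z =>
    (((hF a).differentiable (by simp)).differentiableAt.hasFDerivAt).comp z T.hasFDerivAt
  have hc : ∀ a, Continuous fun z => F a (T z) := fun a => (hF a).continuous.comp T.continuous
  have hpd : ∀ a z, (fderiv ℝ (F a) (T z)).comp T (Pi.single a 1)
      = pd a (F a) (WithLp.toLp 2 z) := fun a z => by
    rw [ContinuousLinearMap.comp_apply, hT, hT, pd]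
    rfl
  have hpc : ∀ a, Continuous fun z : Fin 4 → ℝ => pd a (F a) (WithLp.toLp 2 z) := fun a =>
    (((hF a).continuous_fderiv (by simp)).clm_apply continuous_const).comp T.continuous
  have hle : (fun c : Fin 4 => if c = 3 then lo else -L) ≤ fun c => if c = 3 then hi else L := by
    intro c
    dsimp only
    split_ifs
    · exact hlh
    · linarith
  have key := integral_divergence_of_hasFDerivAt_off_countable' _ _ hle (fun a z => F a (T z))
    (fun a z => (fderiv ℝ (F a) (T z)).comp T) ∅ Set.countable_empty
    (fun a => (hc a).continuousOn) (fun z _ a => hd a z) (by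
      simp only [hpd]
      exact (continuous_finsetSum _ fun a _ => hpc a).continuousOn.integrableOn_compact
        isCompact_Icc)
  simp only [hpd] at key
  -- Split off the two faces of the last coordinate; on the other faces some coordinate has absolute
  -- value `L`, so the field vanishes there.
  rw [key, Fin.sum_univ_castSucc]
  have hz : ∀ (i : Fin 3) (t : ℝ), |t| = L → ∀ y : Fin 3 → ℝ,
      F i.castSucc (T (Fin.insertNth i.castSucc t y)) = 0 := by
    intro i t ht y
    apply h0 _ _ i.castSucc
    rw [hT]
    simp [ht]
  have hne : ∀ i : Fin 3, i.castSucc ≠ (3 : Fin 4) := by decide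
  have hs : ∀ i : Fin 3, (if i.castSucc = (3 : Fin 4) then hi else L) = L ∧
      (if i.castSucc = (3 : Fin 4) then lo else -L) = -L := fun i => by simp [hne i]
  have hlast : ∀ (t : ℝ) (y : Fin 3 → ℝ), T (Fin.insertNth (Fin.last 3) t y)
      = slice y + t • EuclideanSpace.single 3 1 := by
    intro t y
    rw [hT]
    ext b
    refine Fin.lastCases ?_ (fun j => ?_) b
    · simp [slice]
    · rw [PiLp.add_apply, slice_castSucc]
      have := Fin.insertNth_apply_succAbove (α := fun _ => ℝ) (Fin.last 3) t y j
      rw [Fin.succAbove_last] at this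
      change Fin.insertNth (α := fun _ => ℝ) (Fin.last 3) t y j.castSucc = _
      rw [this]
      simp [hne j]
  rw [Finset.sum_eq_zero fun i _ => by
    rw [(hs i).1, (hs i).2]
    simp only [hz i L (abs_of_pos hL), hz i (-L) (by rw [abs_neg, abs_of_pos hL])]
    simp, zero_add]
  simp only [hlast]
  congr 1
  all_goals
    have h3 : (fun c : Fin 4 => if c = 3 then lo else -L) ∘ (Fin.last 3).succAbove
        = fun _ => -L := by
      funext c
      simp
    have h4 : (fun c : Fin 4 => if c = 3 then hi else L) ∘ (Fin.last 3).succAbove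
        = fun _ => L := by
      funext c
      simp
    rw [h3, h4]
    rfl

variable {F : Fin 4 → E4 → ℝ}

/-- A box containing all supports. Vanishing is stated coordinate by coordinate, which is the form
that the faces of the box need. -/
theorem exists_box (hs : ∀ a, HasCompactSupport (F a)) :
    ∃ L : ℝ, 0 < L ∧ (∀ a x c, L ≤ |x c| → F a x = 0) ∧
      ∀ x c, L ≤ |x c| → ∑ a, pd a (F a) x = 0 := by
  have hK : IsCompact (⋃ a, tsupport (F a)) := isCompact_iUnion hs
  obtain ⟨L, hL, hb⟩ := hK.isBounded.exists_pos_norm_lt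
  have h1 : ∀ a x c, L ≤ |x c| → x ∉ tsupport (F a) := by
    intro a x c hx hxs
    have h2 := hb x (Set.mem_iUnion.2 ⟨a, hxs⟩)
    have h3 := PiLp.norm_apply_le x c
    rw [Real.norm_eq_abs] at h3
    linarith
  refine ⟨L, hL, fun a x c hx => image_eq_zero_of_notMem_tsupport (h1 a x c hx), fun x c hx => ?_⟩
  refine Finset.sum_eq_zero fun a _ => ?_
  rw [pd, fderiv_of_notMem_tsupport (𝕜 := ℝ) (h1 a x c hx)]
  rfl

theorem setIntegral_E4 (f : E4 → ℝ) (s : Set E4) :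
    ∫ x in s, f x = ∫ z in WithLp.toLp 2 ⁻¹' s, f (WithLp.toLp 2 z) :=
  ((EuclideanSpace.volume_preserving_symm_measurableEquiv_toLp (Fin 4)).symm.setIntegral_preimage_emb
    (MeasurableEquiv.measurableEmbedding _) f s).symm

/-- The set `s` contains the slab and differs from the box only where the divergence vanishes. One
statement thus serves the upper half space, the lower half space and all of `ℝ⁴`. -/
theorem integral_div_region (hF : ∀ a, ContDiff ℝ 1 (F a)) {L lo hi : ℝ} (hL : 0 < L)
    (h0 : ∀ a x c, L ≤ |x c| → F a x = 0)
    (h1 : ∀ x c, L ≤ |x c| → ∑ a, pd a (F a) x = 0) (hlh : lo ≤ hi) {s : Set E4}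
    (hs : MeasurableSet s) (hsub : ∀ x, lo ≤ x 3 → x 3 ≤ hi → x ∈ s)
    (hsup : ∀ x ∈ s, (∀ c, |x c| < L) → lo ≤ x 3 ∧ x 3 ≤ hi) :
    ∫ x in s, ∑ a, pd a (F a) x
      = (∫ y in Set.Icc (fun _ : Fin 3 => -L) (fun _ => L),
          F 3 (slice y + hi • EuclideanSpace.single 3 1))
        - ∫ y in Set.Icc (fun _ : Fin 3 => -L) (fun _ => L),
          F 3 (slice y + lo • EuclideanSpace.single 3 1) := by
  rw [← integral_div_slab hF hL h0 hlh, setIntegral_E4]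
  refine setIntegral_eq_of_subset_of_forall_sdiff_eq_zero
    (hs.preimage (EuclideanSpace.volume_preserving_symm_measurableEquiv_toLp
      (Fin 4)).symm.measurable) (fun z hz => ?_) fun z hz => ?_
  · have h2 := hz.1 3
    have h3 := hz.2 3
    simp only [if_true] at h2 h3
    exact hsub _ h2 h3
  · by_contra hne
    have h2 : ∀ c, |z c| < L := fun c => by
      by_contra! h
      exact hne (h1 _ c h)
    obtain ⟨h3, h4⟩ := hsup _ hz.1 h2
    apply hz.2
    constructor
    · intro c
      dsimp only
      split_ifs with hc
      · rw [hc]; exact h3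
      · exact (abs_lt.1 (h2 c)).1.le
    · intro c
      dsimp only
      split_ifs with hc
      · rw [hc]; exact h4
      · exact (abs_lt.1 (h2 c)).2.le

theorem integral_slice_eq {L : ℝ} (h0 : ∀ a x c, L ≤ |x c| → F a x = 0) :
    ∫ y in Set.Icc (fun _ : Fin 3 => -L) (fun _ => L),
      F 3 (slice y + (0 : ℝ) • EuclideanSpace.single 3 1) = ∫ y, F 3 (slice y) := by
  simp only [zero_smul, add_zero]
  refine setIntegral_eq_integral_of_forall_compl_eq_zero fun y hy => ?_
  by_contra hne
  apply hy
  have h2 : ∀ c, |y c| < L := fun c => by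
    by_contra! h
    exact hne (h0 3 _ c.castSucc (by rwa [slice_castSucc]))
  exact ⟨fun c => (abs_lt.1 (h2 c)).1.le, fun c => (abs_lt.1 (h2 c)).2.le⟩

theorem integral_end_eq {L t : ℝ} (ht : |t| = L) (h0 : ∀ a x c, L ≤ |x c| → F a x = 0) :
    ∫ y in Set.Icc (fun _ : Fin 3 => -L) (fun _ => L),
      F 3 (slice y + t • EuclideanSpace.single 3 1) = 0 := by
  have h : ∀ y, F 3 (slice y + t • EuclideanSpace.single 3 1) = 0 := fun y => by
    apply h0 3 _ 3
    rw [PiLp.add_apply, slice_last]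
    simp [ht]
  simp [h]

theorem measurable_E4_apply (c : Fin 4) : Measurable fun x : E4 => x c :=
  (EuclideanSpace.proj c : E4 →L[ℝ] ℝ).continuous.measurable

/-- The sign is that of the outer normal `-∂_3` of the upper half space; the opposite face lies
outside the support. -/
theorem integral_div_upper (hF : ∀ a, ContDiff ℝ 1 (F a)) (hs : ∀ a, HasCompactSupport (F a)) :
    ∫ x in {x : E4 | 0 ≤ x 3}, ∑ a, pd a (F a) x = -∫ y, F 3 (slice y) := by
  obtain ⟨L, hL, h0, h1⟩ := exists_box hs
  have hs' : ∫ x in {x : E4 | 0 ≤ x 3}, ∑ a, pd a (F a) x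
      = ∫ x in {x : E4 | 0 ≤ x 3 ∧ x 3 ≤ L}, ∑ a, pd a (F a) x := by
    refine setIntegral_eq_of_subset_of_forall_sdiff_eq_zero
      (measurableSet_le measurable_const (measurable_E4_apply 3)) (fun x hx => hx.1) fun x hx => ?_
    have : L < x 3 := by
      by_contra! h
      exact hx.2 ⟨hx.1, h⟩
    exact h1 x 3 (this.le.trans (le_abs_self _))
  rw [hs', integral_div_region (s := {x : E4 | 0 ≤ x 3 ∧ x 3 ≤ L}) (lo := 0) (hi := L) hF hL h0 h1 (by linarith)
    ((measurableSet_le measurable_const (measurable_E4_apply 3)).inter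
      (measurableSet_le (measurable_E4_apply 3) measurable_const)) (fun x h2 h3 => ⟨h2, h3⟩)
    (fun x hx _ => hx), integral_slice_eq h0, integral_end_eq (abs_of_pos hL) h0, zero_sub]

theorem integral_div_lower (hF : ∀ a, ContDiff ℝ 1 (F a)) (hs : ∀ a, HasCompactSupport (F a)) :
    ∫ x in {x : E4 | x 3 ≤ 0}, ∑ a, pd a (F a) x = ∫ y, F 3 (slice y) := by
  obtain ⟨L, hL, h0, h1⟩ := exists_box hs
  have hs' : ∫ x in {x : E4 | x 3 ≤ 0}, ∑ a, pd a (F a) x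
      = ∫ x in {x : E4 | -L ≤ x 3 ∧ x 3 ≤ 0}, ∑ a, pd a (F a) x := by
    refine setIntegral_eq_of_subset_of_forall_sdiff_eq_zero
      (measurableSet_le (measurable_E4_apply 3) measurable_const) (fun x hx => hx.2) fun x hx => ?_
    have : x 3 < -L := by
      by_contra! h
      exact hx.2 ⟨h, hx.1⟩
    exact h1 x 3 (by rw [le_abs]; right; linarith)
  rw [hs', integral_div_region (s := {x : E4 | -L ≤ x 3 ∧ x 3 ≤ 0}) (lo := -L) (hi := 0) hF hL h0 h1 (by linarith)
    ((measurableSet_le measurable_const (measurable_E4_apply 3)).inter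
      (measurableSet_le (measurable_E4_apply 3) measurable_const)) (fun x h2 h3 => ⟨h2, h3⟩)
    (fun x hx _ => hx), integral_slice_eq h0, integral_end_eq (t := -L) (by rw [abs_neg, abs_of_pos hL]) h0,
    sub_zero]

theorem integral_div_univ (hF : ∀ a, ContDiff ℝ 1 (F a)) (hs : ∀ a, HasCompactSupport (F a)) :
    ∫ x, ∑ a, pd a (F a) x = 0 := by
  obtain ⟨L, hL, h0, h1⟩ := exists_box hs
  rw [← setIntegral_univ]
  rw [integral_div_region (lo := -L) (hi := L) hF hL h0 h1 (by linarith) MeasurableSet.univ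
    (fun x _ _ => Set.mem_univ x) fun x _ h => ⟨(abs_lt.1 (h 3)).1.le, (abs_lt.1 (h 3)).2.le⟩,
    integral_end_eq (abs_of_pos hL) h0,
    integral_end_eq (t := -L) (by rw [abs_neg, abs_of_pos hL]) h0, sub_zero]

end HalfSpace

/-! ### The unit normal in slice charts -/

section Normal

variable {M : Type*} [TopologicalSpace M] [ChartedSpace E4 M] [IsManifold 𝓘(ℝ, E4) ∞ M]
  {e : OpenPartialHomeomorph M E4} {x : E4}

theorem hasFDerivAt_comp_symm (he : e ∈ IsManifold.maximalAtlas 𝓘(ℝ, E4) ∞ M) (hx : x ∈ e.target)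
    {f : M → ℝ} (hf : MDifferentiableAt 𝓘(ℝ, E4) 𝓘(ℝ, ℝ) f (e.symm x)) :
    HasFDerivAt (fun y => f (e.symm y))
      ((differential f (e.symm x)).comp (mfderiv 𝓘(ℝ, E4) 𝓘(ℝ, E4) e.symm x)) x :=
  (hf.hasMFDerivAt.comp x ((mdifferentiable_of_mem_maximalAtlas he).mdifferentiableAt_symm
    hx).hasMFDerivAt).hasFDerivAt

theorem hasDerivAt_along (he : e ∈ IsManifold.maximalAtlas 𝓘(ℝ, E4) ∞ M) (hx : x ∈ e.target)
    {f : M → ℝ} (hf : MDifferentiableAt 𝓘(ℝ, E4) 𝓘(ℝ, ℝ) f (e.symm x)) (v : E4) :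
    HasDerivAt (fun t : ℝ => f (e.symm (x + t • v)))
      (differential f (e.symm x) (mfderiv 𝓘(ℝ, E4) 𝓘(ℝ, E4) e.symm x v)) 0 := by
  have h1 : HasDerivAt (fun t : ℝ => x + t • v) v 0 := by
    have := ((hasDerivAt_id (0 : ℝ)).smul_const v).const_add x
    rwa [one_smul] at this
  have h2 : HasFDerivAt (fun y => f (e.symm y))
      ((differential f (e.symm x)).comp (mfderiv 𝓘(ℝ, E4) 𝓘(ℝ, E4) e.symm x)) (x + (0 : ℝ) • v) := by
    rw [zero_smul, add_zero]
    exact hasFDerivAt_comp_symm he hx hf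
  exact h2.comp_hasDerivAt (0 : ℝ) h1

theorem eventually_line (hx : x ∈ e.target) (v : E4) {P : M → Prop}
    (hP : ∀ᶠ q in 𝓝 (e.symm x), P q) :
    ∀ᶠ t : ℝ in 𝓝 0, x + t • v ∈ e.target ∧ P (e.symm (x + t • v)) := by
  have hc : Filter.Tendsto (fun t : ℝ => x + t • v) (𝓝 0) (𝓝 x) := by
    have : Continuous fun t : ℝ => x + t • v := by fun_prop
    have h := this.tendsto 0
    rwa [zero_smul, add_zero] at h
  have h1 : ∀ᶠ y in 𝓝 x, y ∈ e.target ∧ P (e.symm y) :=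
    (e.open_target.mem_nhds hx |> Filter.eventually_mem_set.2).and
      ((e.continuousAt_symm hx).eventually hP)
  exact hc.eventually h1

/-- The differential of a function that vanishes on the slice is a multiple of that of the last
coordinate. -/
theorem differential_of_vanish {S : Set M} (h : IsSliceChart S e) (hx : x ∈ e.target)
    (hx3 : x 3 = 0) {f : M → ℝ} (hf : MDifferentiableAt 𝓘(ℝ, E4) 𝓘(ℝ, ℝ) f (e.symm x))
    (h0 : ∀ᶠ q in 𝓝 (e.symm x), q ∈ S → f q = 0) (v : E4) :
    differential f (e.symm x) (mfderiv 𝓘(ℝ, E4) 𝓘(ℝ, E4) e.symm x v)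
      = v 3 * differential f (e.symm x) (coordVec e x 3) := by
  have h1 : ∀ v : E4, v 3 = 0 →
      differential f (e.symm x) (mfderiv 𝓘(ℝ, E4) 𝓘(ℝ, E4) e.symm x v) = 0 := by
    intro v hv
    have h2 := hasDerivAt_along h.1 hx hf v
    have h3 : (fun t : ℝ => f (e.symm (x + t • v))) =ᶠ[𝓝 0] fun _ => 0 := by
      filter_upwards [eventually_line hx v h0] with t ht
      refine ht.2 ((h.2 _ (e.map_target ht.1)).2 ?_)
      rw [e.right_inv ht.1]
      simp [hx3, hv]
    exact h2.unique ((hasDerivAt_const (0 : ℝ) (0 : ℝ)).congr_of_eventuallyEq h3)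
  -- Subtracting the last component leaves a vector tangent to the slice, which `h1` annihilates.
  have h2 := h1 (v - v 3 • EuclideanSpace.single 3 1) (by simp)
  set A : E4 →L[ℝ] ℝ :=
    (differential f (e.symm x)).comp (mfderiv 𝓘(ℝ, E4) 𝓘(ℝ, E4) e.symm x)
  have h3 : A (v - v 3 • EuclideanSpace.single 3 1) = 0 := h2
  rw [map_sub, map_smul, sub_eq_zero] at h3
  exact h3

variable [MulAction Torus M] {D : InitialData M} (S : Hypersurface D)

/-- The component of the unit normal transverse to the slice. -/
def Hypersurface.normalComp (e : OpenPartialHomeomorph M E4) (x : E4) : ℝ :=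
  vecComp S.normal e 3 x

/-- The conormal is proportional to the differential of a defining function, hence to `dx³`.
Evaluating `n_a = l δ_a^3` on `n` itself gives `l n³ = 1`. -/
theorem Hypersurface.inner_normal (h : IsSliceChart S.carrier e) (hx : x ∈ e.target)
    (hx3 : x 3 = 0) : ∃ l : ℝ, l * S.normalComp e x = 1 ∧
      ∀ v : E4, D.h.inner (e.symm x) (S.normal (e.symm x))
        (mfderiv 𝓘(ℝ, E4) 𝓘(ℝ, E4) e.symm x v) = l * v 3 := by
  have hS : e.symm x ∈ S.carrier := (h.2 _ (e.map_target hx)).2 (by rwa [e.right_inv hx])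
  obtain ⟨U, f, hU, hpU, hf, hz, hn⟩ := S.smooth _ hS
  obtain ⟨c, hc, hcn⟩ := hn _ hpU hS
  have hfd : MDifferentiableAt 𝓘(ℝ, E4) 𝓘(ℝ, ℝ) f (e.symm x) :=
    (hf.contMDiffAt (hU.mem_nhds hpU)).mdifferentiableAt (by simp)
  have h1 := differential_of_vanish h hx hx3 hfd (by
    filter_upwards [hU.mem_nhds hpU] with q hq hqS using (hz q hq).1 hqS)
  set l := D.h.inner (e.symm x) (S.normal (e.symm x)) (coordVec e x 3)
  have h2 : ∀ v : E4, D.h.inner (e.symm x) (S.normal (e.symm x))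
        (mfderiv 𝓘(ℝ, E4) 𝓘(ℝ, E4) e.symm x v) = l * v 3 := by
    intro v
    have h3 := h1 v
    rw [hcn, hcn] at h3
    apply mul_left_cancel₀ hc.ne'
    rw [h3]
    ring
  refine ⟨l, ?_, h2⟩
  have h3 := S.unit _ hS
  have h4 := mfderiv_symm_mfderiv h.1 hx (S.normal (e.symm x))
  have h5 := h2 (mfderiv 𝓘(ℝ, E4) 𝓘(ℝ, E4) e (e.symm x) (S.normal (e.symm x)))
  rw [h4, h3] at h5
  exact h5.symm

/-- Functions with the slice as zero set increase in the direction of the last coordinate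
if they do so along the normal. -/
theorem Hypersurface.normalComp_pos (h : IsSliceChart S.carrier e) (hx : x ∈ e.target)
    (hx3 : x 3 = 0) {f : M → ℝ} (hf : MDifferentiableAt 𝓘(ℝ, E4) 𝓘(ℝ, ℝ) f (e.symm x))
    (h0 : f (e.symm x) = 0) (hd : 0 < differential f (e.symm x) (S.normal (e.symm x)))
    (hev : ∀ᶠ q in 𝓝 (e.symm x), 0 < f q → 0 ≤ e q 3) : 0 < S.normalComp e x := by
  obtain ⟨l, hl, -⟩ := S.inner_normal h hx hx3
  have hne : S.normalComp e x ≠ 0 := right_ne_zero_of_mul_eq_one hl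
  refine lt_of_le_of_ne ?_ hne.symm
  set v : E4 := mfderiv 𝓘(ℝ, E4) 𝓘(ℝ, E4) e (e.symm x) (S.normal (e.symm x)) with hv
  have h1 := hasDerivAt_along h.1 hx hf v
  rw [hv, mfderiv_symm_mfderiv h.1 hx (S.normal (e.symm x)), ← hv] at h1
  -- Starting in the direction of the normal, `f` becomes positive at once, and then the last
  -- coordinate is nonnegative. This gives `n³ ≥ 0`, and `n³ ≠ 0` is already known.
  have h2 : ∀ᶠ t : ℝ in 𝓝[>] 0, 0 < f (e.symm (x + t • v)) := by
    have h3 := (hasDerivAt_iff_tendsto_slope.1 h1).eventually (lt_mem_nhds hd)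
    have h4 : ∀ᶠ t : ℝ in 𝓝[>] 0, 0 < slope (fun t : ℝ => f (e.symm (x + t • v))) 0 t :=
      h3.filter_mono (nhdsWithin_mono _ fun t ht => ne_of_gt ht)
    filter_upwards [h4, self_mem_nhdsWithin] with t ht ht0
    rw [slope_def_field] at ht
    simp only [zero_smul, add_zero, h0, sub_zero] at ht
    exact (div_pos_iff_of_pos_right ht0).1 ht
  have h3 := (eventually_line hx v hev).filter_mono (nhdsWithin_le_nhds (s := Set.Ioi (0 : ℝ)))
  obtain ⟨t, ⟨⟨ht1, ht2⟩, ht3⟩, ht4⟩ := ((h3.and h2).and self_mem_nhdsWithin).exists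
  have h5 := ht2 ht3
  rw [e.right_inv ht1] at h5
  simp only [PiLp.add_apply, PiLp.smul_apply, hx3, zero_add, smul_eq_mul] at h5
  exact nonneg_of_mul_nonneg_right h5 ht4

/-- Multiplying by the adjugate isolates the cofactor of the last entry, which is the determinant of
the upper left 3×3 block. For a metric and its unit normal it relates `det g` to `det γ`. -/
theorem det_eq_of_mulVec_eq_single {G : Matrix (Fin 4) (Fin 4) ℝ} {n : Fin 4 → ℝ} {l : ℝ}
    (h : G.mulVec n = Pi.single 3 l) :
    G.det * n 3 = l * (Matrix.of fun a b : Fin 3 => G a.castSucc b.castSucc).det := by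
  have h1 : G.adjugate.mulVec (G.mulVec n) = G.det • n := by
    rw [Matrix.mulVec_mulVec, Matrix.adjugate_mul, Matrix.smul_mulVec, Matrix.one_mulVec]
  have h2 := congrFun h1 3
  rw [h, Matrix.mulVec_single] at h2
  have h3 : G.adjugate 3 3 = (Matrix.of fun a b : Fin 3 => G a.castSucc b.castSucc).det := by
    rw [Matrix.adjugate_fin_succ_eq_det_submatrix]
    have : (-1 : ℝ) ^ ((3 : Fin 4) + (3 : Fin 4) : ℕ) = 1 := by norm_num
    rw [show (((3 : Fin 4) : ℕ) + ((3 : Fin 4) : ℕ)) = 6 from rfl, show (-1 : ℝ) ^ 6 = 1 by norm_num,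
      one_mul]
    congr 1
    ext a b
    have h4 : ∀ a : Fin 3, (3 : Fin 4).succAbove a = a.castSucc := by decide
    simp [Matrix.submatrix_apply, h4]
  simp only [Pi.smul_apply, smul_eq_mul, Matrix.col_apply, MulOpposite.smul_eq_mul_unop,
    MulOpposite.unop_op, h3] at h2
  linarith

/-- A slice chart whose last coordinate increases along the unit normal. -/
def Hypersurface.IsAdapted (e : OpenPartialHomeomorph M E4) : Prop :=
  IsSliceChart S.carrier e ∧ ∀ x ∈ e.target, x 3 = 0 → 0 < S.normalComp e x

variable {S}

/-- With conormal `l dx³`, `l > 0`, one has `√g = l √γ` and `K(n, ξ) = ⟨n, X⟩ = l X³`, so the factor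
`l` is shared. This turns the intrinsic surface integrand into the boundary term of the coordinate
divergence theorem. -/
theorem Hypersurface.IsAdapted.flux_density (h : S.IsAdapted e) {y : Fin 3 → ℝ}
    (hy : y ∈ sliceDomain e) (i : Fin 2) : 0 < D.sliceDensity e y ∧
    D.sliceDensity e y * D.K (sliceParam e y) (S.normal (sliceParam e y))
        (generator i (sliceParam e y))
      = D.volDensity e (slice y) * D.fluxComp i e 3 (slice y) := by
  obtain ⟨l, hl, hn⟩ := S.inner_normal h.1 hy rfl
  have hpos := h.2 _ hy rfl
  have hl0 : 0 < l := pos_of_mul_pos_left (by rw [hl]; exact one_pos) hpos.le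
  set q := sliceParam e y
  set G : Matrix (Fin 4) (Fin 4) ℝ := Matrix.of fun a b => D.metricComp e a b (slice y)
  set γ := (Matrix.of fun a b : Fin 3 => D.metricComp e a.castSucc b.castSucc (slice y)).det
  have h1 : G.mulVec (fun a => vecComp S.normal e a (slice y)) = Pi.single 3 l := by
    ext a
    have h2 := hn (EuclideanSpace.single a 1)
    have h3 : D.h.inner (e.symm (slice y)) (S.normal (e.symm (slice y))) (coordVec e (slice y) a)
        = ∑ b, vecComp S.normal e b (slice y) * D.metricComp e a b (slice y) := by
      conv_lhs => rw [sum_vecComp h.1.1 hy S.normal]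
      rw [D.h.symm]
      simp [comp₂]
    rw [Matrix.mulVec, dotProduct]
    have h4 : l * (EuclideanSpace.single a (1 : ℝ) : E4) 3 = (Pi.single 3 l : Fin 4 → ℝ) a := by
      by_cases ha : a = 3
      · subst ha; simp
      · simp [ha, Ne.symm ha]
    rw [← h4, ← h2]
    refine Eq.trans ?_ h3.symm
    exact Finset.sum_congr rfl fun b _ => mul_comm _ _
  have h2 := det_eq_of_mulVec_eq_single h1
  have hG : 0 < G.det := D.metricComp_det_pos h.1.1 hy
  have h3 : G.det = l ^ 2 * γ := by
    have h4 : G.det * S.normalComp e (slice y) = l * γ := h2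
    calc G.det = G.det * (l * S.normalComp e (slice y)) := by rw [hl, mul_one]
      _ = l * (G.det * S.normalComp e (slice y)) := by ring
      _ = l ^ 2 * γ := by rw [h4]; ring
  have hγ : 0 < γ := by
    rw [h3] at hG
    exact pos_of_mul_pos_right hG (sq_nonneg l)
  have h5 : D.volDensity e (slice y) = l * D.sliceDensity e y := by
    change Real.sqrt G.det = l * Real.sqrt γ
    rw [h3, Real.sqrt_mul (sq_nonneg l), Real.sqrt_sq hl0.le]
  refine ⟨Real.sqrt_pos.2 hγ, ?_⟩
  have h6 : D.K q (S.normal q) (generator i q) = l * D.fluxComp i e 3 (slice y) := by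
    rw [D.K_symm, ← D.inner_flux, D.h.symm]
    have h7 := hn (mfderiv 𝓘(ℝ, E4) 𝓘(ℝ, E4) e (e.symm (slice y)) (D.flux i (e.symm (slice y))))
    rw [mfderiv_symm_mfderiv h.1.1 hy] at h7
    rw [← D.vecComp_flux h.1.1 hy]
    exact h7
  rw [h6, h5]
  ring

/-- Continuity of the normal field is not part of the data. It is bypassed: on `S` the integrand is
`√g X³ / √γ` in adapted coordinates. -/
theorem Hypersurface.continuousOn_flux [MeasurableSpace M] [BorelSpace M]
    [ContMDiffSMul torusModel 𝓘(ℝ, E4) ∞ Torus M]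
    (hS : ∀ p ∈ S.carrier, ∃ e, S.IsAdapted e ∧ p ∈ e.source)
    (i : Fin 2) : ContinuousOn (fun p => D.K p (S.normal p) (generator i p)) S.carrier := by
  intro p hp
  obtain ⟨e, he, hpe⟩ := hS p hp
  obtain ⟨h1, h2⟩ := exists_sliceParam he.1 hpe hp
  have h3 : ContinuousAt (fun y => D.volDensity e (slice y) * D.fluxComp i e 3 (slice y)
      / D.sliceDensity e y) (frontL (e p)) := by
    refine ContinuousAt.div ?_ ((D.continuousOn_sliceDensity he.1.1).continuousAt
      ((isOpen_sliceDomain e).mem_nhds h1)) (he.flux_density h1 i).1.ne'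
    exact ((D.contDiffAt_volDensity he.1.1 h1).continuousAt.mul
      (D.contDiffAt_fluxComp he.1.1 h1 i 3).continuousAt).comp continuous_slice.continuousAt
  have h4 : ContinuousAt (fun q => frontL (e q)) p :=
    frontL.continuous.continuousAt.comp (e.continuousAt hpe)
  have h5 := ContinuousAt.comp (x := p) (f := fun q => frontL (e q)) h3 h4
  refine h5.continuousWithinAt.congr_of_eventuallyEq ?_ ?_
  · filter_upwards [nhdsWithin_le_nhds (e.open_source.mem_nhds hpe), self_mem_nhdsWithin]
      with q hq hqS
    obtain ⟨h6, h7⟩ := exists_sliceParam he.1 hq hqS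
    obtain ⟨h8, h9⟩ := he.flux_density h6 i
    rw [h7] at h9
    change _ = _ / _
    rw [eq_div_iff h8.ne', ← h9, mul_comm]
  · obtain ⟨h8, h9⟩ := he.flux_density h1 i
    rw [h2] at h9
    change _ = _ / _
    rw [eq_div_iff h8.ne', ← h9, mul_comm]

end Normal

/-! ### The flux identity in a chart -/

section LocalFlux

variable {M : Type*} [TopologicalSpace M] [ChartedSpace E4 M] [IsManifold 𝓘(ℝ, E4) ∞ M]
  [MulAction Torus M] [ContMDiffSMul torusModel 𝓘(ℝ, E4) ∞ Torus M]
  (D : InitialData M) {e : OpenPartialHomeomorph M E4} {x : E4} {φ : M → ℝ}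

/-- The density `√g φ X` in a chart. -/
def InitialData.cutoffFlux (i : Fin 2) (e : OpenPartialHomeomorph M E4) (φ : M → ℝ) (a : Fin 4) :
    E4 → ℝ :=
  e.target.indicator fun x => D.volDensity e x * D.fluxComp i e a x * φ (e.symm x)

theorem InitialData.cutoffFlux_of_mem (hx : x ∈ e.target) (i : Fin 2) (a : Fin 4) :
    D.cutoffFlux i e φ a x = D.volDensity e x * D.fluxComp i e a x * φ (e.symm x) :=
  Set.indicator_of_mem hx _

/-- The support of `φ` has compact, hence closed, image in the coordinates. So the extension by zero
vanishes near each point outside the target and is smooth there. -/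
theorem InitialData.cutoffFlux_eventuallyEq_zero [T2Space M] (hc : HasCompactSupport φ)
    (hs : tsupport φ ⊆ e.source) (hx : x ∉ e.target) (i : Fin 2) (a : Fin 4) :
    D.cutoffFlux i e φ a =ᶠ[𝓝 x] 0 := by
  have hK : IsCompact (e '' tsupport φ) := hc.isCompact.image_of_continuousOn
    (e.continuousOn.mono hs)
  have hxK : x ∉ e '' tsupport φ := by
    rintro ⟨q, hq, rfl⟩
    exact hx (e.map_source (hs hq))
  filter_upwards [hK.isClosed.isOpen_compl.mem_nhds hxK] with y hy
  by_cases hyt : y ∈ e.target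
  · rw [D.cutoffFlux_of_mem hyt, image_eq_zero_of_notMem_tsupport (f := φ), mul_zero]
    · rfl
    · exact fun h => hy ⟨_, h, e.right_inv hyt⟩
  · exact Set.indicator_of_notMem hyt _

theorem InitialData.hasCompactSupport_cutoffFlux [T2Space M] (hc : HasCompactSupport φ)
    (hs : tsupport φ ⊆ e.source) (i : Fin 2) (a : Fin 4) :
    HasCompactSupport (D.cutoffFlux i e φ a) := by
  refine HasCompactSupport.intro (hc.isCompact.image_of_continuousOn (e.continuousOn.mono hs))
    fun y hy => ?_
  by_cases hyt : y ∈ e.target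
  · rw [D.cutoffFlux_of_mem hyt, image_eq_zero_of_notMem_tsupport (f := φ), mul_zero]
    exact fun h => hy ⟨_, h, e.right_inv hyt⟩
  · exact Set.indicator_of_notMem hyt _

theorem contDiffAt_comp_symm (he : e ∈ IsManifold.maximalAtlas 𝓘(ℝ, E4) ∞ M)
    (hφ : ContMDiff 𝓘(ℝ, E4) 𝓘(ℝ, ℝ) ∞ φ) (hx : x ∈ e.target) :
    ContDiffAt ℝ ∞ (fun y => φ (e.symm y)) x :=
  contMDiffAt_iff_contDiffAt.1 (hφ.contMDiffAt.comp x (contMDiffAt_symm_of_mem_maximalAtlas he hx))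

theorem InitialData.contDiff_cutoffFlux [T2Space M]
    (he : e ∈ IsManifold.maximalAtlas 𝓘(ℝ, E4) ∞ M) (hφ : ContMDiff 𝓘(ℝ, E4) 𝓘(ℝ, ℝ) ∞ φ)
    (hc : HasCompactSupport φ) (hs : tsupport φ ⊆ e.source) (i : Fin 2) (a : Fin 4) :
    ContDiff ℝ 1 (D.cutoffFlux i e φ a) := by
  rw [contDiff_iff_contDiffAt]
  intro x
  by_cases hx : x ∈ e.target
  · have h1 : ContDiffAt ℝ ∞ (fun y => D.volDensity e y * D.fluxComp i e a y * φ (e.symm y)) x :=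
      ((D.contDiffAt_volDensity he hx).mul (D.contDiffAt_fluxComp he hx i a)).mul
        (contDiffAt_comp_symm he hφ hx)
    refine (h1.of_le (by simp)).congr_of_eventuallyEq ?_
    filter_upwards [e.open_target.mem_nhds hx] with y hy using D.cutoffFlux_of_mem hy i a
  · exact contDiffAt_const.congr_of_eventuallyEq (D.cutoffFlux_eventuallyEq_zero hc hs hx i a)

theorem InitialData.differential_flux (he : e ∈ IsManifold.maximalAtlas 𝓘(ℝ, E4) ∞ M)
    (hφ : ContMDiff 𝓘(ℝ, E4) 𝓘(ℝ, ℝ) ∞ φ) (hx : x ∈ e.target) (i : Fin 2) :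
    differential φ (e.symm x) (D.flux i (e.symm x))
      = ∑ a, D.fluxComp i e a x * pd a (fun y => φ (e.symm y)) x := by
  have h1 := hasFDerivAt_comp_symm he hx (hφ.mdifferentiableAt (x := e.symm x) (by simp))
  set v : E4 := WithLp.toLp 2 fun a => vecComp (D.flux i) e a x
  have h2 : D.flux i (e.symm x) = mfderiv 𝓘(ℝ, E4) 𝓘(ℝ, E4) e.symm x v :=
    (sum_vecComp he hx _).trans (mfderiv_symm_apply (e := e) (x := x) v).symm
  have h3 : fderiv ℝ (fun y => φ (e.symm y)) x v
      = ∑ a, D.fluxComp i e a x * pd a (fun y => φ (e.symm y)) x := by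
    conv_lhs => rw [E4_sum v, map_sum]
    refine Finset.sum_congr rfl fun a _ => ?_
    rw [map_smul, ← D.vecComp_flux he hx]
    rfl
  have h4 : fderiv ℝ (fun y => φ (e.symm y)) x = _ :=
    HasFDerivAt.fderiv (𝕜 := ℝ) (E := E4) (F := ℝ) h1
  rw [← h3, h4, h2]
  rfl

/-- `div(φX) = dφ(X) + φ div X`, and `div X = 0`. -/
theorem InitialData.sum_pd_cutoffFlux (he : e ∈ IsManifold.maximalAtlas 𝓘(ℝ, E4) ∞ M)
    (hφ : ContMDiff 𝓘(ℝ, E4) 𝓘(ℝ, ℝ) ∞ φ) (hx : x ∈ e.target) {i : Fin 2}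
    (hj : ∀ p : M, D.j p (generator i p) = 0) :
    ∑ a, pd a (D.cutoffFlux i e φ a) x
      = D.volDensity e x * differential φ (e.symm x) (D.flux i (e.symm x)) := by
  have h1 : ∀ a, pd a (D.cutoffFlux i e φ a) x
      = D.volDensity e x * D.fluxComp i e a x * pd a (fun y => φ (e.symm y)) x
        + φ (e.symm x) * pd a (fun y => D.volDensity e y * D.fluxComp i e a y) x := by
    intro a
    have h2 : D.cutoffFlux i e φ a
        =ᶠ[𝓝 x] fun y => D.volDensity e y * D.fluxComp i e a y * φ (e.symm y) := by
      filter_upwards [e.open_target.mem_nhds hx] with y hy using D.cutoffFlux_of_mem hy i a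
    have h3 : HasFDerivAt (fun y => D.volDensity e y * D.fluxComp i e a y) _ x :=
      (((D.contDiffAt_volDensity he hx).mul
        (D.contDiffAt_fluxComp he hx i a)).differentiableAt (by simp)).hasFDerivAt
    have h4 := ((contDiffAt_comp_symm he hφ hx).differentiableAt (by simp)).hasFDerivAt
    have h5 : HasFDerivAt (fun y => D.volDensity e y * D.fluxComp i e a y * φ (e.symm y)) _ x :=
      h3.mul h4
    rw [pd, h2.fderiv_eq, h5.fderiv]
    rfl
  simp only [h1, Finset.sum_add_distrib, ← Finset.mul_sum, D.div_flux he hx hj, mul_zero,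
    add_zero, D.differential_flux he hφ hx]
  rw [Finset.mul_sum]
  exact Finset.sum_congr rfl fun a _ => by ring

theorem InitialData.continuous_differential_flux (hφ : ContMDiff 𝓘(ℝ, E4) 𝓘(ℝ, ℝ) ∞ φ)
    (i : Fin 2) : Continuous fun p => differential φ p (D.flux i p) := by
  rw [continuous_iff_continuousAt]
  intro p
  set e := chartAt E4 p
  have he : e ∈ IsManifold.maximalAtlas 𝓘(ℝ, E4) ∞ M := IsManifold.chart_mem_maximalAtlas p
  have hp : p ∈ e.source := mem_chart_source E4 p
  have hx := e.map_source hp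
  have h1 : ContinuousAt (fun x => ∑ a, D.fluxComp i e a x * pd a (fun y => φ (e.symm y)) x)
      (e p) := by
    refine tendsto_finsetSum _ fun a _ => ?_
    have h2 : ContinuousAt (pd a fun y => φ (e.symm y)) (e p) :=
      (((contDiffAt_comp_symm he hφ hx).fderiv_right (m := 0) (by simp)).continuousAt).clm_apply
        continuousAt_const
    exact (D.contDiffAt_fluxComp he hx i a).continuousAt.mul h2
  have h2 := ContinuousAt.comp (x := p) (f := e) h1 (e.continuousAt hp)
  refine h2.congr ?_
  filter_upwards [e.open_source.mem_nhds hp] with q hq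
  have h3 := D.differential_flux he hφ (e.map_source hq) i
  rw [e.left_inv hq] at h3
  exact h3.symm

variable [T2Space M] [LocallyCompactSpace M] [MeasurableSpace M] [BorelSpace M]

/-- `H` describes `N` in the chart: a half space at the boundary and the whole space in the
interior. Since `φ` is supported in the chart, both integrals can be taken over the target. -/
theorem InitialData.setIntegral_differential_flux (he : e ∈ IsManifold.maximalAtlas 𝓘(ℝ, E4) ∞ M)
    (hφ : ContMDiff 𝓘(ℝ, E4) 𝓘(ℝ, ℝ) ∞ φ) (hc : HasCompactSupport φ) (hs : tsupport φ ⊆ e.source)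
    {i : Fin 2} (hj : ∀ p : M, D.j p (generator i p) = 0) {N : Set M} (hN : MeasurableSet N)
    {H : Set E4} (hH : MeasurableSet H) (hNH : ∀ q ∈ e.source, q ∈ N ↔ e q ∈ H) :
    ∫ p in N, differential φ p (D.flux i p) ∂D.volMeasure
      = ∫ x in H, ∑ a, pd a (D.cutoffFlux i e φ a) x := by
  classical
  have hcont := D.continuous_differential_flux hφ i
  set f : M → ℝ := fun p => differential φ p (D.flux i p)
  have hf0 : ∀ p, p ∉ e.source → N.indicator f p = 0 := by
    intro p hp
    have h1 : φ =ᶠ[𝓝 p] fun _ => 0 := by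
      have : p ∉ tsupport φ := fun h => hp (hs h)
      exact notMem_tsupport_iff_eventuallyEq.1 this
    have h2 : f p = 0 := by
      change mfderiv 𝓘(ℝ, E4) 𝓘(ℝ, ℝ) φ p (D.flux i p) = 0
      rw [h1.mfderiv_eq, mfderiv_const]
      rfl
    simp [h2]
  have hm : AEStronglyMeasurable (N.indicator f)
      (paramMeasure e.symm e.target (D.volDensity e)) :=
    (hcont.stronglyMeasurable.indicator hN).aestronglyMeasurable
  rw [← integral_indicator hN, ← setIntegral_eq_integral_of_forall_compl_eq_zero hf0,
    D.volMeasure_restrict he, integral_paramMeasure e.open_target e.continuousOn_symm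
      (D.continuousOn_volDensity he) (fun y hy => (D.volDensity_pos he hy).le) hm,
    ← integral_indicator hH]
  have h0 : ∀ x, x ∉ e.target →
      H.indicator (fun x => ∑ a, pd a (D.cutoffFlux i e φ a) x) x = 0 := by
    intro x hx
    have : ∑ a, pd a (D.cutoffFlux i e φ a) x = 0 := Finset.sum_eq_zero fun a _ => by
      rw [pd, (D.cutoffFlux_eventuallyEq_zero hc hs hx i a).fderiv_eq]
      simp
    rw [Set.indicator_apply, this, ite_self]
  refine Eq.trans ?_ (setIntegral_eq_integral_of_forall_compl_eq_zero h0)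
  refine setIntegral_congr_fun e.open_target.measurableSet fun x hx => ?_
  have h1 : e.symm x ∈ N ↔ x ∈ H := by
    rw [hNH _ (e.map_target hx), e.right_inv hx]
  simp only [Set.indicator_apply, h1]
  split_ifs with h
  · exact (D.sum_pd_cutoffFlux he hφ hx hj).symm
  · rw [mul_zero]

variable {S : Hypersurface D}

/-- The flux of `φ X` through the hypersurface. -/
def Hypersurface.fluxIntegral (S : Hypersurface D) (i : Fin 2) (φ : M → ℝ) : ℝ :=
  ∫ p, φ p * D.K p (S.normal p) (generator i p) ∂(surfaceMeasure D S.carrier)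

theorem Hypersurface.fluxIntegral_eq_zero (i : Fin 2) (h : ∀ p ∈ S.carrier, φ p = 0) :
    S.fluxIntegral D i φ = 0 := by
  refine integral_eq_zero_of_ae ?_
  have h1 : ∀ᵐ p ∂(surfaceMeasure D S.carrier), p ∈ S.carrier := by
    rw [ae_iff]
    exact surfaceMeasure_compl D S.isCompact.isClosed
  filter_upwards [h1] with p hp
  simp [h p hp]

/-- For `φ` supported in an adapted chart the surface integral is computed with density `√γ`, and
`flux_density` converts the integrand into the last component of the cut-off flux. -/
theorem Hypersurface.IsAdapted.fluxIntegral_eq (he : S.IsAdapted e)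
    (hS : ∀ p ∈ S.carrier, ∃ e, S.IsAdapted e ∧ p ∈ e.source)
    (hφ : Continuous φ) (hs : tsupport φ ⊆ e.source) (i : Fin 2) :
    S.fluxIntegral D i φ = ∫ y, D.cutoffFlux i e φ 3 (slice y) := by
  have hcl := S.isCompact.isClosed
  set f : M → ℝ := fun p => φ p * D.K p (S.normal p) (generator i p)
  have hf0 : ∀ p, p ∉ e.source → f p = 0 := fun p hp => by
    simp only [f]
    rw [image_eq_zero_of_notMem_tsupport fun h => hp (hs h), zero_mul]
  have hfc : ContinuousOn f S.carrier := hφ.continuousOn.mul (Hypersurface.continuousOn_flux hS i)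
  have hm : AEStronglyMeasurable f
      (paramMeasure (sliceParam e) (sliceDomain e) (D.sliceDensity e)) := by
    rw [← surfaceMeasure_restrict D he.1]
    have h1 : surfaceMeasure D S.carrier = (surfaceMeasure D S.carrier).restrict S.carrier :=
      (Measure.restrict_eq_self_of_ae_mem (by
        rw [ae_iff]; exact surfaceMeasure_compl D hcl)).symm
    rw [h1]
    exact (hfc.aestronglyMeasurable hcl.measurableSet).restrict
  rw [Hypersurface.fluxIntegral, ← setIntegral_eq_integral_of_forall_compl_eq_zero hf0,
    surfaceMeasure_restrict D he.1, integral_paramMeasure (isOpen_sliceDomain e)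
      (continuousOn_sliceParam e) (D.continuousOn_sliceDensity he.1.1)
      (fun y _ => Real.sqrt_nonneg _) hm]
  have h0 : ∀ y, y ∉ sliceDomain e → D.cutoffFlux i e φ 3 (slice y) = 0 := fun y hy =>
    Set.indicator_of_notMem (s := e.target) hy _
  refine Eq.trans ?_ (setIntegral_eq_integral_of_forall_compl_eq_zero h0)
  refine setIntegral_congr_fun (isOpen_sliceDomain e).measurableSet fun y hy => ?_
  rw [D.cutoffFlux_of_mem hy, ← (he.flux_density hy i).2]
  exact (mul_left_comm _ _ _).trans (mul_comm _ _)

end LocalFlux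

/-! ### Conservation of the flux -/

section Conservation

variable {M : Type*} [TopologicalSpace M] [ChartedSpace E4 M] [IsManifold 𝓘(ℝ, E4) ∞ M]
  [MulAction Torus M] {D : InitialData M} {S : Hypersurface D} {N O : Set M}

theorem differential_ne_zero {f : M → ℝ} {p : M} {w : TangentSpace 𝓘(ℝ, E4) p}
    (h : 0 < differential f p w) : differential f p ≠ 0 := fun h0 => by
  rw [h0] at h
  exact lt_irrefl _ h

theorem Hypersurface.isAdapted_of_eventually {e : OpenPartialHomeomorph M E4}
    (he : IsSliceChart S.carrier e)
    (h : ∀ q ∈ S.carrier, q ∈ e.source → ∃ (U : Set M) (f : M → ℝ), IsOpen U ∧ q ∈ U ∧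
      ContMDiffOn 𝓘(ℝ, E4) 𝓘(ℝ, ℝ) ∞ f U ∧ 0 < differential f q (S.normal q) ∧ f q = 0 ∧
      ∀ q' ∈ U, q' ∈ e.source → 0 < f q' → 0 ≤ e q' 3) : S.IsAdapted e := by
  refine ⟨he, fun x hx hx3 => ?_⟩
  have hq := e.map_target hx
  have hS : e.symm x ∈ S.carrier := (he.2 _ hq).2 (by rwa [e.right_inv hx])
  obtain ⟨U, f, hU, hqU, hf, hd, h0, hpos⟩ := h _ hS hq
  refine S.normalComp_pos he hx hx3
    ((hf.contMDiffAt (hU.mem_nhds hqU)).mdifferentiableAt (by simp)) h0 hd ?_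
  filter_upwards [hU.mem_nhds hqU, e.open_source.mem_nhds hq] with q' h1 h2 using hpos q' h1 h2

theorem Hypersurface.IsInward.exists_chart (h : S.IsInward N) (hO : IsOpen O) {p : M}
    (hp : p ∈ S.carrier) (hpO : p ∈ O) : ∃ e, S.IsAdapted e ∧ p ∈ e.source ∧ e.source ⊆ O ∧
      ∀ q ∈ e.source, q ∈ N ↔ 0 ≤ e q 3 := by
  obtain ⟨U, f, hU, hpU, hf, hd, hz, hN⟩ := h p hp
  obtain ⟨e, he, hpe, heU, hef⟩ := exists_chart_of_function (hU.inter hO) ⟨hpU, hpO⟩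
    (hf.mono Set.inter_subset_left) (differential_ne_zero hd)
  have hN' : ∀ q ∈ e.source, q ∈ N ↔ 0 ≤ e q 3 := fun q hq => by
    rw [hef q hq]; exact hN q (heU hq).1
  have hs : IsSliceChart S.carrier e := ⟨he, fun q hq => by
    rw [hef q hq]; exact hz q (heU hq).1⟩
  refine ⟨e, S.isAdapted_of_eventually hs fun q hq hqe => ?_, hpe, fun q hq => (heU hq).2, hN'⟩
  -- Positivity along the normal is known for `f` only at `p`. At another point `q` of `S` its own
  -- defining function `f'` is used: where `f' > 0` one is in `N`, so the last coordinate is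
  -- nonnegative.
  obtain ⟨U', f', hU', hq', hf', hd', hz', hN''⟩ := h q hq
  exact ⟨U', f', hU', hq', hf', hd', (hz' q hq').1 hq, fun q' h1 h2 h3 =>
    (hN' q' h2).1 ((hN'' q' h1).2 h3.le)⟩

theorem Hypersurface.IsOutward.exists_chart (h : S.IsOutward N) (hO : IsOpen O) {p : M}
    (hp : p ∈ S.carrier) (hpO : p ∈ O) : ∃ e, S.IsAdapted e ∧ p ∈ e.source ∧ e.source ⊆ O ∧
      ∀ q ∈ e.source, q ∈ N ↔ e q 3 ≤ 0 := by
  obtain ⟨U, f, hU, hpU, hf, hd, hz, hN⟩ := h p hp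
  obtain ⟨e, he, hpe, heU, hef⟩ := exists_chart_of_function (hU.inter hO) ⟨hpU, hpO⟩
    (hf.mono Set.inter_subset_left) (differential_ne_zero hd)
  have hN' : ∀ q ∈ e.source, q ∈ N ↔ e q 3 ≤ 0 := fun q hq => by
    rw [hef q hq]; exact hN q (heU hq).1
  have hs : IsSliceChart S.carrier e := ⟨he, fun q hq => by
    rw [hef q hq]; exact hz q (heU hq).1⟩
  refine ⟨e, S.isAdapted_of_eventually hs fun q hq hqe => ?_, hpe, fun q hq => (heU hq).2, hN'⟩
  -- As in the inward case, with the defining function at `q`: where `f' > 0` one is outside `N`, so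
  -- the last coordinate cannot be negative.
  obtain ⟨U', f', hU', hq', hf', hd', hz', hN''⟩ := h q hq
  refine ⟨U', f', hU', hq', hf', hd', (hz' q hq').1 hq, fun q' h1 h2 h3 => ?_⟩
  by_contra! hlt
  exact absurd ((hN'' q' h1).1 ((hN' q' h2).2 hlt.le)) (not_le.2 h3)

variable [ContMDiffSMul torusModel 𝓘(ℝ, E4) ∞ Torus M]
  [T2Space M] [LocallyCompactSpace M] [MeasurableSpace M] [BorelSpace M]

/-- The defect in the divergence theorem for `φ X` on the region `N`. -/
def fluxDefect (i : Fin 2) (N : Set M) (S₁ S₂ : Hypersurface D) (φ : M → ℝ) : ℝ :=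
  S₁.fluxIntegral D i φ - S₂.fluxIntegral D i φ
    + ∫ p in N, differential φ p (D.flux i p) ∂D.volMeasure

variable {i : Fin 2} {S₁ S₂ : Hypersurface D}

/-- The local divergence theorem. A point of `S₁` has a chart in which `N` is the upper half space,
a point of `S₂` one with the lower half space. Every other point of `N` is interior, since the
frontier is `S₁ ∪ S₂`. Each chart avoids the surfaces that do not pass through the point, so their
flux terms vanish. -/
theorem Bounds.exists_chart (hB : Bounds N S₁ S₂) (hj : ∀ p : M, D.j p (generator i p) = 0) {p : M}
    (hp : p ∈ N) : ∃ e : OpenPartialHomeomorph M E4, p ∈ e.source ∧ ∀ φ : M → ℝ,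
      ContMDiff 𝓘(ℝ, E4) 𝓘(ℝ, ℝ) ∞ φ → HasCompactSupport φ → tsupport φ ⊆ e.source →
      fluxDefect i N S₁ S₂ φ = 0 := by
  obtain ⟨hN, hfr, hdis, hin, hout⟩ := hB
  have hNm : MeasurableSet N := hN.isClosed.measurableSet
  have hz : ∀ {e : OpenPartialHomeomorph M E4} {φ : M → ℝ} {S : Set M}, tsupport φ ⊆ e.source →
      e.source ⊆ Sᶜ → ∀ q ∈ S, φ q = 0 := fun h1 h2 q hq =>
    image_eq_zero_of_notMem_tsupport fun h => h2 (h1 h) hq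
  have hA₁ : ∀ p ∈ S₁.carrier, ∃ e, S₁.IsAdapted e ∧ p ∈ e.source := fun p hp => by
    obtain ⟨e, h1, h2, -⟩ := hin.exists_chart isOpen_univ hp (Set.mem_univ p)
    exact ⟨e, h1, h2⟩
  have hA₂ : ∀ p ∈ S₂.carrier, ∃ e, S₂.IsAdapted e ∧ p ∈ e.source := fun p hp => by
    obtain ⟨e, h1, h2, -⟩ := hout.exists_chart isOpen_univ hp (Set.mem_univ p)
    exact ⟨e, h1, h2⟩
  by_cases h1 : p ∈ S₁.carrier
  · obtain ⟨e, he, hpe, heO, heN⟩ := hin.exists_chart S₂.isCompact.isClosed.isOpen_compl h1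
      (Set.disjoint_left.1 hdis h1)
    refine ⟨e, hpe, fun φ hφ hc hs => ?_⟩
    rw [fluxDefect, S₂.fluxIntegral_eq_zero D i (hz hs heO),
      he.fluxIntegral_eq D hA₁ hφ.continuous hs, D.setIntegral_differential_flux he.1.1 hφ hc hs hj
        hNm (measurableSet_le measurable_const (measurable_E4_apply 3)) heN,
      integral_div_upper (D.contDiff_cutoffFlux he.1.1 hφ hc hs i)
        (D.hasCompactSupport_cutoffFlux hc hs i)]
    ring
  by_cases h2 : p ∈ S₂.carrier
  · obtain ⟨e, he, hpe, heO, heN⟩ := hout.exists_chart S₁.isCompact.isClosed.isOpen_compl h2 h1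
    refine ⟨e, hpe, fun φ hφ hc hs => ?_⟩
    rw [fluxDefect, S₁.fluxIntegral_eq_zero D i (hz hs heO),
      he.fluxIntegral_eq D hA₂ hφ.continuous hs, D.setIntegral_differential_flux he.1.1 hφ hc hs hj
        hNm (measurableSet_le (measurable_E4_apply 3) measurable_const) heN,
      integral_div_lower (D.contDiff_cutoffFlux he.1.1 hφ hc hs i)
        (D.hasCompactSupport_cutoffFlux hc hs i)]
    ring
  · have hpi : p ∈ interior N := by
      by_contra hni
      have : p ∈ frontier N := ⟨subset_closure hp, hni⟩
      rw [hfr] at this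
      exact this.elim h1 h2
    have he : (chartAt E4 p).restr (interior N) ∈ IsManifold.maximalAtlas 𝓘(ℝ, E4) ∞ M :=
      restr_mem_maximalAtlas (contDiffGroupoid ∞ 𝓘(ℝ, E4)) (IsManifold.chart_mem_maximalAtlas p)
        isOpen_interior
    have hsrc := (chartAt E4 p).restr_source' _ (isOpen_interior (s := N))
    set e := (chartAt E4 p).restr (interior N)
    have hint : ∀ q ∈ e.source, q ∈ interior N := fun q hq => by
      rw [hsrc] at hq; exact hq.2
    have hne : ∀ q ∈ frontier N, q ∉ e.source := fun q hq hqe => hq.2 (hint q hqe)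
    rw [hfr] at hne
    refine ⟨e, by rw [hsrc]; exact ⟨mem_chart_source E4 p, hpi⟩, fun φ hφ hc hs => ?_⟩
    rw [fluxDefect, S₁.fluxIntegral_eq_zero D i (hz hs fun q hq hqS => hne q (Or.inl hqS) hq),
      S₂.fluxIntegral_eq_zero D i (hz hs fun q hq hqS => hne q (Or.inr hqS) hq),
      D.setIntegral_differential_flux he hφ hc hs hj hNm MeasurableSet.univ (fun q hq => by
        simp [interior_subset (hint q hq)]), setIntegral_univ,
      integral_div_univ (D.contDiff_cutoffFlux he hφ hc hs i)
        (D.hasCompactSupport_cutoffFlux hc hs i)]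
    ring

theorem Hypersurface.integrable_flux
    (hS : ∀ p ∈ S.carrier, ∃ e, S.IsAdapted e ∧ p ∈ e.source) {φ : M → ℝ} (hφ : Continuous φ) :
    Integrable (fun p => φ p * D.K p (S.normal p) (generator i p))
      (surfaceMeasure D S.carrier) := by
  have hcl := S.isCompact.isClosed
  have := surfaceMeasure_locallyFinite D hcl fun p hp => by
    obtain ⟨e, h1, h2⟩ := hS p hp
    exact ⟨e, h1.1, h2⟩
  have h1 : surfaceMeasure D S.carrier = (surfaceMeasure D S.carrier).restrict S.carrier :=
    (Measure.restrict_eq_self_of_ae_mem (by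
      rw [ae_iff]; exact surfaceMeasure_compl D hcl)).symm
  rw [h1]
  exact (hφ.continuousOn.mul (Hypersurface.continuousOn_flux hS i)).integrableOn_compact S.isCompact

/-- Additivity needs integrability of all three terms, which follows from continuity on compact sets
and local finiteness of the measures. -/
theorem Bounds.fluxDefect_add (hB : Bounds N S₁ S₂) {φ ψ : M → ℝ}
    (hφ : ContMDiff 𝓘(ℝ, E4) 𝓘(ℝ, ℝ) ∞ φ) (hψ : ContMDiff 𝓘(ℝ, E4) 𝓘(ℝ, ℝ) ∞ ψ) :
    fluxDefect i N S₁ S₂ (fun p => φ p + ψ p)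
      = fluxDefect i N S₁ S₂ φ + fluxDefect i N S₁ S₂ ψ := by
  obtain ⟨hN, hfr, hdis, hin, hout⟩ := hB
  have hA₁ : ∀ p ∈ S₁.carrier, ∃ e, S₁.IsAdapted e ∧ p ∈ e.source := fun p hp => by
    obtain ⟨e, h1, h2, -⟩ := hin.exists_chart isOpen_univ hp (Set.mem_univ p)
    exact ⟨e, h1, h2⟩
  have hA₂ : ∀ p ∈ S₂.carrier, ∃ e, S₂.IsAdapted e ∧ p ∈ e.source := fun p hp => by
    obtain ⟨e, h1, h2, -⟩ := hout.exists_chart isOpen_univ hp (Set.mem_univ p)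
    exact ⟨e, h1, h2⟩
  have := D.volMeasure_locallyFinite
  have hd : ∀ p, differential (fun p => φ p + ψ p) p (D.flux i p)
      = differential φ p (D.flux i p) + differential ψ p (D.flux i p) := by
    intro p
    have h1 : HasMFDerivAt 𝓘(ℝ, E4) 𝓘(ℝ, ℝ) (fun p => φ p + ψ p) p _ :=
      (hφ.mdifferentiableAt (x := p) (by simp)).hasMFDerivAt.add
        (hψ.mdifferentiableAt (x := p) (by simp)).hasMFDerivAt
    rw [differential, h1.mfderiv]
    rfl
  simp only [fluxDefect, Hypersurface.fluxIntegral, add_mul, hd]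
  rw [integral_add (Hypersurface.integrable_flux hA₁ hφ.continuous)
      (Hypersurface.integrable_flux hA₁ hψ.continuous),
    integral_add (Hypersurface.integrable_flux hA₂ hφ.continuous)
      (Hypersurface.integrable_flux hA₂ hψ.continuous),
    integral_add
      ((D.continuous_differential_flux hφ i).continuousOn.integrableOn_compact hN)
      ((D.continuous_differential_flux hψ i).continuousOn.integrableOn_compact hN)]
  ring

theorem fluxDefect_const (c : ℝ) : fluxDefect i N S₁ S₂ (fun _ => c)
    = S₁.fluxIntegral D i (fun _ => c) - S₂.fluxIntegral D i (fun _ => c) := by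
  have h : ∀ p, differential (fun _ : M => c) p (D.flux i p) = 0 := fun p => by
    rw [differential, mfderiv_const]
    rfl
  simp [fluxDefect, h]

theorem Bounds.fluxDefect_sum (hB : Bounds N S₁ S₂) {ι : Type*} (s : Finset ι) {f : ι → M → ℝ}
    (hf : ∀ k, ContMDiff 𝓘(ℝ, E4) 𝓘(ℝ, ℝ) ∞ (f k)) :
    fluxDefect i N S₁ S₂ (fun p => ∑ k ∈ s, f k p) = ∑ k ∈ s, fluxDefect i N S₁ S₂ (f k) := by
  classical
  induction s using Finset.induction_on with
  | empty =>
    simp only [Finset.sum_empty, fluxDefect_const]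
    simp [Hypersurface.fluxIntegral]
  | insert k s hk ih =>
    simp only [Finset.sum_insert hk]
    rw [hB.fluxDefect_add (hf k) (ContMDiff.sum fun k _ => hf k), ih]

theorem Bounds.fluxDefect_of_disjoint (hB : Bounds N S₁ S₂) {φ : M → ℝ} (h : tsupport φ ⊆ Nᶜ) :
    fluxDefect i N S₁ S₂ φ = 0 := by
  obtain ⟨hN, hfr, -⟩ := hB
  have hsub : S₁.carrier ∪ S₂.carrier ⊆ N := by
    rw [← hfr]; exact hN.isClosed.frontier_subset
  have h0 : ∀ p ∈ N, φ p = 0 := fun p hp => image_eq_zero_of_notMem_tsupport fun hs => h hs hp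
  have hd : ∀ p ∈ N, differential φ p (D.flux i p) = 0 := by
    intro p hp
    have h1 : φ =ᶠ[𝓝 p] fun _ => 0 :=
      notMem_tsupport_iff_eventuallyEq.1 fun hs => h hs hp
    rw [differential, h1.mfderiv_eq, mfderiv_const]
    rfl
  rw [fluxDefect, S₁.fluxIntegral_eq_zero D i fun p hp => h0 p (hsub (Or.inl hp)),
    S₂.fluxIntegral_eq_zero D i fun p hp => h0 p (hsub (Or.inr hp)),
    setIntegral_congr_fun hN.isClosed.measurableSet hd]
  simp

/-- Conservation of the angular momentum. -/
theorem Bounds.angularMomentum_eq [SigmaCompactSpace M] (hB : Bounds N S₁ S₂)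
    (hj : ∀ p : M, D.j p (generator i p) = 0) :
    angularMomentum i S₁ = angularMomentum i S₂ := by
  -- For the constant `1` the volume term drops out, and the defect is `8π` times the difference of
  -- the angular momenta.
  have key : fluxDefect i N S₁ S₂ (fun _ => 1) = 0 := by
    choose e hpe hφ using fun (p : M) (hp : p ∈ N) => hB.exists_chart hj hp
    -- Compact neighbourhoods inside the charts ensure that the functions of the partition have
    -- compact support there.
    have hC : ∀ (p : M) (hp : p ∈ N), ∃ C ∈ 𝓝 p, C ⊆ (e p hp).source ∧ IsCompact C := fun p hp =>
      local_compact_nhds ((e p hp).open_source.mem_nhds (hpe p hp))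
    choose C hCn hCe hCc using hC
    obtain ⟨t, ht⟩ := hB.1.elim_nhds_subcover' (fun p hp => interior (C p hp))
      fun p hp => interior_mem_nhds.2 (hCn p hp)
    -- The index `none` stands for the complement of `N`, where the defect is trivially zero; the
    -- others are the finitely many chart pieces covering `N`.
    set V : Option t → Set M := fun k => k.elim Nᶜ fun q => interior (C q.1.1 q.1.2)
    obtain ⟨ρ, hρ⟩ := SmoothPartitionOfUnity.exists_isSubordinate 𝓘(ℝ, E4) (s := Set.univ)
      isClosed_univ V (by
        rintro (_ | q)
        · exact hB.1.isClosed.isOpen_compl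
        · exact isOpen_interior) (by
        intro p _
        by_cases hp : p ∈ N
        · obtain ⟨q, hq, hpq⟩ := Set.mem_iUnion₂.1 (ht hp)
          exact Set.mem_iUnion.2 ⟨some ⟨q, hq⟩, hpq⟩
        · exact Set.mem_iUnion.2 ⟨none, hp⟩)
    have h1 : (fun _ : M => (1 : ℝ)) = fun p => ∑ k, ρ k p := by
      funext p
      rw [← ρ.sum_eq_one (Set.mem_univ p), finsum_eq_sum_of_fintype]
    rw [h1, hB.fluxDefect_sum _ fun k => (ρ k).contMDiff]
    refine Finset.sum_eq_zero fun k _ => ?_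
    rcases k with _ | q
    · exact hB.fluxDefect_of_disjoint (hρ none)
    · have h2 : tsupport (ρ (some q)) ⊆ C q.1.1 q.1.2 := (hρ (some q)).trans interior_subset
      exact hφ q.1.1 q.1.2 _ (ρ (some q)).contMDiff
        ((hCc _ _).of_isClosed_subset (isClosed_tsupport _) h2) (h2.trans (hCe _ _))
  rw [fluxDefect_const, sub_eq_zero] at key
  simp only [Hypersurface.fluxIntegral, one_mul] at key
  rw [angularMomentum, angularMomentum, key]

end Conservation

/-! ### Coordinate spheres in an end -/

section Ends

variable {M : Type*} [TopologicalSpace M] [ChartedSpace E4 M] [IsManifold 𝓘(ℝ, E4) ∞ M]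

/-- The domain of the coordinates of an end. -/
def EndChart.domain (F : EndChart M) : Set E4 := {x | F.R < ‖x‖}

theorem EndChart.isOpen_domain (F : EndChart M) : IsOpen F.domain :=
  isOpen_lt continuous_const continuous_norm

theorem EndChart.contMDiffAt (F : EndChart M) {x : E4} (hx : x ∈ F.domain) :
    ContMDiffAt 𝓘(ℝ, E4) 𝓘(ℝ, E4) ∞ F.toFun x :=
  F.smooth.contMDiffAt (F.isOpen_domain.mem_nhds hx)

theorem EndChart.local_coord (F : EndChart M) {e : OpenPartialHomeomorph M E4}
    (he : e ∈ IsManifold.maximalAtlas 𝓘(ℝ, E4) ∞ M) {x : E4} (hx : x ∈ F.domain)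
    (hxe : F.toFun x ∈ e.source) : ContDiffAt ℝ ∞ (e ∘ F.toFun) x ∧
      Function.Injective (fderiv ℝ (e ∘ F.toFun) x) := by
  refine ⟨contMDiffAt_iff_contDiffAt.1
    ((contMDiffAt_of_mem_maximalAtlas he hxe).comp x (F.contMDiffAt hx)), ?_⟩
  have h1 := mfderiv_comp x
    ((mdifferentiable_of_mem_maximalAtlas he).mdifferentiableAt hxe)
    ((F.contMDiffAt hx).mdifferentiableAt (by simp))
  have h2 : Function.Injective (mfderiv 𝓘(ℝ, E4) 𝓘(ℝ, E4) e (F.toFun x)) := by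
    have h3 := mfderiv_symm_mfderiv he (e.map_source hxe)
    rw [e.left_inv hxe] at h3
    exact Function.LeftInverse.injective h3
  rw [← mfderiv_eq_fderiv, h1]
  exact h2.comp (F.immersion x hx)

/-- The inverse function theorem in a chart around the image point. It makes the end coordinates an
open map, so their inverse is continuous. -/
theorem EndChart.map_nhds_eq (F : EndChart M) {x : E4} (hx : x ∈ F.domain) :
    Filter.map F.toFun (𝓝 x) = 𝓝 (F.toFun x) := by
  set e := chartAt E4 (F.toFun x)
  have he : e ∈ IsManifold.maximalAtlas 𝓘(ℝ, E4) ∞ M := IsManifold.chart_mem_maximalAtlas _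
  have hxe : F.toFun x ∈ e.source := mem_chart_source E4 _
  obtain ⟨h1, h2⟩ := F.local_coord he hx hxe
  obtain ⟨L, hL⟩ := exists_equiv_of_injective h2
  have h3 : HasStrictFDerivAt (e ∘ F.toFun) (L : E4 →L[ℝ] E4) x := by
    rw [hL]
    exact h1.hasStrictFDerivAt (by simp)
  have h4 := h3.map_nhds_eq_of_equiv
  have h5 : F.toFun =ᶠ[𝓝 x] e.symm ∘ (e ∘ F.toFun) := by
    filter_upwards [(F.contMDiffAt hx).continuousAt.eventually (e.open_source.mem_nhds hxe)]
      with y hy using (e.left_inv hy).symm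
  rw [Filter.map_congr h5, ← Filter.map_map, h4, Function.comp_apply]
  have h6 := e.symm.map_nhds_eq (x := e (F.toFun x)) (e.map_source hxe)
  rwa [e.left_inv hxe] at h6

theorem EndChart.isOpenMap_domRestrict (F : EndChart M) :
    IsOpenMap (F.domain.domRestrict F.toFun) := by
  rw [isOpenMap_iff_nhds_le]
  rintro ⟨x, hx⟩
  have h1 : Filter.map (F.domain.domRestrict F.toFun) (𝓝 ⟨x, hx⟩)
      = Filter.map F.toFun (𝓝 x) := by
    rw [← F.isOpen_domain.nhdsWithin_eq hx, nhdsWithin_eq_map_subtype_coe hx, Filter.map_map]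
    rfl
  exact (h1.trans (F.map_nhds_eq hx)).ge

/-- The coordinates of an end as a chart. -/
def EndChart.chart (F : EndChart M) : OpenPartialHomeomorph M E4 :=
  (OpenPartialHomeomorph.ofContinuousOpenRestrict (F.injOn.toPartialEquiv F.toFun F.domain)
    F.smooth.continuousOn F.isOpenMap_domRestrict F.isOpen_domain).symm

variable (F : EndChart M)

theorem EndChart.mem_chart_source {x : E4} (hx : x ∈ F.domain) : F.toFun x ∈ F.chart.source :=
  F.chart.map_target hx

theorem EndChart.chart_apply {x : E4} (hx : x ∈ F.domain) : F.chart (F.toFun x) = x :=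
  F.chart.right_inv hx

theorem EndChart.chart_mem_maximalAtlas :
    F.chart ∈ IsManifold.maximalAtlas 𝓘(ℝ, E4) ∞ M := by
  rw [IsManifold.mem_maximalAtlas_iff, mem_maximalAtlas_iff]
  intro e' he'
  have he : e' ∈ IsManifold.maximalAtlas 𝓘(ℝ, E4) ∞ M := IsManifold.subset_maximalAtlas he'
  have h1 : F.chart.symm ≫ₕ e' ∈ contDiffGroupoid ∞ 𝓘(ℝ, E4) := by
    have h2 : ∀ x ∈ (F.chart.symm ≫ₕ e').source, x ∈ F.domain ∧ F.toFun x ∈ e'.source := by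
      intro x hx
      rwa [OpenPartialHomeomorph.trans_source] at hx
    exact mem_contDiffGroupoid_of_injective
      (fun x hx => (F.local_coord he (h2 x hx).1 (h2 x hx).2).1.contDiffWithinAt)
      fun x hx => (F.local_coord he (h2 x hx).1 (h2 x hx).2).2
  refine ⟨h1, ?_⟩
  have h2 := StructureGroupoid.symm _ h1
  rwa [OpenPartialHomeomorph.trans_symm_eq_symm_trans_symm, F.chart.symm_symm] at h2

/-- The function `|x|² - r²` in an end. -/
def EndChart.radial (r : ℝ) (q : M) : ℝ := ‖F.chart q‖ ^ 2 - r ^ 2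

theorem EndChart.contMDiffOn_radial (r : ℝ) :
    ContMDiffOn 𝓘(ℝ, E4) 𝓘(ℝ, ℝ) ∞ (F.radial r) F.chart.source := by
  have h1 : ContDiff ℝ ∞ fun x : E4 => ‖x‖ ^ 2 - r ^ 2 := (contDiff_norm_sq ℝ).sub contDiff_const
  exact h1.contMDiff.comp_contMDiffOn (contMDiffOn_of_mem_maximalAtlas F.chart_mem_maximalAtlas)

/-- Euler's identity for the homogeneous function `|x|²` in the radial direction. -/
theorem EndChart.differential_radial (r : ℝ) {x : E4} (hx : x ∈ F.domain) :
    differential (F.radial r) (F.toFun x) (mfderiv 𝓘(ℝ, E4) 𝓘(ℝ, E4) F.toFun x x)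
      = 2 * ‖x‖ ^ 2 := by
  have h1 : MDifferentiableAt 𝓘(ℝ, E4) 𝓘(ℝ, ℝ) (F.radial r) (F.chart.symm x) :=
    ((F.contMDiffOn_radial r).contMDiffAt (F.chart.open_source.mem_nhds
      (F.mem_chart_source hx))).mdifferentiableAt (by simp)
  have h2 := hasFDerivAt_comp_symm F.chart_mem_maximalAtlas (x := x) hx h1
  have h3 : HasFDerivAt (fun y => F.radial r (F.chart.symm y)) ((2 : ℕ) • innerSL ℝ x) x := by
    refine ((hasStrictFDerivAt_norm_sq x).hasFDerivAt.sub_const (r ^ 2)).congr_of_eventuallyEq ?_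
    filter_upwards [F.isOpen_domain.mem_nhds hx] with y hy
    change ‖F.chart (F.toFun y)‖ ^ 2 - r ^ 2 = _
    rw [F.chart_apply hy]
  have h4 := congrArg (fun L : E4 →L[ℝ] ℝ => L x) 
    (HasFDerivAt.unique (𝕜 := ℝ) (E := E4) (F := ℝ) h2 h3)
  refine Eq.trans h4 ?_
  simp

variable [MulAction Torus M] {D : InitialData M}

/-- At `p` both `df` and `h(n, ·)` are multiples of the same covector. If both are positive on one
vector `w`, the factor between them is positive, and `df(n)` has the sign of `h(n, n) = 1`. -/
theorem Hypersurface.differential_normal_pos (S : Hypersurface D) {U : Set M} {f : M → ℝ} {p : M}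
    (hU : IsOpen U) (hp : p ∈ U) (hf : ContMDiffOn 𝓘(ℝ, E4) 𝓘(ℝ, ℝ) ∞ f U)
    (hz : ∀ q ∈ U, q ∈ S.carrier ↔ f q = 0) (hS : p ∈ S.carrier) {w : TangentSpace 𝓘(ℝ, E4) p}
    (hw : 0 < D.h.inner p (S.normal p) w) (hd : 0 < differential f p w) :
    0 < differential f p (S.normal p) := by
  obtain ⟨e, he, hpe, heU, hef⟩ := exists_chart_of_function hU hp hf (differential_ne_zero hd)
  have hs : IsSliceChart S.carrier e := ⟨he, fun q hq => by rw [hef q hq]; exact hz q (heU hq)⟩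
  have hdf : ∀ u : TangentSpace 𝓘(ℝ, E4) p, differential f p u
      = (show E4 from mfderiv 𝓘(ℝ, E4) 𝓘(ℝ, E4) e p u) 3 := by
    intro u
    have h1 : f =ᶠ[𝓝 p] (EuclideanSpace.proj 3 : E4 →L[ℝ] ℝ) ∘ e := by
      filter_upwards [e.open_source.mem_nhds hpe] with q hq using (hef q hq).symm
    have h2 := mfderiv_comp p
      ((EuclideanSpace.proj 3 : E4 →L[ℝ] ℝ).differentiableAt (x := e p)).mdifferentiableAt
      ((mdifferentiable_of_mem_maximalAtlas he).mdifferentiableAt hpe)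
    rw [differential, h1.mfderiv_eq, h2, mfderiv_eq_fderiv, ContinuousLinearMap.fderiv]
    rfl
  have hx := e.map_source hpe
  obtain ⟨l, hl, hn⟩ := S.inner_normal hs hx ((hs.2 p hpe).1 hS)
  have hinv := mfderiv_symm_mfderiv he hx
  rw [Hypersurface.normalComp, vecComp] at hl
  rw [e.left_inv hpe] at hl hn hinv
  have h1 := hn (mfderiv 𝓘(ℝ, E4) 𝓘(ℝ, E4) e p w)
  rw [hinv w] at h1
  have h2 : D.h.inner p (S.normal p) w = l * differential f p w := by
    rw [hdf w]; exact h1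
  have h3 : l * differential f p (S.normal p) = 1 := by
    rw [hdf]; exact hl
  have hl0 : 0 < l := by
    rw [h2] at hw
    exact pos_of_mul_pos_left hw hd.le
  exact pos_of_mul_pos_right (by rw [h3]; exact one_pos) hl0.le

variable {F} {S S₁ S₂ : Hypersurface D} {r r₁ r₂ : ℝ}

theorem Hypersurface.IsCoordSphere.mem_iff (hS : S.IsCoordSphere F r) (hr : F.R < r) {q : M}
    (hq : q ∈ F.chart.source) : q ∈ S.carrier ↔ F.radial r q = 0 := by
  obtain ⟨x, hx, rfl⟩ : ∃ x ∈ F.domain, F.toFun x = q := hq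
  rw [hS.1, EndChart.radial, F.chart_apply hx, sub_eq_zero,
    sq_eq_sq₀ (norm_nonneg x) (F.R_pos.trans hr).le]
  constructor
  · rintro ⟨y, hy, hxy⟩
    have hy' : y ∈ F.domain := by
      change F.R < ‖y‖
      rw [show ‖y‖ = r from hy]
      exact hr
    rw [← F.injOn hy' hx hxy]
    exact hy
  · exact fun h => ⟨x, h, rfl⟩

theorem Hypersurface.IsCoordSphere.differential_pos (hS : S.IsCoordSphere F r) (hr : F.R < r)
    {p : M} (hp : p ∈ S.carrier) :
    p ∈ F.chart.source ∧ 0 < differential (F.radial r) p (S.normal p) := by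
  have hp' := hp
  rw [hS.1] at hp'
  obtain ⟨x, hx, rfl⟩ := hp'
  have hxr : ‖x‖ = r := hx
  have hxd : x ∈ F.domain := by
    change F.R < ‖x‖
    rw [hxr]; exact hr
  refine ⟨F.mem_chart_source hxd, S.differential_normal_pos F.chart.open_source
    (F.mem_chart_source hxd) (F.contMDiffOn_radial r) (fun q hq => hS.mem_iff hr hq) hp
    (hS.2 x hxr) ?_⟩
  rw [F.differential_radial r hxd, hxr]
  have := F.R_pos.trans hr
  positivity

/-- The image of a closed annulus. -/
def EndChart.annulus (F : EndChart M) (r₁ r₂ : ℝ) : Set M :=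
  F.toFun '' {x | r₁ ≤ ‖x‖ ∧ ‖x‖ ≤ r₂}

theorem EndChart.mem_annulus_iff (hr : F.R < r₁) {x : E4} (hx : x ∈ F.domain) :
    F.toFun x ∈ F.annulus r₁ r₂ ↔ r₁ ≤ ‖x‖ ∧ ‖x‖ ≤ r₂ := by
  constructor
  · rintro ⟨y, hy, hxy⟩
    rw [← F.injOn (lt_of_lt_of_le hr hy.1) hx hxy]
    exact hy
  · exact fun h => ⟨x, h, rfl⟩

theorem EndChart.isCompact_annulus (hr : F.R < r₁) : IsCompact (F.annulus r₁ r₂) := by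
  have h1 : IsCompact {x : E4 | r₁ ≤ ‖x‖ ∧ ‖x‖ ≤ r₂} := by
    have h2 := (isCompact_closedBall (0 : E4) r₂).inter_right
      (isClosed_le (continuous_const (y := r₁)) (continuous_norm (E := E4)))
    refine h2.of_isClosed_subset ?_ fun x hx => ⟨by simpa using hx.2, hx.1⟩
    exact (isClosed_le continuous_const continuous_norm).inter
      (isClosed_le continuous_norm continuous_const)
  exact h1.image_of_continuousOn (F.smooth.continuousOn.mono fun x hx => lt_of_lt_of_le hr hx.1)

variable [T2Space M]

theorem EndChart.frontier_annulus (hr : F.R < r₁) (h12 : r₁ < r₂) :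
    frontier (F.annulus r₁ r₂) = F.toFun '' {x | ‖x‖ = r₁} ∪ F.toFun '' {x | ‖x‖ = r₂} := by
  have hcl : IsClosed (F.annulus r₁ r₂) := (F.isCompact_annulus hr).isClosed
  have h0 := F.R_pos
  -- points with a radius at the ends are not interior
  have hscale : ∀ x ∈ F.domain, F.toFun x ∈ interior (F.annulus r₁ r₂) →
      ∀ᶠ t : ℝ in 𝓝 1, r₁ ≤ |t| * ‖x‖ ∧ |t| * ‖x‖ ≤ r₂ := by
    intro x hx hi
    have h1 : ∀ᶠ y in 𝓝 x, y ∈ F.domain ∧ F.toFun y ∈ F.annulus r₁ r₂ :=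
      (F.isOpen_domain.mem_nhds hx |> Filter.eventually_mem_set.2).and
        ((F.contMDiffAt hx).continuousAt.eventually (mem_interior_iff_mem_nhds.1 hi))
    have h2 : Filter.Tendsto (fun t : ℝ => t • x) (𝓝 1) (𝓝 x) := by
      have : Continuous fun t : ℝ => t • x := by fun_prop
      have h := this.tendsto 1
      rwa [one_smul] at h
    filter_upwards [h2.eventually h1] with t ht
    have h3 := (F.mem_annulus_iff hr ht.1).1 ht.2
    rwa [norm_smul, Real.norm_eq_abs] at h3
  rw [hcl.frontier_eq]
  ext q
  constructor
  · rintro ⟨⟨x, hx, rfl⟩, hni⟩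
    by_contra hne
    apply hni
    have hx1 : ‖x‖ ≠ r₁ := fun h => hne (Or.inl ⟨x, h, rfl⟩)
    have hx2 : ‖x‖ ≠ r₂ := fun h => hne (Or.inr ⟨x, h, rfl⟩)
    have hxd : x ∈ F.domain := lt_of_lt_of_le hr hx.1
    rw [mem_interior_iff_mem_nhds, ← F.map_nhds_eq hxd, Filter.mem_map]
    have hO : IsOpen {y : E4 | r₁ < ‖y‖ ∧ ‖y‖ < r₂} :=
      (isOpen_lt continuous_const continuous_norm).inter
        (isOpen_lt continuous_norm continuous_const)
    filter_upwards [hO.mem_nhds ⟨lt_of_le_of_ne hx.1 hx1.symm, lt_of_le_of_ne hx.2 hx2⟩] with y hy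
    exact ⟨y, ⟨hy.1.le, hy.2.le⟩, rfl⟩
  · rintro (⟨x, hx, rfl⟩ | ⟨x, hx, rfl⟩)
    · have hxr : ‖x‖ = r₁ := hx
      refine ⟨⟨x, ⟨hxr.ge, hxr.le.trans h12.le⟩, rfl⟩, fun hi => ?_⟩
      have h1 := (hscale x (by change F.R < ‖x‖; rw [hxr]; exact hr) hi).filter_mono
        (nhdsWithin_le_nhds (s := Set.Iio (1 : ℝ)))
      have h2 : ∀ᶠ t : ℝ in 𝓝[<] 1, 0 < t :=
        (lt_mem_nhds (zero_lt_one (α := ℝ))).filter_mono nhdsWithin_le_nhds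
      obtain ⟨t, ⟨ht1, ht2⟩, ht3⟩ := ((h1.and h2).and self_mem_nhdsWithin).exists
      have ht4 : t < 1 := ht3
      rw [hxr, abs_of_pos ht2] at ht1
      nlinarith [ht1.1]
    · have hxr : ‖x‖ = r₂ := hx
      refine ⟨⟨x, ⟨h12.le.trans hxr.ge, hxr.le⟩, rfl⟩, fun hi => ?_⟩
      have h1 := (hscale x (by change F.R < ‖x‖; rw [hxr]; exact hr.trans h12) hi).filter_mono
        (nhdsWithin_le_nhds (s := Set.Ioi (1 : ℝ)))
      obtain ⟨t, ht1, ht3⟩ := (h1.and self_mem_nhdsWithin).exists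
      have ht4 : 1 < t := ht3
      rw [hxr, abs_of_pos (zero_lt_one.trans ht4)] at ht1
      nlinarith [ht1.2]

/-- Coordinate spheres bound annuli. -/
theorem Hypersurface.IsCoordSphere.bounds (h₁ : S₁.IsCoordSphere F r₁)
    (h₂ : S₂.IsCoordSphere F r₂) (hr : F.R < r₁) (h12 : r₁ < r₂) :
    Bounds (F.annulus r₁ r₂) S₁ S₂ := by
  have h0 := F.R_pos.trans hr
  have hr2 := hr.trans h12
  refine ⟨F.isCompact_annulus hr, ?_, ?_, ?_, ?_⟩
  · rw [F.frontier_annulus hr h12, h₁.1, h₂.1]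
  · rw [Set.disjoint_left]
    intro p hp hp2
    have hps := (h₁.differential_pos hr hp).1
    have k1 := (h₁.mem_iff hr hps).1 hp
    have k2 := (h₂.mem_iff hr2 hps).1 hp2
    rw [EndChart.radial] at k1 k2
    nlinarith
  · intro p hp
    obtain ⟨hps, hd⟩ := h₁.differential_pos hr hp
    have hp0 := (h₁.mem_iff hr hps).1 hp
    -- Within `|x| < r₂` the annulus is given by the single inequality `r₁ ≤ |x|`, that is, by the
    -- sign of `radial r₁`.
    refine ⟨F.chart.source ∩ F.chart ⁻¹' {x | ‖x‖ < r₂}, F.radial r₁,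
      F.chart.isOpen_inter_preimage (isOpen_lt continuous_norm continuous_const), ⟨hps, ?_⟩,
      (F.contMDiffOn_radial r₁).mono Set.inter_subset_left, hd,
      fun q hq => h₁.mem_iff hr hq.1, ?_⟩
    · change ‖F.chart p‖ < r₂
      rw [EndChart.radial, sub_eq_zero, sq_eq_sq₀ (norm_nonneg _) h0.le] at hp0
      rw [hp0]; exact h12
    · rintro q ⟨⟨x, hx, rfl⟩, hq⟩
      have hx : x ∈ F.domain := hx
      change ‖F.chart (F.toFun x)‖ < r₂ at hq
      change F.toFun x ∈ _ ↔ _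
      rw [F.chart_apply hx] at hq
      rw [F.mem_annulus_iff hr hx, EndChart.radial, F.chart_apply hx, sub_nonneg,
        sq_le_sq₀ h0.le (norm_nonneg x)]
      exact ⟨fun h => h.1, fun h => ⟨h, hq.le⟩⟩
  · intro p hp
    obtain ⟨hps, hd⟩ := h₂.differential_pos hr2 hp
    have hp0 := (h₂.mem_iff hr2 hps).1 hp
    -- Likewise, within `|x| > r₁` only the inequality `|x| ≤ r₂` matters.
    refine ⟨F.chart.source ∩ F.chart ⁻¹' {x | r₁ < ‖x‖}, F.radial r₂,
      F.chart.isOpen_inter_preimage (isOpen_lt continuous_const continuous_norm), ⟨hps, ?_⟩,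
      (F.contMDiffOn_radial r₂).mono Set.inter_subset_left, hd,
      fun q hq => h₂.mem_iff hr2 hq.1, ?_⟩
    · change r₁ < ‖F.chart p‖
      rw [EndChart.radial, sub_eq_zero, sq_eq_sq₀ (norm_nonneg _) (h0.trans h12).le] at hp0
      rw [hp0]; exact h12
    · rintro q ⟨⟨x, hx, rfl⟩, hq⟩
      have hx : x ∈ F.domain := hx
      change r₁ < ‖F.chart (F.toFun x)‖ at hq
      change F.toFun x ∈ _ ↔ _
      rw [F.chart_apply hx] at hq
      rw [F.mem_annulus_iff hr hx, EndChart.radial, F.chart_apply hx, sub_nonpos,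
        sq_le_sq₀ (norm_nonneg x) (h0.trans h12).le]
      exact ⟨fun h => h.2, fun h => ⟨hq.le, h⟩⟩

end Ends

end TorusData

end

/-- Let `M` be a simply connected four-manifold with a smooth `U(1)²`-action, and `D` maximal
`U(1)²`-invariant initial data on it with `ι_{ξ_(i)} j = 0`. Then `J_(i)` takes the same value on
any two invariant hypersurfaces that bound a compact region; in every end the limit that
defines the ADM angular momentum exists and equals `J_(i)(S)` for every invariant hypersurface `S`
that bounds a region together with a coordinate sphere; and the twist potential `Y^(i)` exists
globally. -/
theorem mainTheorem3 {M : Type*} [TopologicalSpace M] [T2Space M] [SecondCountableTopology M]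
    [MeasurableSpace M] [BorelSpace M] [SimplyConnectedSpace M]
    [ChartedSpace TorusData.E4 M] [IsManifold 𝓘(ℝ, TorusData.E4) ∞ M]
    [MulAction TorusData.Torus M]
    [ContMDiffSMul TorusData.torusModel 𝓘(ℝ, TorusData.E4) ∞ TorusData.Torus M]
    (D : TorusData.InitialData M) (i : Fin 2)
    (hj : ∀ p : M, D.j p (TorusData.generator i p) = 0) :
    (∀ (N : Set M) (S₁ S₂ : TorusData.Hypersurface D), S₁.IsInvariant → S₂.IsInvariant →
      TorusData.Bounds N S₁ S₂ →
      TorusData.angularMomentum i S₁ = TorusData.angularMomentum i S₂) ∧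
    (∀ (F : TorusData.EndChart M) (Sph : ℝ → TorusData.Hypersurface D),
      (∀ r, F.R < r → (Sph r).IsCoordSphere F r) →
      ∃ J : ℝ, Filter.Tendsto (fun r => TorusData.angularMomentum i (Sph r)) Filter.atTop (𝓝 J) ∧
        ∀ (N : Set M) (S : TorusData.Hypersurface D) (r : ℝ), F.R < r → S.IsInvariant →
          TorusData.Bounds N S (Sph r) → TorusData.angularMomentum i S = J) ∧
    (∃ Y : M → ℝ, ContMDiff 𝓘(ℝ, TorusData.E4) 𝓘(ℝ, ℝ) ∞ Y ∧
      ∀ (p : M) (w : TangentSpace 𝓘(ℝ, TorusData.E4) p),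
        TorusData.differential Y p w = 2 * D.twistForm i p w) := by
  have : LocallyCompactSpace M := ChartedSpace.locallyCompactSpace TorusData.E4 M
  refine ⟨fun N S₁ S₂ _ _ hB => hB.angularMomentum_eq hj, fun F Sph hSph => ?_,
    D.exists_twist_potential hj⟩
  have hlt : ∀ r₁ r₂, F.R < r₁ → r₁ < r₂ →
      TorusData.angularMomentum i (Sph r₁) = TorusData.angularMomentum i (Sph r₂) :=
    fun r₁ r₂ h₁ h₂ =>
      ((hSph r₁ h₁).bounds (hSph r₂ (h₁.trans h₂)) h₁ h₂).angularMomentum_eq hj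
  -- The angular momentum of coordinate spheres is constant in `r`; the radius `R + 1` is an
  -- arbitrary reference value.
  have hconst : ∀ r, F.R < r → TorusData.angularMomentum i (Sph r)
      = TorusData.angularMomentum i (Sph (F.R + 1)) := by
    intro r hr
    have h1 : F.R < F.R + 1 := lt_add_one _
    rcases lt_trichotomy r (F.R + 1) with h | h | h
    · exact hlt _ _ hr h
    · rw [h]
    · exact (hlt _ _ h1 h).symm
  refine ⟨TorusData.angularMomentum i (Sph (F.R + 1)), ?_, fun N S r hr _ hB => ?_⟩
  · refine tendsto_const_nhds.congr' ?_
    filter_upwards [Filter.eventually_gt_atTop F.R] with r hr using (hconst r hr).symm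
  · rw [hB.angularMomentum_eq hj, hconst r hr]
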